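/- Let $k$ be a commutative ring. **Categories.** A closed oriented $0$-manifold is a finite set of signed points. For closed oriented $0$-manifolds $Y_0,Y_1$ let $\mathcal Cob(Y_0,Y_1)$ be the additive closure of the $k$-linear category whose objects are compact oriented $1$-dimensional cobordisms $W:Y_0\to Y_1$ and whose morphisms $W_0\to W_1$ are formal $k$-linear combinations of diffeomorphism classes (relative to the boundary) of compact oriented $2$-bordisms with corners from $W_0$ to $W_1$, modulo the local relations: a surface with a sphere component is $0$; a torus component may be removed at the price of a factor $2$; and the four-tube relation $C_{12}+C_{34}=C_{13}+C_{24}$, where $C_{ij}$ is obtained from a surface with four chosen points by attaching a tube between the points $i$ and $j$. Gluing gives biadditive functors $$\ast:\mathcal Cob(Y_1,Y_2)\times \mathcal Cob(Y_0,Y_1)\to \mathcal Cob(Y_0,Y_2),\qquad \otimes:\mathcal Cob(Y_0,Y_1)\times\mathcal Cob(Y_0',Y_1')\to\mathcal Cob(Y_0\sqcup Y_0',Y_1\sqcup Y_1'),$$ which are extended to bounded cochain complexes by $F(X,X')^n=\bigoplus_{p+q=n}F(X^p,X'^q)$ with differential $F(d,\mathrm{id})+(-1)^pF(\mathrm{id},d)$.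 **Diagrams.** A singular tangle diagram $D$ is a tangle diagram in $\mathbb R\times[0,1]$ whose $4$-valent vertices are either crossings or double points; at a double point two neighbouring ends are incoming and the other two outgoing. It is used only through its underlying combinatorial map (vertices, edges, counterclockwise order of the ends at each vertex, boundary points); planarity is not needed. A checkerboard colouring $\chi$ colours the regions black and white such that adjacent regions have different colours. It orients every smoothing of $D$ as the boundary of the black regions; let $\partial^-D^\chi$ and $\partial^+D^\chi$ be the resulting bottom and top boundary $0$-manifolds, a point having sign $+$ iff the region to the west of it is black. **The bracket complex.** Order the set of all crossings and double points of $D$ in any way. For a set $\mathfrak r$ of double points let $D_{\mathfrak r}$ be the tangle diagram in which the double points in $\mathfrak r$ are resolved to positive crossings and the others to negative crossings. For a set $s$ of crossings of $D_{\mathfrak r}$ let $D_{\mathfrak r,s}^\chi$ be its smoothing with the $1$-smoothing at the crossings in $s$ and the $0$-smoothing at the others, oriented by $\chi$. The extended universal bracket complex $[\![D^\chi]\!]$ is the bounded complex in $\mathcal Cob(\partial^-D^\chi,\partial^+D^\chi)$ with one summand $D_{\mathfrak r,s}^\chi$ in degree $|s|+2|\mathfrak r|$ for each pair $(\mathfrak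 r,s)$, and whose differential has the following nonzero components: for each crossing $c\notin s$, the saddle $(\mathfrak r,s)\to(\mathfrak r,s\cup\{c\})$ times $(-1)^{\#\{a\in s\mid a<c\}}$; and for each double point $b\notin\mathfrak r$ with $b\in s$, the genus-one morphism $\Phi_b:(\mathfrak r,s)\to(\mathfrak r\cup\{b\},s\setminus\{b\})$ times $(-1)^{\#\{a\in s\mid a<b\}}$. Both of these smoothings have the oriented smoothing at $b$, and $\Phi_b$ is the identity bordism with a tube between the two strands at $b$ minus the identity bordism with a handle attached to the left strand at $b$. **Theorem.** 1. Let $D$ be the composition of two singular tangle diagrams $D'$ and $D''$, with $D''$ stacked on top of $D'$. Let $\chi$ be a checkerboard colouring of $D$ and let $\chi',\chi''$ be the induced colourings of $D',D''$. Then, for any orderings of the crossings and double points of $D$, $D'$ and $D''$, there is an isomorphism of cochain complexes $$[\![D^\chi]\!]\cong[\![D''^{\chi''}]\!]\ast[\![D'^{\chi'}]\!]$$ over $\mathcal Cob(\partial^-D^\chi,\partial^+D^\chi)=\mathcal Cob(\partial^-D'^{\chi'},\partial^+D''^{\chi''})$. 2. Let $D$ be the tensor product of two singular tangle diagrams $D'$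 and $D''$, with $D''$ placed to the right of $D'$. Let $\chi$ be a checkerboard colouring of $D$ and let $\chi',\chi''$ be the induced colourings of $D',D''$. Then, for any orderings of the crossings and double points of $D$, $D'$ and $D''$, there is an isomorphism of cochain complexes $$[\![D^\chi]\!]\cong[\![D'^{\chi'}]\!]\otimes[\![D''^{\chi''}]\!]$$ over $\mathcal Cob(\partial^-D^\chi,\partial^+D^\chi)=\mathcal Cob(\partial^-D'^{\chi'}\sqcup\partial^-D''^{\chi''},\partial^+D'^{\chi'}\sqcup\partial^+D''^{\chi''})$. -/

import Mathlib

/-!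
# Universal bracket complexes of singular tangle diagrams

Conventions.

* A surface with corners is recorded, up to diffeomorphism relative to its boundary, by its set of
  components, the component containing each boundary circle, and the genera of the components
  (classification of compact oriented surfaces): `Bordism`, `BHom`.
* To glue surfaces, components are joined along the glued arcs and circles and the genera are
  determined by the additivity of the Euler characteristic: `Pre` is a surface glued from pieces
  carrying relative Euler characteristics, `Pre.cls` its diffeomorphism class.  That the glued object
  is a surface (the resulting numbers are Euler characteristics of connected surfaces, i.e. `Pre.Surf`)
  rests on a count of the circles obtained from three systems of arcs (`Counting circles`).
* The categories `Cob k Z` of `1`-manifolds with boundary `Z` and bordisms modulo the sphere, torus and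
  four-tube relations, the gluing functors `Sew.biFun`, and complexes `FinCx` follow.
* Finally, singular tangle diagrams `SDiagram`, checkerboard colourings `Coloring` and their bracket
  complexes `Coloring.bracket` are defined, with the operations `SDiagram.comp`, `SDiagram.tensor` on
  diagrams, and `hcomp`, `otimes` on complexes.
-/

/-! ### Counting circles -/

section
open Module

theorem alt_even {M : Type*} [AddCommGroup M] [Module ℚ M] [FiniteDimensional ℚ M]
    (B : LinearMap.BilinForm ℚ M) (hB : ∀ x, B x x = 0) :
    ∃ m : ℕ, finrank ℚ M = finrank ℚ (LinearMap.ker B) + 2 * m := by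
  have hneg : ∀ x y, B y x = - B x y := fun x y => by
    have h := hB (x + y)
    simp only [map_add, LinearMap.add_apply, hB] at h
    linarith
  obtain ⟨W, hW⟩ := Submodule.exists_isCompl (LinearMap.ker B)
  have hdim := Submodule.finrank_add_eq_of_isCompl hW
  let b := Module.finBasis ℚ W
  let A : Matrix (Fin (finrank ℚ W)) (Fin (finrank ℚ W)) ℚ := fun i j => B (b i) (b j)
  have hA : A.transpose = -A := by
    ext i j; exact hneg (b i : M) (b j)
  have hdet : A.det ≠ 0 := by
    intro h0
    obtain ⟨v, hv, hv0⟩ := Matrix.exists_vecMul_eq_zero_iff.mpr h0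
    let w : W := ∑ i, v i • b i
    have hw : ∀ j, B w (b j) = 0 := by
      intro j
      have := congrFun hv0 j
      simpa [w, Matrix.vecMul, dotProduct, A, map_sum, LinearMap.sum_apply] using this
    have hwW : ∀ u : W, B w u = 0 := by
      intro u
      rw [← b.sum_repr u]
      simp only [Submodule.coe_sum, Submodule.coe_smul, map_sum, map_smul, hw, smul_zero,
        Finset.sum_const_zero]
    have hker : (w : M) ∈ LinearMap.ker B := by
      rw [LinearMap.mem_ker]
      ext u
      obtain ⟨x, hx, y, hy, rfl⟩ := Submodule.mem_sup.mp
        (hW.sup_eq_top ▸ Submodule.mem_top : u ∈ LinearMap.ker B ⊔ W)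
      have hx' : B x = 0 := hx
      rw [map_add, hneg x, hx', hwW ⟨y, hy⟩]; simp
    have h0 : w = 0 := by
      have := hW.disjoint.le_bot ⟨hker, w.2⟩
      exact Subtype.ext (by simpa using this)
    apply hv
    have := b.linearIndependent
    rw [Fintype.linearIndependent_iff] at this
    funext i; exact this v h0 i
  have hpow : (-1 : ℚ) ^ (finrank ℚ W) = 1 := by
    have h1 : A.det = (-1) ^ (finrank ℚ W) * A.det := by
      conv_lhs => rw [← Matrix.det_transpose, hA, Matrix.det_neg]
      simp
    have h2 : (1 - (-1 : ℚ) ^ (finrank ℚ W)) * A.det = 0 := by linarith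
    rcases mul_eq_zero.mp h2 with h | h
    · linarith
    · exact absurd h hdet
  have hev : Even (finrank ℚ W) := by
    by_contra ho
    rw [Nat.not_even_iff_odd] at ho
    rw [ho.neg_one_pow] at hpow; norm_num at hpow
  obtain ⟨m, hm⟩ := hev
  exact ⟨m, by omega⟩

section
variable {V : Type*} [AddCommGroup V] [Module ℚ V] [FiniteDimensional ℚ V]

theorem orth_inf_le (B : LinearMap.BilinForm ℚ V) (hs : B.IsSymm) (hn : B.Nondegenerate)
    (P Q : Submodule ℚ V) : B.orthogonal (P ⊓ Q) ≤ B.orthogonal P ⊔ B.orthogonal Q := by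
  have hr := hs.isRefl
  rw [← B.orthogonal_orthogonal hn hr (B.orthogonal P ⊔ B.orthogonal Q)]
  apply LinearMap.BilinForm.orthogonal_le
  refine le_inf ?_ ?_
  · conv_rhs => rw [← B.orthogonal_orthogonal hn hr P]
    exact LinearMap.BilinForm.orthogonal_le le_sup_left
  · conv_rhs => rw [← B.orthogonal_orthogonal hn hr Q]
    exact LinearMap.BilinForm.orthogonal_le le_sup_right

theorem lagrangian_triple (B : LinearMap.BilinForm ℚ V) (hs : B.IsSymm) (hn : B.Nondegenerate)
    (L₀ L₁ L₂ : Submodule ℚ V) (h₀ : B.orthogonal L₀ = L₀) (h₁ : B.orthogonal L₁ = L₁)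
    (h₂ : B.orthogonal L₂ = L₂) :
    ∃ m : ℕ, 2 * (finrank ℚ ↥(L₀ ⊓ L₁) + finrank ℚ ↥(L₁ ⊓ L₂) + finrank ℚ ↥(L₀ ⊓ L₂)) + 4 * m
      = finrank ℚ V + 4 * finrank ℚ ↥(L₀ ⊓ L₁ ⊓ L₂) := by
  have hr := hs.isRefl
  have iso₀ : ∀ x ∈ L₀, ∀ y ∈ L₀, B x y = 0 := fun x hx y hy => by
    rw [← h₀] at hy; exact hy x hx
  have iso₁ : ∀ x ∈ L₁, ∀ y ∈ L₁, B x y = 0 := fun x hx y hy => by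
    rw [← h₁] at hy; exact hy x hx
  have iso₂ : ∀ x ∈ L₂, ∀ y ∈ L₂, B x y = 0 := fun x hx y hy => by
    rw [← h₂] at hy; exact hy x hx
  have sym : ∀ x y, B x y = B y x := fun x y => hs.eq x y
  -- the space of pairs
  let M : Submodule ℚ (V × V) := (L₁.prod L₂) ⊓ L₀.comap (LinearMap.fst ℚ V V + LinearMap.snd ℚ V V)
  have hM : ∀ p : V × V, p ∈ M ↔ p.1 ∈ L₁ ∧ p.2 ∈ L₂ ∧ p.1 + p.2 ∈ L₀ := by
    intro p; simp [M, Submodule.mem_inf, Submodule.mem_prod, and_assoc]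
  let φ : LinearMap.BilinForm ℚ M :=
    (B.compl₁₂ ((LinearMap.fst ℚ V V).comp M.subtype) ((LinearMap.snd ℚ V V).comp M.subtype))
  have hφ : ∀ p q : M, φ p q = B p.1.1 q.1.2 := fun p q => rfl
  have halt : ∀ p, φ p p = 0 := by
    intro p
    obtain ⟨a, b, c⟩ := (hM _).1 p.2
    have := iso₀ _ c _ c
    simp only [map_add, LinearMap.add_apply, iso₁ _ a _ a, iso₂ _ b _ b,
      sym p.1.2 p.1.1] at this
    rw [hφ]; linarith
  obtain ⟨m, hm⟩ := alt_even φ halt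
  -- dimension of M
  let s : M →ₗ[ℚ] V := (LinearMap.fst ℚ V V + LinearMap.snd ℚ V V).comp M.subtype
  have hsr : LinearMap.range s = L₀ ⊓ (L₁ ⊔ L₂) := by
    apply le_antisymm
    · rintro _ ⟨p, rfl⟩
      obtain ⟨a, b, c⟩ := (hM _).1 p.2
      exact ⟨c, Submodule.add_mem_sup a b⟩
    · rintro x ⟨hx, hx'⟩
      obtain ⟨y, hy, z, hz, rfl⟩ := Submodule.mem_sup.mp hx'
      exact ⟨⟨(y, z), (hM _).2 ⟨hy, hz, hx⟩⟩, rfl⟩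
  have hsk : finrank ℚ (LinearMap.ker s) = finrank ℚ ↥(L₁ ⊓ L₂) := by
    let i : ↥(L₁ ⊓ L₂) →ₗ[ℚ] M := LinearMap.codRestrict M
      ((LinearMap.prod LinearMap.id (-LinearMap.id)).comp (L₁ ⊓ L₂).subtype)
      (fun x => (hM _).2 ⟨x.2.1, by simpa using x.2.2, by simp⟩)
    have hi : Function.Injective i := by
      intro x y h
      have := congrArg (fun p : M => p.1.1) h
      exact Subtype.ext this
    have : LinearMap.range i = LinearMap.ker s := by
      apply le_antisymm
      · rintro _ ⟨x, rfl⟩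
        rw [LinearMap.mem_ker]
        show (x : V) + -(x : V) = 0
        simp
      · intro p hp
        rw [LinearMap.mem_ker] at hp
        have hp' : p.1.1 + p.1.2 = 0 := hp
        obtain ⟨a, b, c⟩ := (hM _).1 p.2
        have e : p.1.2 = - p.1.1 := by rw [eq_neg_iff_add_eq_zero, add_comm]; exact hp'
        refine ⟨⟨p.1.1, a, ?_⟩, ?_⟩
        · rw [e] at b; simpa using b
        · apply Subtype.ext
          exact Prod.ext rfl e.symm
    rw [← this, LinearMap.finrank_range_of_inj hi]
  have hMdim := LinearMap.finrank_range_add_finrank_ker s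
  rw [hsr, hsk] at hMdim
  -- kernel of φ
  let Ψ : (↥(L₁ ⊓ L₂) × ↥(L₀ ⊓ L₁) × ↥(L₀ ⊓ L₂)) →ₗ[ℚ] M := LinearMap.codRestrict M
    { toFun := fun t => ((t.1 : V) + t.2.1, -(t.1 : V) + t.2.2)
      map_add' := fun a b => by ext <;> simp <;> abel
      map_smul' := fun c a => by ext <;> simp }
    (fun t => (hM _).2 ⟨L₁.add_mem t.1.2.1 t.2.1.2.2, L₂.add_mem (L₂.neg_mem t.1.2.2) t.2.2.2.2, by
      have : (t.1 : V) + t.2.1 + (-(t.1 : V) + t.2.2) = t.2.1 + t.2.2 := by abel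
      show (t.1 : V) + t.2.1 + (-(t.1 : V) + t.2.2) ∈ L₀
      rw [this]
      exact L₀.add_mem t.2.1.2.1 t.2.2.2.1⟩)
  have hΨ : ∀ t, (Ψ t : V × V) = ((t.1 : V) + t.2.1, -(t.1 : V) + t.2.2) := fun t => rfl
  have hΨr : LinearMap.range Ψ = LinearMap.ker φ := by
    apply le_antisymm
    · rintro _ ⟨t, rfl⟩
      rw [LinearMap.mem_ker]
      ext q
      obtain ⟨a, b, c⟩ := (hM _).1 q.2
      rw [hφ, hΨ]
      simp only [map_add, LinearMap.add_apply, LinearMap.zero_apply]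
      rw [iso₂ _ t.1.2.2 _ b]
      have h1 := iso₀ _ t.2.1.2.1 _ c
      rw [map_add, iso₁ _ t.2.1.2.2 _ a] at h1
      linarith
    · intro p hp
      rw [LinearMap.mem_ker] at hp
      obtain ⟨a, b, c⟩ := (hM _).1 p.2
      have h1 : p.1.1 ∈ B.orthogonal (L₂ ⊓ (L₀ ⊔ L₁)) := by
        rintro y ⟨hy, hy'⟩
        obtain ⟨u, hu, v, hv, rfl⟩ := Submodule.mem_sup.mp hy'
        have hq : ((-v, u + v) : V × V) ∈ M :=
          (hM _).2 ⟨L₁.neg_mem hv, hy, by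
            show -v + (u + v) ∈ L₀
            have : -v + (u + v) = u := by abel
            rwa [this]⟩
        have := congrArg (fun f => f ⟨_, hq⟩) hp
        simp only [hφ, LinearMap.zero_apply] at this
        show B (u + v) p.1.1 = 0
        rw [sym]; exact this
      have h2 := orth_inf_le B hs hn _ _ h1
      rw [h₂] at h2
      have h3 : B.orthogonal (L₀ ⊔ L₁) ≤ L₀ ⊓ L₁ := by
        refine le_inf ?_ ?_
        · conv_rhs => rw [← h₀]
          exact LinearMap.BilinForm.orthogonal_le le_sup_left
        · conv_rhs => rw [← h₁]
          exact LinearMap.BilinForm.orthogonal_le le_sup_right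
      obtain ⟨u, hu, v, hv, huv⟩ := Submodule.mem_sup.mp (sup_le_sup_left h3 _ h2)
      have hu1 : u ∈ L₁ := by
        have : u = p.1.1 - v := by rw [← huv]; abel
        rw [this]; exact L₁.sub_mem a hv.2
      have hw : u + p.1.2 ∈ L₀ ⊓ L₂ := by
        refine ⟨?_, L₂.add_mem hu b⟩
        have : u + p.1.2 = (p.1.1 + p.1.2) - v := by rw [← huv]; abel
        rw [this]; exact L₀.sub_mem c hv.1
      refine ⟨(⟨u, hu1, hu⟩, ⟨v, hv⟩, ⟨_, hw⟩), ?_⟩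
      apply Subtype.ext
      rw [hΨ]
      exact Prod.ext huv (by simp)
  have hΨk : finrank ℚ (LinearMap.ker Ψ) = finrank ℚ ↥(L₀ ⊓ L₁ ⊓ L₂) := by
    let i : ↥(L₀ ⊓ L₁ ⊓ L₂) →ₗ[ℚ] (↥(L₁ ⊓ L₂) × ↥(L₀ ⊓ L₁) × ↥(L₀ ⊓ L₂)) :=
      { toFun := fun x => (⟨x, x.2.1.2, x.2.2⟩, ⟨-(x : V), (L₀ ⊓ L₁).neg_mem x.2.1⟩, ⟨x, x.2.1.1, x.2.2⟩)
        map_add' := fun a b => by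
          refine Prod.ext (Subtype.ext rfl) (Prod.ext (Subtype.ext ?_) (Subtype.ext rfl))
          simp; abel
        map_smul' := fun c a => by
          refine Prod.ext (Subtype.ext rfl) (Prod.ext (Subtype.ext ?_) (Subtype.ext rfl))
          simp }
    have hi : Function.Injective i := by
      intro x y h
      have := congrArg (fun p => (p.1 : V)) h
      exact Subtype.ext this
    have : LinearMap.range i = LinearMap.ker Ψ := by
      apply le_antisymm
      · rintro _ ⟨x, rfl⟩
        rw [LinearMap.mem_ker]
        apply Subtype.ext
        rw [hΨ]
        simp [i]
      · intro t ht
        rw [LinearMap.mem_ker] at ht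
        have ht' := congrArg Subtype.val ht
        rw [hΨ] at ht'
        have e1 : (t.1 : V) + t.2.1 = 0 := congrArg Prod.fst ht'
        have e2 : -(t.1 : V) + t.2.2 = 0 := congrArg Prod.snd ht'
        have e1' : (t.2.1 : V) = -t.1 := by rw [eq_neg_iff_add_eq_zero, add_comm]; exact e1
        have e2' : (t.2.2 : V) = t.1 := by
          rw [neg_add_eq_zero] at e2; exact e2.symm
        refine ⟨⟨t.1, ⟨?_, t.1.2.1⟩, t.1.2.2⟩, ?_⟩
        · rw [← e2']; exact t.2.2.2.1
        · refine Prod.ext (Subtype.ext rfl) (Prod.ext (Subtype.ext e1'.symm) (Subtype.ext e2'.symm))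
    rw [← this, LinearMap.finrank_range_of_inj hi]
  have hΨd := LinearMap.finrank_range_add_finrank_ker Ψ
  rw [hΨr, hΨk, Module.finrank_prod, Module.finrank_prod] at hΨd
  -- dimension of L₀ ⊓ (L₁ ⊔ L₂)
  have hd : ∀ L : Submodule ℚ V, B.orthogonal L = L → 2 * finrank ℚ L = finrank ℚ V := by
    intro L hL
    have := B.finrank_add_finrank_orthogonal hr L
    rw [hL, B.orthogonal_top_eq_bot hn, inf_bot_eq, finrank_bot] at this
    omega
  have d0 := hd _ h₀
  have d1 := hd _ h₁
  have d2 := hd _ h₂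
  have d3 := Submodule.finrank_sup_add_finrank_inf_eq L₀ (L₁ ⊓ L₂)
  have e1 : B.orthogonal (L₀ ⊔ (L₁ ⊓ L₂)) = L₀ ⊓ (L₁ ⊔ L₂) := by
    apply le_antisymm
    · refine le_inf ?_ ?_
      · conv_rhs => rw [← h₀]
        exact LinearMap.BilinForm.orthogonal_le le_sup_left
      · refine (LinearMap.BilinForm.orthogonal_le le_sup_right).trans ?_
        refine (orth_inf_le B hs hn _ _).trans ?_
        rw [h₁, h₂]
    · rintro x ⟨hx, hx'⟩ y hy
      obtain ⟨u, hu, v, hv, rfl⟩ := Submodule.mem_sup.mp hy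
      obtain ⟨z, hz, w, hw, rfl⟩ := Submodule.mem_sup.mp hx'
      show B (u + v) (z + w) = 0
      have t := iso₀ _ hu _ hx
      rw [LinearMap.map_add B, LinearMap.add_apply, t, map_add, iso₁ _ hv.1 _ hz,
        iso₂ _ hv.2 _ hw]; simp
  have d4 := B.finrank_add_finrank_orthogonal hr (L₀ ⊔ (L₁ ⊓ L₂))
  rw [e1, B.orthogonal_top_eq_bot hn, inf_bot_eq, finrank_bot] at d4
  rw [← inf_assoc] at d3
  exact ⟨m, by omega⟩
end

/-- Real-valued functions on `K` that are constant along the relation `r`. -/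
def invFun {K : Type} (r : K → K → Prop) : Submodule ℚ (K → ℚ) where
  carrier := {f | ∀ x y, r x y → f x = f y}
  add_mem' hf hg x y h := by simp [hf x y h, hg x y h]
  zero_mem' _ _ _ := rfl
  smul_mem' c f hf x y h := by simp [hf x y h]

theorem finrank_invFun {K : Type} [Finite K] (r : K → K → Prop) :
    finrank ℚ (invFun r) = Nat.card (Quot r) := by
  have : Fintype (Quot r) := Fintype.ofFinite _
  let E : invFun r ≃ₗ[ℚ] (Quot r → ℚ) :=
    { toFun := fun f => Quot.lift f.1 f.2
      map_add' := fun f g => by funext q; induction q using Quot.ind; rfl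
      map_smul' := fun c f => by funext q; induction q using Quot.ind; rfl
      invFun := fun g => ⟨fun x => g (Quot.mk r x), fun x y h => congrArg g (Quot.sound h)⟩
      left_inv := fun f => rfl
      right_inv := fun g => by funext q; induction q using Quot.ind; rfl }
  rw [E.finrank_eq, Module.finrank_fintype_fun_eq_card, Nat.card_eq_fintype_card]

/-- An orientation-reversing involution. -/
structure Flip {K : Type} (o : K → Bool) (σ : K → K) : Prop where
  inv : ∀ x, σ (σ x) = x
  flip : ∀ x, o (σ x) = !o x

theorem Flip.ne {K : Type} {o : K → Bool} {σ : K → K} (h : Flip o σ) (x : K) : σ x ≠ x := by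
  intro e; have := h.flip x; rw [e] at this; simp at this

/-- The relation whose classes are the joint orbits of two maps. -/
def Joint {K : Type} (σ τ : K → K) (x y : K) : Prop := y = σ x ∨ y = τ x

theorem joint_left {K : Type} (σ τ : K → K) (k : K) :
    Quot.mk (Joint σ τ) (σ k) = Quot.mk (Joint σ τ) k := (Quot.sound (show Joint σ τ k (σ k) from Or.inl rfl)).symm

theorem joint_right {K : Type} (σ τ : K → K) (k : K) :
    Quot.mk (Joint σ τ) (τ k) = Quot.mk (Joint σ τ) k := (Quot.sound (show Joint σ τ k (τ k) from Or.inr rfl)).symm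

theorem mem_invFun_joint {K : Type} (σ τ : K → K) (f : K → ℚ) :
    f ∈ invFun (Joint σ τ) ↔ (∀ x, f (σ x) = f x) ∧ (∀ x, f (τ x) = f x) := by
  constructor
  · intro hf
    exact ⟨fun x => (hf x _ (Or.inl rfl)).symm, fun x => (hf x _ (Or.inr rfl)).symm⟩
  · rintro ⟨a, b⟩ x y (rfl | rfl)
    exacts [(a x).symm, (b x).symm]

section
variable {K : Type} [Finite K] {o : K → Bool}

theorem triple_count {σ τ ρ : K → K} (hσ : Flip o σ) (hτ : Flip o τ) (hρ : Flip o ρ) 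
    {r₀₁ r₁₂ r₀₂ r₃ : K → K → Prop}
    (h₀₁ : ∀ f : K → ℚ, f ∈ invFun r₀₁ ↔ (∀ x, f (σ x) = f x) ∧ (∀ x, f (τ x) = f x))
    (h₁₂ : ∀ f : K → ℚ, f ∈ invFun r₁₂ ↔ (∀ x, f (τ x) = f x) ∧ (∀ x, f (ρ x) = f x))
    (h₀₂ : ∀ f : K → ℚ, f ∈ invFun r₀₂ ↔ (∀ x, f (σ x) = f x) ∧ (∀ x, f (ρ x) = f x))
    (h₃ : ∀ f : K → ℚ, f ∈ invFun r₃ ↔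
      ((∀ x, f (σ x) = f x) ∧ (∀ x, f (τ x) = f x)) ∧ (∀ x, f (ρ x) = f x)) :
    ∃ m : ℕ, 2 * (Nat.card (Quot r₀₁) + Nat.card (Quot r₁₂) + Nat.card (Quot r₀₂)) + 4 * m
      = Nat.card K + 4 * Nat.card (Quot r₃) := by
  classical
  have : Fintype K := Fintype.ofFinite K
  let s : K → ℚ := fun x => if o x then 1 else -1
  have hs2 : ∀ x, s x * s x = 1 := by intro x; simp only [s]; split <;> norm_num
  have hs0 : ∀ x, s x ≠ 0 := by intro x h; have := hs2 x; rw [h] at this; norm_num at this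
  let B : LinearMap.BilinForm ℚ (K → ℚ) := LinearMap.mk₂ ℚ (fun f g => ∑ x, s x * f x * g x)
    (by intro a b c; simp only [Pi.add_apply, ← Finset.sum_add_distrib]
        exact Finset.sum_congr rfl fun x _ => by ring)
    (by intro a b c; simp only [Pi.smul_apply, smul_eq_mul, Finset.mul_sum]
        exact Finset.sum_congr rfl fun x _ => by ring)
    (by intro a b c; simp only [Pi.add_apply, ← Finset.sum_add_distrib]
        exact Finset.sum_congr rfl fun x _ => by ring)
    (by intro a b c; simp only [Pi.smul_apply, smul_eq_mul, Finset.mul_sum]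
        exact Finset.sum_congr rfl fun x _ => by ring)
  have hB : ∀ f g, B f g = ∑ x, s x * f x * g x := fun f g => rfl
  have hsym : B.IsSymm := ⟨fun f g => by
    rw [hB, hB]; exact Finset.sum_congr rfl fun x _ => by ring⟩
  have hsep : ∀ f, (∀ g, B f g = 0) → f = 0 := by
    intro f hf
    funext x
    have := hf (Pi.single x 1)
    rw [hB, Finset.sum_eq_single x] at this
    · simpa [hs0] using this
    · intro y _ hy; simp [hy]
    · simp
  have hnd : B.Nondegenerate := by
    refine ⟨hsep, fun f hf => hsep f fun g => ?_⟩
    have := hsym.eq f g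
    rw [this]; exact hf g
  let S : (K → K) → Submodule ℚ (K → ℚ) := fun α =>
    { carrier := {f | ∀ x, f (α x) = f x}
      add_mem' := fun hf hg x => by simp [hf x, hg x]
      zero_mem' := fun _ => rfl
      smul_mem' := fun c f hf x => by simp [hf x] }
  have hS : ∀ α, Flip o α → B.orthogonal (S α) = S α := by
    intro α hα
    apply le_antisymm
    · intro f hf x
      have := hf (Pi.single x 1 + Pi.single (α x) 1) (by
        intro y
        simp only [Pi.add_apply, Pi.single_apply]
        by_cases h1 : y = x
        · subst h1; simp [hα.ne, (hα.ne y).symm]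
        · by_cases h2 : y = α x
          · subst h2; simp [hα.inv, hα.ne, (hα.ne x).symm]
          · have h3 : α y ≠ x := fun h => h2 (by rw [← h, hα.inv])
            have h4 : α y ≠ α x := fun h => h1 (by rw [← hα.inv y, h, hα.inv])
            simp [h1, h2, h3, h4])
      have h2 : s (α x) = - s x := by
        simp only [s, hα.flip]; cases o x <;> simp
      have : B (Pi.single x 1 + Pi.single (α x) 1) f = s x * f x + s (α x) * f (α x) := by
        rw [hB]
        simp only [Pi.add_apply, mul_add, add_mul, Finset.sum_add_distrib]
        congr 1
        · rw [Finset.sum_eq_single x] <;> simp +contextual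
        · rw [Finset.sum_eq_single (α x)] <;> simp +contextual
      have h3 : s x * f x + s (α x) * f (α x) = 0 := by
        rw [← this]; assumption
      rw [h2] at h3
      have h4 : s x * (f x - f (α x)) = 0 := by linarith
      rcases mul_eq_zero.mp h4 with h | h
      · exact absurd h (hs0 x)
      · linarith
    · intro f hf g hg
      show B g f = 0
      rw [hB]
      have : ∑ x, s x * g x * f x = ∑ x, s (α x) * g (α x) * f (α x) :=
        (Equiv.sum_comp (⟨α, α, hα.inv, hα.inv⟩ : K ≃ K) fun x => s x * g x * f x).symm
      have h2 : ∑ x, s (α x) * g (α x) * f (α x) = - ∑ x, s x * g x * f x := by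
        rw [← Finset.sum_neg_distrib]
        refine Finset.sum_congr rfl fun x _ => ?_
        have h2 : s (α x) = - s x := by
          simp only [s, hα.flip]; cases o x <;> simp
        rw [hf x, hg x, h2]; ring
      linarith
  obtain ⟨m, hm⟩ := lagrangian_triple B hsym hnd (S σ) (S τ) (S ρ) (hS _ hσ) (hS _ hτ) (hS _ hρ)
  have e₀₁ : S σ ⊓ S τ = invFun r₀₁ := by ext f; exact (h₀₁ f).symm
  have e₁₂ : S τ ⊓ S ρ = invFun r₁₂ := by ext f; exact (h₁₂ f).symm
  have e₀₂ : S σ ⊓ S ρ = invFun r₀₂ := by ext f; exact (h₀₂ f).symm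
  have e₃ : S σ ⊓ S τ ⊓ S ρ = invFun r₃ := by ext f; exact (h₃ f).symm
  rw [e₃, e₀₁, e₁₂, e₀₂, finrank_invFun, finrank_invFun, finrank_invFun, finrank_invFun,
    Module.finrank_fintype_fun_eq_card] at hm
  exact ⟨m, by rw [Nat.card_eq_fintype_card (α := K)]; exact hm⟩

/-- Orbit count for two commuting fixed-point free involutions. -/
theorem commuting_count {τ ρ : K → K} (hτ : Flip o τ) (hρ : Flip o ρ)
    (hc : ∀ x, τ (ρ x) = ρ (τ x)) {r : K → K → Prop}
    (h : ∀ f : K → ℚ, f ∈ invFun r ↔ (∀ x, f (τ x) = f x) ∧ (∀ x, f (ρ x) = f x)) :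
    4 * Nat.card (Quot r) = Nat.card K + Nat.card {x // τ x = ρ x} := by
  classical
  have : Fintype K := Fintype.ofFinite K
  let P : (K → ℚ) →ₗ[ℚ] (K → ℚ) :=
    { toFun := fun f x => (f x + f (τ x) + f (ρ x) + f (τ (ρ x))) / 4
      map_add' := fun f g => by funext x; simp only [Pi.add_apply]; ring
      map_smul' := fun c f => by
        funext x; simp only [Pi.smul_apply, smul_eq_mul, RingHom.id_apply]; ring }
  have hP : LinearMap.IsProj (invFun r) P := by
    constructor
    · intro f
      rw [h]
      constructor <;> intro x
      · show (f _ + f _ + f _ + f _) / 4 = (f _ + f _ + f _ + f _) / 4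
        rw [hτ.inv, ← hc, hτ.inv]; ring
      · show (f _ + f _ + f _ + f _) / 4 = (f _ + f _ + f _ + f _) / 4
        rw [hρ.inv, hc]; ring
    · intro f hf
      rw [h] at hf
      funext x
      show (f _ + f _ + f _ + f _) / 4 = f x
      rw [hf.1, hf.1, hf.2]; ring
  have ht := hP.trace
  rw [finrank_invFun, LinearMap.trace_eq_matrix_trace ℚ (Pi.basisFun ℚ K), Matrix.trace] at ht
  have hd : ∀ x, (LinearMap.toMatrix (Pi.basisFun ℚ K) (Pi.basisFun ℚ K) P).diag x
      = (1 + if τ x = ρ x then 1 else 0) / 4 := by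
    intro x
    have e1 : τ (ρ x) = x ↔ τ x = ρ x :=
      ⟨fun e => by conv_lhs => rw [← e, hτ.inv], fun e => by rw [← e, hτ.inv]⟩
    simp only [Matrix.diag, LinearMap.toMatrix_apply, Pi.basisFun_repr, Pi.basisFun_apply]
    have e2 : P (Pi.single x 1) x = ((Pi.single x 1 : K → ℚ) x + (Pi.single x 1 : K → ℚ) (τ x)
      + (Pi.single x 1 : K → ℚ) (ρ x) + (Pi.single x 1 : K → ℚ) (τ (ρ x))) / 4 := rfl
    rw [e2]
    simp [Pi.single_apply, hτ.ne, hρ.ne, e1]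
  rw [Finset.sum_congr rfl fun x _ => hd x, ← Finset.sum_div, Finset.sum_add_distrib,
    Finset.sum_boole] at ht
  have : Nat.card {x // τ x = ρ x} = (Finset.univ.filter fun x => τ x = ρ x).card := by
    rw [Nat.card_eq_fintype_card, Fintype.card_subtype]
  rw [this, Nat.card_eq_fintype_card (α := K)]
  simp at ht
  have h4 : (4 : ℚ) * Nat.card (Quot r) =
      Fintype.card K + (Finset.univ.filter fun x => τ x = ρ x).card := by
    rw [← ht]; ring
  exact_mod_cast h4

/-- Genus count when the boundary gluing pattern `τ` of a surface is replaced by `ρ`. -/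
theorem reglue_count {σ τ ρ : K → K} (hσ : Flip o σ) (hτ : Flip o τ) (hρ : Flip o ρ) 
    (hc : ∀ x, τ (ρ x) = ρ (τ x))
    {V : Type} [Finite V] (p : K → V) (hpσ : ∀ x, p (σ x) = p x) (hpτ : ∀ x, p (τ x) = p x)
    (hconn : ∀ φ : V → ℚ, (∀ x, φ (p (ρ x)) = φ (p x)) → ∀ v w, φ v = φ w) :
    ∃ m : ℕ, 8 * Nat.card V + 8 * m + 4 * Nat.card (Quot (Joint σ ρ)) + Nat.card {x // τ x = ρ x}
      = 8 + 4 * Nat.card (Quot (Joint σ τ)) + Nat.card K := by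
  classical
  have : Fintype K := Fintype.ofFinite K
  have : Fintype V := Fintype.ofFinite V
  have h := mem_invFun_joint σ τ
  have h' := mem_invFun_joint σ ρ
  set r := Joint σ τ
  set r' := Joint σ ρ
  let r12 : K → K → Prop := Joint τ ρ
  let r3 : K → K → Prop := fun x y => (y = σ x ∨ y = τ x) ∨ y = ρ x
  have h12 := mem_invFun_joint τ ρ
  have h3 : ∀ f : K → ℚ, f ∈ invFun r3 ↔
      ((∀ x, f (σ x) = f x) ∧ (∀ x, f (τ x) = f x)) ∧ (∀ x, f (ρ x) = f x) := by
    intro f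
    constructor
    · intro hf
      exact ⟨⟨fun x => (hf x _ (Or.inl (Or.inl rfl))).symm,
        fun x => (hf x _ (Or.inl (Or.inr rfl))).symm⟩, fun x => (hf x _ (Or.inr rfl)).symm⟩
    · rintro ⟨⟨a, b⟩, c⟩ x y ((rfl | rfl) | rfl)
      exacts [(a x).symm, (b x).symm, (c x).symm]
  obtain ⟨m, hm⟩ := triple_count hσ hτ hρ h h12 h' h3
  have hQ := commuting_count hτ hρ hc h12
  -- the connectivity bound
  let F : (V → ℚ) →ₗ[ℚ] (invFun r) := LinearMap.codRestrict _ (LinearMap.funLeft ℚ ℚ p)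
    (fun φ => (h _).2 ⟨fun x => congrArg φ (hpσ x), fun x => congrArg φ (hpτ x)⟩)
  let T : Submodule ℚ (invFun r) := (invFun r3).comap (invFun r).subtype
  have hT : finrank ℚ T = Nat.card (Quot r3) := by
    rw [← finrank_invFun]
    refine LinearEquiv.finrank_eq (Submodule.comapSubtypeEquivOfLe ?_)
    intro f hf
    exact (h f).2 ((h3 f).1 hf).1
  let G := T.mkQ.comp F
  have hG := LinearMap.finrank_range_add_finrank_ker G
  rw [Module.finrank_fintype_fun_eq_card] at hG
  have hker : finrank ℚ (LinearMap.ker G) ≤ 1 := by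
    rcases isEmpty_or_nonempty V with hV | ⟨⟨v₀⟩⟩
    · have : Fintype.card V = 0 := Fintype.card_eq_zero
      omega
    · refine (LinearMap.finrank_le_finrank_of_injective
        (f := (LinearMap.proj v₀ : (V → ℚ) →ₗ[ℚ] ℚ).comp (LinearMap.ker G).subtype) ?_).trans
        (by rw [finrank_self])
      intro a b hab
      apply Subtype.ext
      have key : ∀ c : LinearMap.ker G, ∀ v w, c.1 v = c.1 w := by
        intro c
        have hc' : F c.1 ∈ T := by
          have := c.2
          rw [LinearMap.mem_ker] at this
          exact (Submodule.Quotient.mk_eq_zero T).mp this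
        exact hconn c.1 ((h3 _).1 hc').2
      funext v
      rw [key a v v₀, key b v v₀]; exact hab
  have hrange : finrank ℚ (LinearMap.range G) + Nat.card (Quot r3) ≤ Nat.card (Quot r) := by
    have h1 := Submodule.finrank_quotient_add_finrank T
    rw [hT, finrank_invFun] at h1
    have h2 := Submodule.finrank_le (LinearMap.range G)
    omega
  rw [Nat.card_eq_fintype_card (α := V)]
  refine ⟨m + (1 + Nat.card (Quot r) - Nat.card (Quot r3) - Fintype.card V), ?_⟩
  omega
end

/-! ### Counting in fibres -/

section
open scoped Classical in
/-- Push an integer weight forward along a map of finite sets. -/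
noncomputable def pushW {X Y : Type} [Finite X] (g : X → Y) (w : X → ℤ) (y : Y) : ℤ :=
  letI := Fintype.ofFinite X
  ∑ x, if g x = y then w x else 0

open scoped Classical in
theorem pushW_eq {X Y : Type} [Fintype X] (g : X → Y) (w : X → ℤ) (y : Y) :
    pushW g w y = ∑ x, if g x = y then w x else 0 := by
  unfold pushW; congr!

theorem pushW_add {X Y : Type} [Finite X] (g : X → Y) (w w' : X → ℤ) (y : Y) :
    pushW g (fun x => w x + w' x) y = pushW g w y + pushW g w' y := by
  have := Fintype.ofFinite X
  classical
  simp only [pushW_eq, ← Finset.sum_add_distrib]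
  exact Finset.sum_congr rfl fun x _ => by split <;> simp

theorem pushW_mul {X Y : Type} [Finite X] (g : X → Y) (a : ℤ) (w : X → ℤ) (y : Y) :
    pushW g (fun x => a * w x) y = a * pushW g w y := by
  have := Fintype.ofFinite X
  classical
  simp only [pushW_eq, Finset.mul_sum]
  exact Finset.sum_congr rfl fun x _ => by split <;> simp

theorem pushW_zero {X Y : Type} [Finite X] (g : X → Y) (y : Y) :
    pushW g (fun _ => 0) y = 0 := by
  have := Fintype.ofFinite X
  classical
  simp [pushW_eq]

theorem pushW_pushW {X Y C : Type} [Finite X] [Finite Y] (g : X → Y) (h : Y → C) (w : X → ℤ)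
    (c : C) : pushW h (pushW g w) c = pushW (fun x => h (g x)) w c := by
  have := Fintype.ofFinite X
  have := Fintype.ofFinite Y
  classical
  have e : pushW g w = fun y => ∑ x, if g x = y then w x else 0 := by
    funext y; rw [pushW_eq]
  rw [e, pushW_eq, pushW_eq]
  have : ∀ y, (if h y = c then ∑ x, (if g x = y then w x else 0) else 0)
      = ∑ x, if g x = y then (if h y = c then w x else 0) else 0 := by
    intro y; split <;> simp
  rw [Finset.sum_congr rfl fun y _ => this y, Finset.sum_comm]
  exact Finset.sum_congr rfl fun x _ => by simp

theorem pushW_sum {X X' Y : Type} [Finite X] [Finite X'] (g : X ⊕ X' → Y) (w : X ⊕ X' → ℤ) (y : Y) :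
    pushW g w y = pushW (fun x => g (Sum.inl x)) (fun x => w (Sum.inl x)) y
      + pushW (fun x => g (Sum.inr x)) (fun x => w (Sum.inr x)) y := by
  have := Fintype.ofFinite X
  have := Fintype.ofFinite X'
  classical
  simp [pushW_eq]

theorem pushW_equiv {X X' Y : Type} [Finite X] [Finite X'] (φ : X ≃ X') (g : X' → Y)
    (w : X' → ℤ) (y : Y) : pushW (fun x => g (φ x)) (fun x => w (φ x)) y = pushW g w y := by
  have := Fintype.ofFinite X
  have := Fintype.ofFinite X'
  classical
  simp only [pushW_eq]
  exact Equiv.sum_comp φ fun x => if g x = y then w x else 0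

theorem pushW_inj {X Y C : Type} [Finite X] (g : X → Y) (φ : Y → C) (hφ : Function.Injective φ)
    (w : X → ℤ) (y : Y) : pushW (fun x => φ (g x)) w (φ y) = pushW g w y := by
  have := Fintype.ofFinite X
  classical
  simp only [pushW_eq, hφ.eq_iff]

theorem pushW_self {X Y : Type} [Finite X] (g : X → Y) (hg : Function.Injective g) (w : X → ℤ)
    (x : X) : pushW g w (g x) = w x := by
  have := Fintype.ofFinite X
  classical
  simp [pushW_eq, hg.eq_iff]

/-- The size of a fibre. -/
noncomputable def cnt {X Y : Type} (g : X → Y) (y : Y) : ℕ := Nat.card {x // g x = y}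

theorem pushW_one {X Y : Type} [Finite X] (g : X → Y) (y : Y) :
    pushW g (fun _ => 1) y = cnt g y := by
  have := Fintype.ofFinite X
  classical
  rw [pushW_eq, cnt, Nat.card_eq_fintype_card, Fintype.card_subtype, Finset.sum_boole]

theorem pushW_cnt {X Y C : Type} [Finite X] [Finite Y] (g : X → Y) (h : Y → C) (c : C) :
    pushW h (fun y => (cnt g y : ℤ)) c = cnt (fun x => h (g x)) c := by
  have : (fun y => (cnt g y : ℤ)) = pushW g (fun _ => 1) := by
    funext y; rw [pushW_one]
  rw [this, pushW_pushW, pushW_one]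

theorem cnt_sum {X X' Y : Type} [Finite X] [Finite X'] (g : X ⊕ X' → Y) (y : Y) :
    cnt g y = cnt (fun x => g (Sum.inl x)) y + cnt (fun x => g (Sum.inr x)) y := by
  have := pushW_sum g (fun _ => 1) y
  simp only [pushW_one] at this
  exact_mod_cast this

theorem cnt_congr {X X' Y Y' : Type} (φ : X ≃ X') (g : X → Y) (g' : X' → Y') (y : Y) (y' : Y')
    (h : ∀ x, g x = y ↔ g' (φ x) = y') : cnt g y = cnt g' y' :=
  Nat.card_congr (φ.subtypeEquiv h)

/-- Mutually inverse maps up to the relations give a bijection of quotients. -/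
def quotEquiv {A B : Type} {r : A → A → Prop} {s : B → B → Prop} (g : A → B) (h : B → A)
    (hg : ∀ x y, r x y → Quot.mk s (g x) = Quot.mk s (g y))
    (hh : ∀ x y, s x y → Quot.mk r (h x) = Quot.mk r (h y))
    (hgh : ∀ x, Quot.mk r (h (g x)) = Quot.mk r x)
    (hhg : ∀ x, Quot.mk s (g (h x)) = Quot.mk s x) : Quot r ≃ Quot s where
  toFun := Quot.lift (fun x => Quot.mk s (g x)) hg
  invFun := Quot.lift (fun x => Quot.mk r (h x)) hh
  left_inv q := by induction q using Quot.ind; exact hgh _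
  right_inv q := by induction q using Quot.ind; exact hhg _

theorem card_quot_sub {K C : Type} (r : K → K → Prop) (q : Quot r → C) (c : C) :
    Nat.card (Quot fun a b : {k // q (Quot.mk r k) = c} => r a b) = cnt q c := by
  classical
  let f : (Quot fun a b : {k // q (Quot.mk r k) = c} => r a b) → {x // q x = c} :=
    Quot.lift (fun a => ⟨Quot.mk r a.1, a.2⟩) (fun a b h => Subtype.ext (Quot.sound h))
  let G : Quot r → Option (Quot fun a b : {k // q (Quot.mk r k) = c} => r a b) :=
    Quot.lift (fun k => if h : q (Quot.mk r k) = c then some (Quot.mk _ ⟨k, h⟩) else none) (by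
      intro a b h
      by_cases ha : q (Quot.mk r a) = c
      · have hb : q (Quot.mk r b) = c := by rw [← ha, Quot.sound h]
        simp only [ha, hb, dite_true]
        exact congrArg some (Quot.sound h)
      · have hb : ¬ q (Quot.mk r b) = c := by rwa [← Quot.sound h]
        simp only [ha, hb, dite_false])
  have hG : ∀ x, G (f x).1 = some x := by
    intro x
    induction x using Quot.ind with
    | mk a => exact dif_pos a.2
  refine Nat.card_eq_of_bijective f ⟨fun x y h => ?_, ?_⟩
  · exact Option.some.inj (by rw [← hG, ← hG, h])
  · rintro ⟨x, hx⟩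
    induction x using Quot.ind with
    | mk a => exact ⟨Quot.mk _ ⟨a, hx⟩, rfl⟩

theorem Flip.cnt_even {K C : Type} [Finite K] {o : K → Bool} {σ : K → K} (h : Flip o σ)
    (q : K → C) (hq : ∀ k, q (σ k) = q k) (c : C) :
    (cnt q c : ℤ) = 2 * pushW q (fun k => if o k then 1 else 0) c := by
  have e := pushW_equiv (⟨σ, σ, h.inv, h.inv⟩ : K ≃ K) q (fun k => if o k then 1 else 0) c
  simp only [Equiv.coe_fn_mk, hq, h.flip] at e
  rw [two_mul, ← pushW_one]
  nth_rewrite 1 [← e]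
  rw [← pushW_add]
  congr 1
  funext k; cases o k <;> simp

theorem Flip.cnt_joint {K C : Type} [Finite K] {o : K → Bool} {σ : K → K} (h : Flip o σ)
    (q : Quot (Joint σ σ) → C) (c : C) : cnt (fun k => q (Quot.mk _ k)) c = 2 * cnt q c := by
  let σ' : {k // q (Quot.mk _ k) = c} → {k // q (Quot.mk _ k) = c} := fun k => ⟨σ k, 
    (congrArg q (joint_left _ _ _)).trans k.2⟩
  have hσ' : Flip (fun k : {k // q (Quot.mk _ k) = c} => o k) σ' :=
    ⟨fun x => Subtype.ext (h.inv _), fun x => h.flip _⟩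
  have e := commuting_count hσ' hσ' (fun _ => rfl) (mem_invFun_joint σ' σ')
  have e2 : Joint σ' σ' = fun a b : {k // q (Quot.mk _ k) = c} => Joint σ σ a b := by
    funext a b; exact propext (or_congr Subtype.ext_iff Subtype.ext_iff)
  rw [e2, card_quot_sub] at e
  have e3 : Nat.card {x // σ' x = σ' x} = Nat.card {k // q (Quot.mk _ k) = c} :=
    Nat.card_congr (Equiv.subtypeUnivEquiv fun _ => rfl)
  rw [e3] at e
  have e4 : cnt (fun k => q (Quot.mk _ k)) c = Nat.card {k // q (Quot.mk _ k) = c} := rfl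
  omega

theorem commuting_class {K C : Type} [Finite K] {o : K → Bool} {τ ρ : K → K} (hτ : Flip o τ)
    (hρ : Flip o ρ) (hc : ∀ x, τ (ρ x) = ρ (τ x)) (q : Quot (Joint τ ρ) → C) (c : C) :
    4 * cnt q c = cnt (fun k => q (Quot.mk _ k)) c
      + cnt (fun k : {x // τ x = ρ x} => q (Quot.mk _ k.1)) c := by
  let τ' : {k // q (Quot.mk _ k) = c} → {k // q (Quot.mk _ k) = c} := fun k => ⟨τ k, 
    (congrArg q (joint_left _ _ _)).trans k.2⟩
  let ρ' : {k // q (Quot.mk _ k) = c} → {k // q (Quot.mk _ k) = c} := fun k => ⟨ρ k, 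
    (congrArg q (joint_right _ _ _)).trans k.2⟩
  have hτ' : Flip (fun k : {k // q (Quot.mk _ k) = c} => o k) τ' :=
    ⟨fun x => Subtype.ext (hτ.inv _), fun x => hτ.flip _⟩
  have hρ' : Flip (fun k : {k // q (Quot.mk _ k) = c} => o k) ρ' :=
    ⟨fun x => Subtype.ext (hρ.inv _), fun x => hρ.flip _⟩
  have e := commuting_count hτ' hρ' (fun x => Subtype.ext (hc _)) (mem_invFun_joint τ' ρ')
  have e2 : Joint τ' ρ' = fun a b : {k // q (Quot.mk _ k) = c} => Joint τ ρ a b := by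
    funext a b; exact propext (or_congr Subtype.ext_iff Subtype.ext_iff)
  rw [e2, card_quot_sub] at e
  have e3 : Nat.card {x // τ' x = ρ' x} = cnt (fun k : {x // τ x = ρ x} => q (Quot.mk _ k.1)) c :=
    Nat.card_congr
      { toFun := fun x => ⟨⟨x.1.1, congrArg Subtype.val x.2⟩, x.1.2⟩
        invFun := fun x => ⟨⟨x.1.1, x.2⟩, Subtype.ext x.1.2⟩
        left_inv := fun _ => rfl
        right_inv := fun _ => rfl }
  rw [e3] at e
  exact e

/-- `reglue_count` in one class `c`. -/
theorem reglue_class {K C V : Type} [Finite K] [Finite V] {o : K → Bool} {σ τ ρ : K → K}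
    (hσ : Flip o σ) (hτ : Flip o τ) (hρ : Flip o ρ) (hc : ∀ x, τ (ρ x) = ρ (τ x))
    (p : Quot (Joint σ τ) → V) (π : V → C) (q : Quot (Joint σ ρ) → C)
    (hq : ∀ k, q (Quot.mk _ k) = π (p (Quot.mk _ k)))
    (hconn : ∀ φ : V → ℚ, (∀ x, φ (p (Quot.mk _ (ρ x))) = φ (p (Quot.mk _ x))) →
      ∀ v w, π v = π w → φ v = φ w) (c : C) :
    ∃ m : ℕ, 8 * cnt π c + 8 * m + 4 * cnt q c
        + cnt (fun k : {x // τ x = ρ x} => q (Quot.mk _ k.1)) c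
      = 8 + 4 * cnt (fun x => π (p x)) c + cnt (fun k => q (Quot.mk _ k)) c := by
  classical
  let K' := {k // q (Quot.mk _ k) = c}
  have q1 : ∀ k, q (Quot.mk _ (σ k)) = q (Quot.mk _ k) := fun k =>
    congrArg q (joint_left _ _ _)
  have q2 : ∀ k, q (Quot.mk _ (ρ k)) = q (Quot.mk _ k) := fun k =>
    congrArg q (joint_right _ _ _)
  have p1 : ∀ k, p (Quot.mk _ (σ k)) = p (Quot.mk _ k) := fun k =>
    congrArg p (joint_left _ _ _)
  have p2 : ∀ k, p (Quot.mk _ (τ k)) = p (Quot.mk _ k) := fun k =>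
    congrArg p (joint_right _ _ _)
  have q3 : ∀ k, q (Quot.mk _ (τ k)) = q (Quot.mk _ k) := fun k => by rw [hq, hq, p2]
  let σ' : K' → K' := fun k => ⟨σ k, (q1 k).trans k.2⟩
  let τ' : K' → K' := fun k => ⟨τ k, (q3 k).trans k.2⟩
  let ρ' : K' → K' := fun k => ⟨ρ k, (q2 k).trans k.2⟩
  have hσ' : Flip (fun k : K' => o k) σ' := ⟨fun x => Subtype.ext (hσ.inv _), fun x => hσ.flip _⟩
  have hτ' : Flip (fun k : K' => o k) τ' := ⟨fun x => Subtype.ext (hτ.inv _), fun x => hτ.flip _⟩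
  have hρ' : Flip (fun k : K' => o k) ρ' := ⟨fun x => Subtype.ext (hρ.inv _), fun x => hρ.flip _⟩
  obtain ⟨m, hm⟩ := reglue_count hσ' hτ' hρ' (fun x => Subtype.ext (hc _))
    (V := {v // π v = c}) (fun k => ⟨p (Quot.mk _ k.1), by rw [← hq]; exact k.2⟩)
    (fun x => Subtype.ext (p1 _)) (fun x => Subtype.ext (p2 _))
    (by
      intro φ hφ v w
      let ψ : V → ℚ := fun v => if h : π v = c then φ ⟨v, h⟩ else 0
      have hψ : ∀ v : {v // π v = c}, ψ v.1 = φ v := fun v => dif_pos v.2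
      rw [← hψ, ← hψ]
      refine hconn ψ ?_ _ _ (v.2.trans w.2.symm)
      intro x
      by_cases hx : q (Quot.mk _ x) = c
      · have h1 : π (p (Quot.mk _ x)) = c := by rw [← hq]; exact hx
        have h2 : π (p (Quot.mk _ (ρ x))) = c := by rw [← hq, q2]; exact hx
        have := hφ ⟨x, hx⟩
        simp only [ψ, h1, h2, dite_true]
        exact this
      · have h1 : ¬ π (p (Quot.mk _ x)) = c := by rw [← hq]; exact hx
        have h2 : ¬ π (p (Quot.mk _ (ρ x))) = c := by rw [← hq, q2]; exact hx
        simp only [ψ, h1, h2, dite_false])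
  refine ⟨m, ?_⟩
  have e1 : Joint σ' ρ' = fun a b : K' => Joint σ ρ a b := by
    funext a b; exact propext (or_congr Subtype.ext_iff Subtype.ext_iff)
  have e2 : Nat.card {x // τ' x = ρ' x}
      = cnt (fun k : {x // τ x = ρ x} => q (Quot.mk _ k.1)) c :=
    Nat.card_congr
      { toFun := fun x => ⟨⟨x.1.1, congrArg Subtype.val x.2⟩, x.1.2⟩
        invFun := fun x => ⟨⟨x.1.1, x.2⟩, Subtype.ext x.1.2⟩
        left_inv := fun _ => rfl
        right_inv := fun _ => rfl }
  have e3 : Nat.card (Quot (Joint σ' τ')) = cnt (fun x => π (p x)) c := by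
    rw [← card_quot_sub (Joint σ τ) (fun x => π (p x)) c]
    refine Nat.card_congr (Quot.congr (Equiv.subtypeEquivRight fun k => by rw [hq]) ?_)
    intro a b
    exact or_congr Subtype.ext_iff Subtype.ext_iff
  rw [e1, e2, card_quot_sub, e3] at hm
  exact hm
end

end

/-! ### Oriented 0-manifolds, 1-manifolds and 2-bordisms -/

/-- A closed oriented `0`-manifold: a finite set of points with signs (`true` is `+`). -/
structure Signed where
  pt : Type
  [fin : Finite pt]
  pos : pt → Bool

attribute [instance] Signed.fin

namespace Signed
/-- Orientation reversal. -/
def neg (Y : Signed) : Signed := ⟨Y.pt, fun y => !Y.pos y⟩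
/-- Disjoint union. -/
def sum (Y Y' : Signed) : Signed := ⟨Y.pt ⊕ Y'.pt, Sum.elim Y.pos Y'.pos⟩
end Signed

/-- A compact oriented `1`-manifold with boundary points `Z`, cut into finitely many intervals.
An *end* (of an interval) is either one of the ends `J` at an interior cut point, or lies at a
boundary point.  The involution `e` exchanges the two ends of each interval, the involution `l`
exchanges the two ends meeting at an interior cut point.  The orientation `o` says whether the
manifold runs from the given end into its interval (`true`), or towards the end (`false`);
at a boundary point `z` it runs into the manifold iff `Z.pos z`. -/
structure OneMfd (Z : Signed) where
  J : Type
  [fin : Finite J]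
  e : J ⊕ Z.pt → J ⊕ Z.pt
  l : J → J
  o : J → Bool
  e_e : ∀ x, e (e x) = x
  e_o : ∀ x, Sum.elim o Z.pos (e x) = !Sum.elim o Z.pos x
  l_l : ∀ j, l (l j) = j
  l_o : ∀ j, o (l j) = !o j

attribute [instance] OneMfd.fin

section
variable {Z : Signed}

namespace OneMfd
/-- The set of all ends. -/
abbrev H (W : OneMfd Z) : Type := W.J ⊕ Z.pt
/-- The orientation on all ends. -/
def dir (W : OneMfd Z) : W.H → Bool := Sum.elim W.o Z.pos
theorem flipE (W : OneMfd Z) : Flip W.dir W.e := ⟨W.e_e, W.e_o⟩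
theorem flipL (W : OneMfd Z) : Flip W.o W.l := ⟨W.l_l, W.l_o⟩
end OneMfd

variable (W₀ W₁ W₂ : OneMfd Z)

/-- Edges of the closed `1`-manifold `∂S = -W₀ ∪ Z × [0,1] ∪ W₁`. -/
def bdE : W₀.H ⊕ W₁.H → W₀.H ⊕ W₁.H := Sum.map W₀.e W₁.e

/-- Cut points of the closed `1`-manifold `∂S = -W₀ ∪ Z × [0,1] ∪ W₁`. -/
def bdL : W₀.H ⊕ W₁.H → W₀.H ⊕ W₁.H
  | .inl (.inl j) => .inl (.inl (W₀.l j))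
  | .inl (.inr z) => .inr (.inr z)
  | .inr (.inl j) => .inr (.inl (W₁.l j))
  | .inr (.inr z) => .inl (.inr z)

/-- The set of circles of the closed `1`-manifold `∂S = -W₀ ∪ Z × [0,1] ∪ W₁`. -/
abbrev BdCirc : Type := Quot (Joint (bdE W₀ W₁) (bdL W₀ W₁))

/-- The orientation of `∂S` (with a global sign). -/
def bdO : W₀.H ⊕ W₁.H → Bool := Sum.elim W₀.dir (fun x => !W₁.dir x)

theorem flip_bdE : Flip (bdO W₀ W₁) (bdE W₀ W₁) := by
  constructor
  · rintro (x | x) <;> simp [bdE, W₀.e_e, W₁.e_e]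
  · rintro (x | x)
    · exact W₀.e_o x
    · exact congrArg (fun b => !b) (W₁.e_o x)

theorem flip_bdL : Flip (bdO W₀ W₁) (bdL W₀ W₁) := by
  constructor
  · rintro ((x | x) | (x | x)) <;> simp [bdL, W₀.l_l, W₁.l_l]
  · rintro ((x | x) | (x | x)) <;> simp [bdL, bdO, OneMfd.dir, W₀.l_o, W₁.l_o]

/-- A `2`-bordism `S : W₀ → W₁`, i.e. a compact oriented surface with corners with
`∂S = -W₀ ∪ Z × [0,1] ∪ W₁`, recorded up to diffeomorphism relative to the boundary:
its set of components `C`, the component `bd x` containing each boundary circle `x`, and the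
genus of each component. -/
structure Bordism where
  C : Type
  [fin : Finite C]
  bd : BdCirc W₀ W₁ → C
  genus : C → ℕ

attribute [instance] Bordism.fin

variable {W₀ W₁ W₂}

/-- The number of arcs of `W₀` (equally of `W₁`) in the component `c`: each arc has exactly one
boundary point at which it starts. -/
noncomputable def arcs {C : Type} (b : BdCirc W₀ W₁ → C) (c : C) : ℕ :=
  cnt (fun z : {z // Z.pos z = true} => b (Quot.mk _ (.inl (.inr z.1)))) c

/-- The Euler characteristic `2 - 2g - #(boundary circles)` of a component, relative to `W₀`:
`χ(S_c, W₀ ∩ S_c) = χ(S_c) - χ(W₀ ∩ S_c)`. This number is additive under gluing. -/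
noncomputable def Bordism.relEuler (S : Bordism W₀ W₁) (c : S.C) : ℤ :=
  2 - 2 * S.genus c - cnt S.bd c - arcs S.bd c

/-- Diffeomorphism of bordisms relative to the boundary. -/
def Bordism.Iso (S S' : Bordism W₀ W₁) : Prop :=
  ∃ φ : S.C ≃ S'.C, (∀ x, φ (S.bd x) = S'.bd x) ∧ ∀ c, S'.genus (φ c) = S.genus c

instance Bordism.setoid (W₀ W₁ : OneMfd Z) : Setoid (Bordism W₀ W₁) where
  r := Bordism.Iso
  iseqv :=
    { refl := fun S => ⟨Equiv.refl _, fun _ => rfl, fun _ => rfl⟩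
      symm := fun ⟨φ, h, h'⟩ => ⟨φ.symm, fun x => by rw [← h]; simp, fun c => by rw [← h']; simp⟩
      trans := fun ⟨φ, h, h'⟩ ⟨ψ, k, k'⟩ => ⟨φ.trans ψ, fun x => by simp [h, k],
        fun c => by simp [h', k']⟩ }

/-- Diffeomorphism classes of `2`-bordisms. -/
def BHom (W₀ W₁ : OneMfd Z) : Type 1 := Quotient (Bordism.setoid W₀ W₁)

/-- The weights `w` are relative Euler characteristics of connected oriented surfaces. -/
def IsSurf {C : Type} (b : BdCirc W₀ W₁ → C) (w : C → ℤ) : Prop :=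
  ∀ c, ∃ g : ℕ, w c = 2 - 2 * g - cnt b c - arcs b c

theorem arcs_pushW {C : Type} (b : BdCirc W₀ W₁ → C) (c : C) :
    (arcs b c : ℤ) = pushW (fun z => b (Quot.mk _ (.inl (.inr z))))
      (fun z => if Z.pos z then 1 else 0) c := by
  have := Fintype.ofFinite Z.pt
  classical
  rw [arcs, cnt, Nat.card_congr (Equiv.subtypeSubtypeEquivSubtypeInter _
    (fun z => b (Quot.mk _ (.inl (.inr z))) = c)), Nat.card_eq_fintype_card, Fintype.card_subtype,
    pushW_eq, ← Finset.sum_boole]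
  refine Finset.sum_congr rfl fun x _ => ?_
  by_cases h : Z.pos x <;> simp [h]

/-- The number of boundary points in a component is twice the number of arcs. -/
theorem arcs_double {C : Type} (W : OneMfd Z) (q : W.H → C) (he : ∀ x, q (W.e x) = q x)
    (hl : ∀ j, q (.inl (W.l j)) = q (.inl j)) (c : C) :
    (cnt (fun z => q (.inr z)) c : ℤ)
      = 2 * pushW (fun z => q (.inr z)) (fun z => if Z.pos z then 1 else 0) c := by
  have h1 := W.flipE.cnt_even q he c
  have h2 := W.flipL.cnt_even (fun j => q (.inl j)) hl c
  rw [cnt_sum, pushW_sum] at h1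
  simp only [OneMfd.dir, Sum.elim_inl, Sum.elim_inr] at h1
  have h3 : (cnt (fun x => q (Sum.inl x)) c : ℤ) + (cnt (fun x => q (Sum.inr x)) c : ℤ) =
      2 * (pushW (fun x => q (Sum.inl x)) (fun x => if W.o x = true then 1 else 0) c +
        pushW (fun x => q (Sum.inr x)) (fun x => if Z.pos x = true then 1 else 0) c) := by
    exact_mod_cast h1
  have h4 : (cnt (fun x => q (Sum.inl x)) c : ℤ)
    = 2 * pushW (fun x => q (Sum.inl x)) (fun x => if W.o x = true then 1 else 0) c := h2
  rw [h4, mul_add] at h3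
  exact add_left_cancel h3

/-- A surface glued from finitely many pieces `X`, identified along `r`. -/
structure Pre (W₀ W₁ : OneMfd Z) where
  X : Type
  [fin : Finite X]
  r : X → X → Prop
  f : W₀.H ⊕ W₁.H → X
  hE : ∀ k, Quot.mk r (f (bdE W₀ W₁ k)) = Quot.mk r (f k)
  hL : ∀ k, Quot.mk r (f (bdL W₀ W₁ k)) = Quot.mk r (f k)
  w : X → ℤ

attribute [instance] Pre.fin

namespace Pre

/-- The component containing a boundary circle. -/
def bd (P : Pre W₀ W₁) : BdCirc W₀ W₁ → Quot P.r :=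
  Quot.lift (fun k => Quot.mk P.r (P.f k)) (by
    rintro x y (rfl | rfl)
    · exact (P.hE x).symm
    · exact (P.hL x).symm)

/-- All components of the glued object are surfaces. -/
def Surf (P : Pre W₀ W₁) : Prop := IsSurf P.bd (pushW (Quot.mk P.r) P.w)

/-- The resulting bordism. -/
noncomputable def toB (P : Pre W₀ W₁) (hP : P.Surf) : Bordism W₀ W₁ where
  C := Quot P.r
  bd := P.bd
  genus c := (hP c).choose

theorem toB_relEuler (P : Pre W₀ W₁) (hP : P.Surf) (c : Quot P.r) :
    (P.toB hP).relEuler c = pushW (Quot.mk P.r) P.w c := ((hP c).choose_spec).symm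

/-- The diffeomorphism class of the resulting bordism. -/
noncomputable def cls (P : Pre W₀ W₁) (hP : P.Surf) : BHom W₀ W₁ := Quotient.mk _ (P.toB hP)

end Pre

theorem arcs_equiv {C C' : Type} (b : BdCirc W₀ W₁ → C) (b' : BdCirc W₀ W₁ → C') (φ : C ≃ C')
    (h : ∀ x, φ (b x) = b' x) (c : C) : arcs b' (φ c) = arcs b c :=
  (cnt_congr (Equiv.refl _) _ _ _ _ fun z => by simp [← h]).symm

theorem cnt_equiv {C C' : Type} (b : BdCirc W₀ W₁ → C) (b' : BdCirc W₀ W₁ → C') (φ : C ≃ C')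
    (h : ∀ x, φ (b x) = b' x) (c : C) : cnt b' (φ c) = cnt b c :=
  (cnt_congr (Equiv.refl _) _ _ _ _ fun z => by simp [← h]).symm

theorem Bordism.iso_of_relEuler {S S' : Bordism W₀ W₁} (φ : S.C ≃ S'.C)
    (h : ∀ x, φ (S.bd x) = S'.bd x) (h' : ∀ c, S'.relEuler (φ c) = S.relEuler c) : S.Iso S' := by
  refine ⟨φ, h, fun c => ?_⟩
  have := h' c
  unfold relEuler at this
  rw [arcs_equiv _ _ φ h, cnt_equiv _ _ φ h] at this
  omega

theorem Bordism.Iso.relEuler {S S' : Bordism W₀ W₁} (h : S.Iso S') :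
    ∃ φ : S.C ≃ S'.C, (∀ x, φ (S.bd x) = S'.bd x) ∧ ∀ c, S'.relEuler (φ c) = S.relEuler c := by
  obtain ⟨φ, h, h'⟩ := h
  refine ⟨φ, h, fun c => ?_⟩
  unfold Bordism.relEuler
  rw [arcs_equiv _ _ φ h, cnt_equiv _ _ φ h, h']

/-- A bordism as glued from its components. -/
noncomputable def Bordism.toPre (S : Bordism W₀ W₁) : Pre W₀ W₁ where
  X := S.C
  r := fun _ _ => False
  f := fun k => S.bd (Quot.mk _ k)
  hE k := by rw [joint_left]
  hL k := by rw [joint_right]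
  w := S.relEuler

theorem quot_false_inj {X : Type} {x y : X}
    (h : Quot.mk (fun _ _ : X => False) x = Quot.mk (fun _ _ => False) y) : x = y :=
  congrArg (Quot.lift id (fun _ _ h => h.elim)) h

/-- Quotient by the empty relation. -/
def quotFalse (X : Type) : X ≃ Quot (fun _ _ : X => False) where
  toFun := Quot.mk _
  invFun := Quot.lift id (fun _ _ h => h.elim)
  left_inv _ := rfl
  right_inv q := by induction q using Quot.ind; rfl

theorem Bordism.toPre_surf (S : Bordism W₀ W₁) : S.toPre.Surf := by
  intro c
  obtain ⟨c, rfl⟩ := (quotFalse S.C).surjective c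
  refine ⟨S.genus c, ?_⟩
  have e : ∀ x, quotFalse S.C (S.bd x) = S.toPre.bd x := by
    intro x; induction x using Quot.ind; rfl
  have e1 := arcs_equiv S.bd S.toPre.bd (quotFalse S.C) e c
  have e2 := cnt_equiv S.bd S.toPre.bd (quotFalse S.C) e c
  refine (pushW_self (quotFalse S.C) (quotFalse S.C).injective S.relEuler c).trans ?_
  unfold Bordism.relEuler
  rw [← e1, ← e2]
  rfl

namespace Pre

/-- Criterion for two glued surfaces to be diffeomorphic. -/
theorem iso_toB {P P' : Pre W₀ W₁} (hP : P.Surf) (hP' : P'.Surf) (g : P.X → P'.X) (h : P'.X → P.X)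
    (hg : ∀ x y, P.r x y → Quot.mk P'.r (g x) = Quot.mk P'.r (g y))
    (hh : ∀ x y, P'.r x y → Quot.mk P.r (h x) = Quot.mk P.r (h y))
    (hgh : ∀ x, Quot.mk P.r (h (g x)) = Quot.mk P.r x)
    (hhg : ∀ x, Quot.mk P'.r (g (h x)) = Quot.mk P'.r x)
    (hf : ∀ k, Quot.mk P'.r (g (P.f k)) = Quot.mk P'.r (P'.f k))
    (hw : ∀ c, pushW (fun x => Quot.mk P'.r (g x)) P.w c = pushW (Quot.mk P'.r) P'.w c) :
    (P.toB hP).Iso (P'.toB hP') := by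
  refine Bordism.iso_of_relEuler (quotEquiv g h hg hh hgh hhg) ?_ ?_
  · intro x
    induction x using Quot.ind
    exact hf _
  · intro c
    refine ((P'.toB_relEuler hP' _).trans ?_).trans (P.toB_relEuler hP c).symm
    refine (hw _).symm.trans ?_
    exact pushW_inj (Quot.mk P.r) (quotEquiv g h hg hh hgh hhg)
      (quotEquiv g h hg hh hgh hhg).injective P.w c

theorem cls_eq {P P' : Pre W₀ W₁} (hP : P.Surf) (hP' : P'.Surf) (g : P.X → P'.X) (h : P'.X → P.X)
    (hg : ∀ x y, P.r x y → Quot.mk P'.r (g x) = Quot.mk P'.r (g y))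
    (hh : ∀ x y, P'.r x y → Quot.mk P.r (h x) = Quot.mk P.r (h y))
    (hgh : ∀ x, Quot.mk P.r (h (g x)) = Quot.mk P.r x)
    (hhg : ∀ x, Quot.mk P'.r (g (h x)) = Quot.mk P'.r x)
    (hf : ∀ k, Quot.mk P'.r (g (P.f k)) = Quot.mk P'.r (P'.f k))
    (hw : ∀ c, pushW (fun x => Quot.mk P'.r (g x)) P.w c = pushW (Quot.mk P'.r) P'.w c) :
    P.cls hP = P'.cls hP' := Quotient.sound (iso_toB hP hP' g h hg hh hgh hhg hf hw)

end Pre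

theorem Bordism.cls_toPre (S : Bordism W₀ W₁) :
    S.toPre.cls S.toPre_surf = Quotient.mk _ S := by
  refine Quotient.sound ?_
  refine Setoid.symm (Bordism.iso_of_relEuler (quotFalse S.C) ?_ ?_)
  · intro x; induction x using Quot.ind; rfl
  · intro c
    refine (Pre.toB_relEuler _ S.toPre_surf _).trans ?_
    exact pushW_self (quotFalse S.C) (quotFalse S.C).injective S.relEuler c

theorem BHom.exists_pre (a : BHom W₀ W₁) : ∃ (P : Pre W₀ W₁) (hP : P.Surf), P.cls hP = a := by
  induction a using Quotient.ind with
  | _ S => exact ⟨S.toPre, S.toPre_surf, S.cls_toPre⟩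

/-! ### Identities -/

/-- Two ends lie at the same interval or at the same cut point of `W`. -/
inductive OneMfd.Rel (W : OneMfd Z) : W.H → W.H → Prop
  | e (x : W.H) : W.Rel x (W.e x)
  | l (j : W.J) : W.Rel (.inl j) (.inl (W.l j))

theorem OneMfd.mk_e (W : OneMfd Z) (x : W.H) : Quot.mk W.Rel (W.e x) = Quot.mk W.Rel x :=
  (Quot.sound (.e x)).symm

theorem OneMfd.mk_l (W : OneMfd Z) (j : W.J) :
    Quot.mk W.Rel (.inl (W.l j)) = Quot.mk W.Rel (.inl j) := (Quot.sound (.l j)).symm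

/-- The trivial bordism `W × [0,1]`. -/
def Pre.one (W : OneMfd Z) : Pre W W where
  X := W.H
  r := W.Rel
  f := Sum.elim id id
  hE := by rintro (x | x) <;> exact W.mk_e x
  hL := by
    rintro ((j | z) | (j | z))
    exacts [W.mk_l j, rfl, W.mk_l j, rfl]
  w := fun _ => 0

end

section
variable {Z : Signed}

/-- Interchange the two copies of `W` in the boundary of `W × [0,1]`. -/
theorem flip_swap (W : OneMfd Z) : Flip (bdO W W) Sum.swap :=
  ⟨by rintro (x | x) <;> rfl, by rintro (x | x) <;> simp [bdO]⟩

/-- The points of `Z × {0, 1}` inside `∂ (W × [0,1])`. -/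
def swapFix (W : OneMfd Z) : Z.pt ⊕ Z.pt ≃ {x : W.H ⊕ W.H // Sum.swap x = bdL W W x} where
  toFun := Sum.elim (fun z => ⟨.inl (.inr z), rfl⟩) (fun z => ⟨.inr (.inr z), rfl⟩)
  invFun
    | ⟨.inl (.inr z), _⟩ => .inl z
    | ⟨.inr (.inr z), _⟩ => .inr z
    | ⟨.inl (.inl _), h⟩ => by simp [bdL] at h
    | ⟨.inr (.inl _), h⟩ => by simp [bdL] at h
  left_inv := by rintro (x | x) <;> rfl
  right_inv := by
    rintro ⟨(j | z) | (j | z), h⟩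
    · simp [bdL] at h
    · rfl
    · simp [bdL] at h
    · rfl

theorem one_count (W : OneMfd Z) (b : BdCirc W W → Quot W.Rel)
    (hb : ∀ k, b (Quot.mk _ k) = Quot.mk W.Rel (Sum.elim id id k)) (c : Quot W.Rel) :
    ∃ m : ℕ, (0 : ℤ) = 2 - 2 * m - cnt b c - arcs b c := by
  have hrel : ∀ k : W.H ⊕ W.H, Quot.mk W.Rel (Sum.elim id id (Sum.map W.e W.e k))
      = Quot.mk W.Rel (Sum.elim id id k) := by
    rintro (x | x) <;> exact W.mk_e x
  have hsw : ∀ k : W.H ⊕ W.H, Quot.mk W.Rel (Sum.elim id id (Sum.swap k))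
      = Quot.mk W.Rel (Sum.elim id id k) := by
    rintro (x | x) <;> rfl
  let π : Quot (Joint (bdE W W) Sum.swap) → Quot W.Rel :=
    Quot.lift (fun k => Quot.mk W.Rel (Sum.elim id id k)) (by
      rintro x y (rfl | rfl)
      · exact (hrel x).symm
      · exact (hsw x).symm)
  have hbπ : ∀ k, b (Quot.mk _ k) = π (Quot.mk _ k) := hb
  obtain ⟨m, hm⟩ := reglue_class (flip_bdE W W) (flip_swap W) (flip_bdL W W)
    (by rintro ((j | z) | (j | z)) <;> rfl) id π b hb
    (by
      intro φ hφ v w hvw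
      have h1 : ∀ x y, W.Rel x y → φ (Quot.mk _ (.inl x)) = φ (Quot.mk _ (.inl y)) := by
        rintro x y (x | j)
        · exact congrArg φ (joint_left (bdE W W) _ (.inl x)).symm
        · exact (hφ (.inl (.inl j))).symm
      have h2 : ∀ v, φ v = Quot.lift (fun x => φ (Quot.mk _ (.inl x))) h1 (π v) := by
        intro v
        induction v using Quot.ind with
        | mk v =>
          rcases v with x | x
          · rfl
          · exact congrArg φ (joint_right (bdE W W) _ (.inl x))
      rw [h2 v, h2 w, hvw]) c
  have h4 := commuting_class (flip_bdE W W) (flip_swap W) (by rintro (x | x) <;> rfl) π c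
  have h5 : cnt (fun k : {x // bdE W W x = Sum.swap x} => π (Quot.mk _ k.1)) c = 0 := by
    have : IsEmpty {x // bdE W W x = Sum.swap x} := ⟨by rintro ⟨x | x, h⟩ <;> simp [bdE] at h⟩
    unfold cnt
    exact Nat.card_of_isEmpty
  have h6 : cnt (fun k : {x : W.H ⊕ W.H // Sum.swap x = bdL W W x} =>
      b (Quot.mk _ k.1)) c = 2 * cnt (fun z => Quot.mk W.Rel (.inr z)) c := by
    rw [← cnt_congr (swapFix W) (Sum.elim (fun z => Quot.mk W.Rel (.inr z))
      (fun z => Quot.mk W.Rel (.inr z))) _ c c, cnt_sum, two_mul]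
    · simp only [Sum.elim_inl, Sum.elim_inr]
    · rintro (x | x) <;> (rw [hb]; exact Iff.rfl)
  have h7 := arcs_double W (Quot.mk W.Rel) W.mk_e W.mk_l c
  have h8 := arcs_pushW b c
  have h9 : (arcs b c : ℤ) * 2 = cnt (fun z => Quot.mk W.Rel (.inr z)) c := by
    rw [h8, mul_comm, h7]
    simp only [hb]
    rfl
  have h10 : cnt (fun k => b (Quot.mk _ k)) c = cnt (fun k => π (Quot.mk _ k)) c := by
    simp only [hbπ]
  have h11 : cnt (fun x => π (id x)) c = cnt π c := rfl
  refine ⟨m, ?_⟩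
  rw [h6, h10, h11] at hm
  rw [h5] at h4
  omega

theorem Pre.one_surf (W : OneMfd Z) : (Pre.one W).Surf := fun c => by
  obtain ⟨m, hm⟩ := one_count W (Pre.one W).bd (fun _ => rfl) c
  exact ⟨m, (pushW_zero _ _).trans hm⟩

end

/-! ### Vertical composition of bordisms -/

section
variable {Z : Signed} {W₀ W₁ W₂ : OneMfd Z}

/-- Push forward the surface condition to unions of components. -/
theorem IsSurf.push {V C : Type} [Finite V] {b : BdCirc W₀ W₁ → V} {w : V → ℤ} (h : IsSurf b w)
    (π : V → C) (c : C) : ∃ G : ℕ, pushW π w c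
      = 2 * cnt π c - 2 * G - cnt (fun x => π (b x)) c - arcs (fun x => π (b x)) c := by
  choose g hg using h
  have : Fintype V := Fintype.ofFinite V
  classical
  refine ⟨∑ v, if π v = c then g v else 0, ?_⟩
  have e1 : w = fun v => ((2 * 1 + (-2) * (g v : ℤ)) + (-1) * cnt b v) + (-1) * arcs b v := by
    funext v; rw [hg]; ring
  rw [e1, pushW_add, pushW_add, pushW_add, pushW_mul, pushW_mul, pushW_mul, pushW_mul, pushW_one,
    pushW_cnt]
  have e2 : pushW π (fun v => (arcs b v : ℤ)) c = arcs (fun x => π (b x)) c := by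
    exact pushW_cnt _ _ _
  have e3 : pushW π (fun v => (g v : ℤ)) c = ((∑ v, if π v = c then g v else 0 : ℕ) : ℤ) := by
    rw [pushW_eq]; push_cast; rfl
  rw [e2, e3]; ring

/-- The joint orbits of a disjoint union of two pairs of maps. -/
def quotJointSum {A B : Type} (σ τ : A → A) (σ' τ' : B → B) :
    Quot (Joint (Sum.map σ σ') (Sum.map τ τ')) ≃ Quot (Joint σ τ) ⊕ Quot (Joint σ' τ') where
  toFun := Quot.lift (Sum.map (Quot.mk _) (Quot.mk _)) (by
    rintro (x | x) y (rfl | rfl)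
    · exact congrArg Sum.inl (joint_left σ τ x).symm
    · exact congrArg Sum.inl (joint_right σ τ x).symm
    · exact congrArg Sum.inr (joint_left σ' τ' x).symm
    · exact congrArg Sum.inr (joint_right σ' τ' x).symm)
  invFun := Sum.elim
    (Quot.lift (fun x => Quot.mk _ (.inl x)) (by
      rintro x y (rfl | rfl)
      · exact (joint_left (Sum.map σ σ') (Sum.map τ τ') (.inl x)).symm
      · exact (joint_right (Sum.map σ σ') (Sum.map τ τ') (.inl x)).symm))
    (Quot.lift (fun x => Quot.mk _ (.inr x)) (by
      rintro x y (rfl | rfl)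
      · exact (joint_left (Sum.map σ σ') (Sum.map τ τ') (.inr x)).symm
      · exact (joint_right (Sum.map σ σ') (Sum.map τ τ') (.inr x)).symm))
  left_inv q := by
    induction q using Quot.ind with
    | mk x => rcases x with x | x <;> rfl
  right_inv q := by
    rcases q with q | q <;> (induction q using Quot.ind; rfl)

/-- The gluing of two boundaries along `W₁`. -/
def midSwap (W₀ W₁ W₂ : OneMfd Z) :
    (W₀.H ⊕ W₁.H) ⊕ (W₁.H ⊕ W₂.H) → (W₀.H ⊕ W₁.H) ⊕ (W₁.H ⊕ W₂.H)
  | .inl (.inl x) => .inl (.inl (W₀.e x))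
  | .inl (.inr x) => .inr (.inl x)
  | .inr (.inl x) => .inl (.inr x)
  | .inr (.inr x) => .inr (.inr (W₂.e x))

theorem Flip.sum {A B : Type} {o : A → Bool} {o' : B → Bool} {σ : A → A} {σ' : B → B}
    (h : Flip o σ) (h' : Flip o' σ') : Flip (Sum.elim o o') (Sum.map σ σ') :=
  ⟨by rintro (x | x) <;> simp [h.inv, h'.inv], by rintro (x | x) <;> simp [h.flip, h'.flip]⟩

theorem flip_midSwap : Flip (Sum.elim (bdO W₀ W₁) (bdO W₁ W₂)) (midSwap W₀ W₁ W₂) := by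
  constructor
  · rintro ((x | x) | (x | x)) <;> simp [midSwap, W₀.e_e, W₂.e_e]
  · rintro ((x | x) | (x | x))
    · exact W₀.e_o x
    · simp [midSwap, bdO]
    · simp [midSwap, bdO]
    · exact congrArg (fun b => !b) (W₂.e_o x)

/-- The circles after gluing along `W₁`: those of the new boundary, and one closed-up link for each
cut point of `W₁`. -/
def midCirc (W₀ W₁ W₂ : OneMfd Z) :
    Quot (Joint (Sum.map (bdL W₀ W₁) (bdL W₁ W₂)) (midSwap W₀ W₁ W₂)) ≃
      BdCirc W₀ W₂ ⊕ Quot (Joint W₁.l W₁.l) where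
  toFun := Quot.lift
    (fun x => match x with
      | .inl (.inl x) => .inl (Quot.mk _ (.inl x))
      | .inl (.inr (.inr z)) => .inl (Quot.mk _ (.inl (.inr z)))
      | .inr (.inl (.inr z)) => .inl (Quot.mk _ (.inl (.inr z)))
      | .inr (.inr x) => .inl (Quot.mk _ (.inr x))
      | .inl (.inr (.inl j)) => .inr (Quot.mk _ j)
      | .inr (.inl (.inl j)) => .inr (Quot.mk _ j)) (by
      rintro (((j | z) | (j | z)) | ((j | z) | (j | z))) y (rfl | rfl)
      · exact congrArg Sum.inl (joint_right (bdE W₀ W₂) (bdL W₀ W₂) (.inl (.inl j))).symm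
      · exact congrArg Sum.inl (joint_left (bdE W₀ W₂) (bdL W₀ W₂) (.inl (.inl j))).symm
      · rfl
      · exact congrArg Sum.inl (joint_left (bdE W₀ W₂) (bdL W₀ W₂) (.inl (.inr z))).symm
      · exact congrArg Sum.inr (joint_left W₁.l W₁.l j).symm
      · rfl
      · rfl
      · rfl
      · exact congrArg Sum.inr (joint_left W₁.l W₁.l j).symm
      · rfl
      · exact congrArg Sum.inl (joint_right (bdE W₀ W₂) (bdL W₀ W₂) (.inl (.inr z))).symm
      · rfl
      · exact congrArg Sum.inl (joint_right (bdE W₀ W₂) (bdL W₀ W₂) (.inr (.inl j))).symm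
      · exact congrArg Sum.inl (joint_left (bdE W₀ W₂) (bdL W₀ W₂) (.inr (.inl j))).symm
      · exact congrArg Sum.inl (joint_right (bdE W₀ W₂) (bdL W₀ W₂) (.inr (.inr z))).symm
      · exact congrArg Sum.inl (joint_left (bdE W₀ W₂) (bdL W₀ W₂) (.inr (.inr z))).symm)
  invFun := Sum.elim
    (Quot.lift (Sum.elim (fun x => Quot.mk _ (.inl (.inl x))) (fun x => Quot.mk _ (.inr (.inr x))))
      (by
        have jl := joint_left (Sum.map (bdL W₀ W₁) (bdL W₁ W₂)) (midSwap W₀ W₁ W₂)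
        have jr := joint_right (Sum.map (bdL W₀ W₁) (bdL W₁ W₂)) (midSwap W₀ W₁ W₂)
        have key : ∀ z, Quot.mk (Joint (Sum.map (bdL W₀ W₁) (bdL W₁ W₂)) (midSwap W₀ W₁ W₂))
            (.inl (.inl (.inr z))) = Quot.mk _ (.inr (.inr (.inr z))) := fun z =>
          (jl (.inl (.inl (.inr z)))).symm.trans ((jr (.inl (.inr (.inr z)))).symm.trans
            (jl (.inr (.inl (.inr z)))).symm)
        rintro ((j | z) | (j | z)) y (rfl | rfl)
        · exact (jr (.inl (.inl (.inl j)))).symm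
        · exact (jl (.inl (.inl (.inl j)))).symm
        · exact (jr (.inl (.inl (.inr z)))).symm
        · exact key z
        · exact (jr (.inr (.inr (.inl j)))).symm
        · exact (jl (.inr (.inr (.inl j)))).symm
        · exact (jr (.inr (.inr (.inr z)))).symm
        · exact (key z).symm))
    (Quot.lift (fun j => Quot.mk _ (.inl (.inr (.inl j)))) (by
      rintro j y (rfl | rfl)
      · exact (joint_left (Sum.map (bdL W₀ W₁) (bdL W₁ W₂)) (midSwap W₀ W₁ W₂)
          (.inl (.inr (.inl j)))).symm
      · exact (joint_left (Sum.map (bdL W₀ W₁) (bdL W₁ W₂)) (midSwap W₀ W₁ W₂)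
          (.inl (.inr (.inl j)))).symm))
  left_inv q := by
    have jl := joint_left (Sum.map (bdL W₀ W₁) (bdL W₁ W₂)) (midSwap W₀ W₁ W₂)
    have jr := joint_right (Sum.map (bdL W₀ W₁) (bdL W₁ W₂)) (midSwap W₀ W₁ W₂)
    induction q using Quot.ind with
    | mk x =>
      rcases x with ((j | z) | (j | z)) | ((j | z) | (j | z))
      · rfl
      · rfl
      · rfl
      · exact (jl (.inl (.inl (.inr z)))).symm
      · exact jr (.inr (.inl (.inl j)))
      · exact (jl (.inl (.inl (.inr z)))).symm.trans (jr (.inl (.inr (.inr z)))).symm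
      · rfl
      · rfl
  right_inv q := by
    rcases q with q | q
    · induction q using Quot.ind with
      | mk x => rcases x with x | x <;> rfl
    · induction q using Quot.ind; rfl

/-- The ends at which the two gluing patterns agree. -/
def midFix (W₀ W₁ W₂ : OneMfd Z) : W₀.H ⊕ W₂.H ≃
    {x // Sum.map (bdE W₀ W₁) (bdE W₁ W₂) x = midSwap W₀ W₁ W₂ x} where
  toFun := Sum.elim (fun x => ⟨.inl (.inl x), rfl⟩) (fun x => ⟨.inr (.inr x), rfl⟩)
  invFun
    | ⟨.inl (.inl x), _⟩ => .inl x
    | ⟨.inr (.inr x), _⟩ => .inr x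
    | ⟨.inl (.inr _), h⟩ => by simp [bdE, midSwap] at h
    | ⟨.inr (.inl _), h⟩ => by simp [bdE, midSwap] at h
  left_inv := by rintro (x | x) <;> rfl
  right_inv := by
    rintro ⟨(x | x) | (x | x), h⟩
    · rfl
    · simp [bdE, midSwap] at h
    · simp [bdE, midSwap] at h
    · rfl

theorem quotJoint_comm {A : Type} (σ τ : A → A) : Joint σ τ = Joint τ σ := by
  funext a b; exact propext or_comm

theorem comp_count {V V' C : Type} [Finite V] [Finite V'] {b : BdCirc W₀ W₁ → V}
    {b' : BdCirc W₁ W₂ → V'} {w : V → ℤ} {w' : V' → ℤ} (hw : IsSurf b w) (hw' : IsSurf b' w')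
    (π : V ⊕ V' → C) (b₀₂ : BdCirc W₀ W₂ → C)
    (h₀ : ∀ x, b₀₂ (Quot.mk _ (.inl x)) = π (.inl (b (Quot.mk _ (.inl x)))))
    (h₂ : ∀ x, b₀₂ (Quot.mk _ (.inr x)) = π (.inr (b' (Quot.mk _ (.inr x)))))
    (h₁ : ∀ x, π (.inl (b (Quot.mk _ (.inr x)))) = π (.inr (b' (Quot.mk _ (.inl x)))))
    (hconn : ∀ φ : V ⊕ V' → ℚ,
      (∀ x, φ (.inl (b (Quot.mk _ (.inr x)))) = φ (.inr (b' (Quot.mk _ (.inl x))))) →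
      ∀ v w, π v = π w → φ v = φ w) (c : C) :
    ∃ g : ℕ, pushW π (Sum.elim w w') c = 2 - 2 * g - cnt b₀₂ c - arcs b₀₂ c := by
  obtain ⟨G, hG⟩ := hw.push (fun v => π (.inl v)) c
  obtain ⟨G', hG'⟩ := hw'.push (fun v => π (.inr v)) c
  have hz : ∀ z, π (.inl (b (Quot.mk _ (.inr (.inr z)))))
      = π (.inl (b (Quot.mk _ (.inl (.inr z))))) := fun z =>
    congrArg (fun x => π (.inl (b x))) (joint_right (bdE W₀ W₁) (bdL W₀ W₁) (.inl (.inr z)))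
  have hz' : ∀ z, π (.inr (b' (Quot.mk _ (.inr (.inr z)))))
      = π (.inr (b' (Quot.mk _ (.inl (.inr z))))) := fun z =>
    congrArg (fun x => π (.inr (b' x))) (joint_right (bdE W₁ W₂) (bdL W₁ W₂) (.inl (.inr z)))
  -- the old and the new circles
  let p : Quot (Joint (Sum.map (bdL W₀ W₁) (bdL W₁ W₂)) (Sum.map (bdE W₀ W₁) (bdE W₁ W₂))) →
      V ⊕ V' := fun x => Sum.map b b' (quotJointSum _ _ _ _
        (Quot.map id (fun a b h => (quotJoint_comm _ _ ▸ h)) x))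
  let q : Quot (Joint (Sum.map (bdL W₀ W₁) (bdL W₁ W₂)) (midSwap W₀ W₁ W₂)) → C := fun x =>
    Sum.elim b₀₂ (Quot.lift (fun j => π (.inl (b (Quot.mk _ (.inr (.inl j)))))) (by
      rintro j y (rfl | rfl) <;> exact congrArg (fun x => π (.inl (b x)))
        (joint_right (bdE W₀ W₁) (bdL W₀ W₁) (.inr (.inl j))).symm)) (midCirc W₀ W₁ W₂ x)
  have hp0 : ∀ x, p (Quot.mk _ (.inl x)) = .inl (b (Quot.mk _ x)) := fun x => rfl
  have hp1 : ∀ x, p (Quot.mk _ (.inr x)) = .inr (b' (Quot.mk _ x)) := fun x => rfl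
  have hq : ∀ k, q (Quot.mk _ k) = π (p (Quot.mk _ k)) := by
    rintro ((x | (j | z)) | ((j | z) | x))
    · exact h₀ x
    · rfl
    · exact (h₀ _).trans (hz z).symm
    · exact h₁ _
    · exact (h₀ _).trans ((hz z).symm.trans (h₁ _))
    · exact h₂ x
  obtain ⟨m, hm⟩ := reglue_class ((flip_bdL W₀ W₁).sum (flip_bdL W₁ W₂))
    ((flip_bdE W₀ W₁).sum (flip_bdE W₁ W₂)) flip_midSwap
    (by rintro ((x | x) | (x | x)) <;> rfl) p π q hq
    (by
      intro φ hφ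
      refine hconn φ fun x => ?_
      exact (hφ (.inl (.inr x))).symm) c
  -- evaluate all counts
  have c1 : cnt π c = cnt (fun v => π (.inl v)) c + cnt (fun v => π (.inr v)) c := cnt_sum _ _
  have c2 : cnt q c = cnt b₀₂ c
      + cnt (Quot.lift (r := Joint W₁.l W₁.l) (fun j => π (.inl (b (Quot.mk _ (.inr (.inl j)))))) (by
      rintro j y (rfl | rfl) <;> exact congrArg (fun x => π (.inl (b x)))
        (joint_right (bdE W₀ W₁) (bdL W₀ W₁) (.inr (.inl j))).symm)) c := by
    rw [cnt_congr (midCirc W₀ W₁ W₂) q _ c c (fun x => Iff.rfl), cnt_sum]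
  have c3 := W₁.flipL.cnt_joint (Quot.lift (r := Joint W₁.l W₁.l)
    (fun j => π (.inl (b (Quot.mk _ (.inr (.inl j)))))) (by
      rintro j y (rfl | rfl) <;> exact congrArg (fun x => π (.inl (b x)))
        (joint_right (bdE W₀ W₁) (bdL W₀ W₁) (.inr (.inl j))).symm)) c
  have c4 : cnt (fun k : {x // Sum.map (bdE W₀ W₁) (bdE W₁ W₂) x = midSwap W₀ W₁ W₂ x} =>
      q (Quot.mk _ k.1)) c = cnt (fun x => q (Quot.mk _ (.inl (.inl x)))) c
        + cnt (fun x => q (Quot.mk _ (.inr (.inr x)))) c := by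
    rw [← cnt_congr (midFix W₀ W₁ W₂) (fun x => q (Quot.mk _ (midFix W₀ W₁ W₂ x).1)) _ c c
      (fun x => Iff.rfl), cnt_sum]
    rfl
  have c5 : cnt (fun x => π (p x)) c = cnt (fun x => π (.inl (b x))) c
      + cnt (fun x => π (.inr (b' x))) c := by
    have e : (Joint (Sum.map (bdL W₀ W₁) (bdL W₁ W₂)) (Sum.map (bdE W₀ W₁) (bdE W₁ W₂)))
      = Joint (Sum.map (bdE W₀ W₁) (bdE W₁ W₂)) (Sum.map (bdL W₀ W₁) (bdL W₁ W₂)) :=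
        quotJoint_comm _ _
    rw [cnt_congr ((Quot.congrRight fun a b => by rw [e]).trans (quotJointSum _ _ _ _))
      (fun x => π (p x)) (fun y => π (Sum.map b b' y)) c c (fun x => by
        induction x using Quot.ind; rfl), cnt_sum]
    rfl
  have c6 : cnt (fun k => q (Quot.mk _ k)) c
      = (cnt (fun x => q (Quot.mk _ (.inl (.inl x)))) c
        + (cnt (fun j => π (.inl (b (Quot.mk _ (.inr (.inl j)))))) c
          + cnt (fun z => b₀₂ (Quot.mk _ (.inl (.inr z)))) c))
        + ((cnt (fun j => π (.inl (b (Quot.mk _ (.inr (.inl j)))))) c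
          + cnt (fun z => b₀₂ (Quot.mk _ (.inl (.inr z)))) c)
        + cnt (fun x => q (Quot.mk _ (.inr (.inr x)))) c) := by
    rw [cnt_sum, cnt_sum (fun x => q (Quot.mk _ (.inl x))),
      cnt_sum (fun x => q (Quot.mk _ (.inr x))), cnt_sum (fun x => q (Quot.mk _ (.inl (.inr x)))),
      cnt_sum (fun x => q (Quot.mk _ (.inr (.inl x))))]
    rfl
  have c7 : (cnt (fun z => b₀₂ (Quot.mk _ (.inl (.inr z)))) c : ℤ) = 2 * arcs b₀₂ c := by
    rw [arcs_pushW]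
    have := arcs_double W₀ (fun x => b₀₂ (Quot.mk _ (.inl x)))
      (fun x => congrArg b₀₂ (joint_left (bdE W₀ W₂) (bdL W₀ W₂) (.inl x)))
      (fun x => congrArg b₀₂ (joint_right (bdE W₀ W₂) (bdL W₀ W₂) (.inl (.inl x)))) c
    exact this
  have c8 : arcs (fun x => π (.inl (b x))) c = arcs b₀₂ c := by
    unfold arcs; simp only [h₀]
  have c9 : arcs (fun x => π (.inr (b' x))) c = arcs b₀₂ c := by
    unfold arcs; simp only [h₀, ← hz, h₁]
  have c10 : pushW π (Sum.elim w w') c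
      = pushW (fun v => π (.inl v)) w c + pushW (fun v => π (.inr v)) w' c := by
    rw [pushW_sum]; rfl
  rw [c8] at hG
  rw [c9] at hG'
  refine ⟨G + G' + m, ?_⟩
  rw [c10, hG, hG']
  rw [c1, c2, c4, c5, c6] at hm
  have c3' : cnt (fun j => π (.inl (b (Quot.mk _ (.inr (.inl j)))))) c = _ := c3
  rw [c3'] at hm
  push_cast
  omega

end

section
variable {Z : Signed} {W₀ W₁ W₂ W₃ : OneMfd Z}

/-- Mutually inverse maps (up to the gluing relations) between two glued surfaces that respect the
boundary and the Euler characteristics. -/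
structure Pre.Eqv (P P' : Pre W₀ W₁) (g : P.X → P'.X) (h : P'.X → P.X) : Prop where
  hg : ∀ x y, P.r x y → Quot.mk P'.r (g x) = Quot.mk P'.r (g y)
  hh : ∀ x y, P'.r x y → Quot.mk P.r (h x) = Quot.mk P.r (h y)
  hgh : ∀ x, Quot.mk P.r (h (g x)) = Quot.mk P.r x
  hhg : ∀ x, Quot.mk P'.r (g (h x)) = Quot.mk P'.r x
  hf : ∀ k, Quot.mk P'.r (g (P.f k)) = Quot.mk P'.r (P'.f k)
  hw : ∀ c, pushW (fun x => Quot.mk P'.r (g x)) P.w c = pushW (Quot.mk P'.r) P'.w c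

theorem Pre.Eqv.cls {P P' : Pre W₀ W₁} {g : P.X → P'.X} {h : P'.X → P.X} (H : Pre.Eqv P P' g h)
    (hP : P.Surf) (hP' : P'.Surf) : P.cls hP = P'.cls hP' :=
  Pre.cls_eq hP hP' g h H.hg H.hh H.hgh H.hhg H.hf H.hw

theorem Pre.Eqv.hf' {P P' : Pre W₀ W₁} {g : P.X → P'.X} {h : P'.X → P.X} (H : Pre.Eqv P P' g h) (k) :
    Quot.mk P.r (h (P'.f k)) = Quot.mk P.r (P.f k) :=
  (congrArg (Quot.lift (fun x => Quot.mk P.r (h x)) H.hh) (H.hf k)).symm.trans (H.hgh _)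

theorem Pre.exists_eqv {P P' : Pre W₀ W₁} (hP : P.Surf) (hP' : P'.Surf)
    (e : P.cls hP = P'.cls hP') : ∃ g h, Pre.Eqv P P' g h := by
  obtain ⟨φ, h1, h2⟩ := (Quotient.exact e : (P.toB hP).Iso (P'.toB hP')).relEuler
  let ψ : Quot P.r ≃ Quot P'.r := φ
  have k1 : ∀ k, ψ (Quot.mk P.r (P.f k)) = Quot.mk P'.r (P'.f k) := fun k => h1 (Quot.mk _ k)
  have k2 : ∀ c, pushW (Quot.mk P'.r) P'.w (ψ c) = pushW (Quot.mk P.r) P.w c := fun c =>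
    ((P'.toB_relEuler hP' _).symm.trans (h2 c)).trans (P.toB_relEuler hP c)
  have o1 : ∀ c : Quot P.r, Quot.mk P.r c.out = c := fun c => Quot.out_eq c
  have o2 : ∀ c : Quot P'.r, Quot.mk P'.r c.out = c := fun c => Quot.out_eq c
  refine ⟨fun x => (ψ (Quot.mk _ x)).out, fun y => (ψ.symm (Quot.mk _ y)).out, ?_, ?_, ?_, ?_, ?_, ?_⟩
  · intro x y hxy
    rw [o2, o2, Quot.sound hxy]
  · intro x y hxy
    rw [o1, o1, Quot.sound hxy]
  · intro x
    rw [o1, o2]; simp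
  · intro x
    rw [o2, o1]; simp
  · intro k
    rw [o2, k1]
  · intro c
    simp only [o2]
    obtain ⟨c, rfl⟩ := ψ.surjective c
    rw [k2]
    exact pushW_inj (Quot.mk P.r) ψ ψ.injective P.w c

/-- A chosen representative. -/
noncomputable def BHom.rep (a : BHom W₀ W₁) : Pre W₀ W₁ := (Quotient.out a).toPre
theorem BHom.rep_surf (a : BHom W₀ W₁) : a.rep.Surf := (Quotient.out a).toPre_surf
theorem BHom.rep_cls (a : BHom W₀ W₁) : a.rep.cls a.rep_surf = a :=
  (Bordism.cls_toPre _).trans (Quotient.out_eq a)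

namespace Pre

/-- The gluing relation of a stacked pair of surfaces. -/
inductive GlueRel (P : Pre W₀ W₁) (Q : Pre W₁ W₂) : P.X ⊕ Q.X → P.X ⊕ Q.X → Prop
  | left {x y} (h : P.r x y) : GlueRel P Q (.inl x) (.inl y)
  | right {x y} (h : Q.r x y) : GlueRel P Q (.inr x) (.inr y)
  | mid (k : W₁.H) : GlueRel P Q (.inl (P.f (.inr k))) (.inr (Q.f (.inl k)))

theorem glue_left (P : Pre W₀ W₁) (Q : Pre W₁ W₂) {x y : P.X} (h : Quot.mk P.r x = Quot.mk P.r y) :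
    Quot.mk (GlueRel P Q) (.inl x) = Quot.mk _ (.inl y) :=
  congrArg (Quot.lift (fun x => Quot.mk (GlueRel P Q) (.inl x)) fun _ _ h =>
    Quot.sound (.left h)) h

theorem glue_right (P : Pre W₀ W₁) (Q : Pre W₁ W₂) {x y : Q.X} (h : Quot.mk Q.r x = Quot.mk Q.r y) :
    Quot.mk (GlueRel P Q) (.inr x) = Quot.mk _ (.inr y) :=
  congrArg (Quot.lift (fun x => Quot.mk (GlueRel P Q) (.inr x)) fun _ _ h =>
    Quot.sound (.right h)) h

theorem glue_mid (P : Pre W₀ W₁) (Q : Pre W₁ W₂) (k : W₁.H) :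
    Quot.mk (GlueRel P Q) (.inl (P.f (.inr k))) = Quot.mk _ (.inr (Q.f (.inl k))) :=
  Quot.sound (.mid k)

/-- Stack `Q` on top of `P`. -/
def comp (P : Pre W₀ W₁) (Q : Pre W₁ W₂) : Pre W₀ W₂ where
  X := P.X ⊕ Q.X
  r := GlueRel P Q
  f := Sum.elim (fun x => .inl (P.f (.inl x))) (fun x => .inr (Q.f (.inr x)))
  hE := by
    rintro (x | x)
    · exact glue_left P Q (P.hE (.inl x))
    · exact glue_right P Q (Q.hE (.inr x))
  hL := by
    have key : ∀ z, Quot.mk (GlueRel P Q) (.inr (Q.f (.inr (.inr z))))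
        = Quot.mk _ (.inl (P.f (.inl (.inr z)))) := fun z =>
      (glue_right P Q (Q.hL (.inl (.inr z)))).trans ((glue_mid P Q (.inr z)).symm.trans
        (glue_left P Q (P.hL (.inl (.inr z)))))
    rintro ((j | z) | (j | z))
    · exact glue_left P Q (P.hL (.inl (.inl j)))
    · exact key z
    · exact glue_right P Q (Q.hL (.inr (.inl j)))
    · exact (key z).symm
  w := Sum.elim P.w Q.w

theorem comp_surf {P : Pre W₀ W₁} {Q : Pre W₁ W₂} (hP : P.Surf) (hQ : Q.Surf) :
    (P.comp Q).Surf := by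
  intro c
  let π : Quot P.r ⊕ Quot Q.r → Quot (GlueRel P Q) := Sum.elim
    (Quot.lift (fun x => Quot.mk _ (.inl x)) fun _ _ h => Quot.sound (.left h))
    (Quot.lift (fun x => Quot.mk _ (.inr x)) fun _ _ h => Quot.sound (.right h))
  obtain ⟨g, hg⟩ := comp_count hP hQ π (P.comp Q).bd (fun _ => rfl) (fun _ => rfl)
    (fun x => glue_mid P Q x) (by
      intro φ hφ v w hvw
      let φ' : Quot (GlueRel P Q) → ℚ := Quot.lift
        (Sum.elim (fun x => φ (.inl (Quot.mk _ x))) (fun x => φ (.inr (Quot.mk _ x)))) (by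
          rintro _ _ (h | h | k)
          · exact congrArg (fun x => φ (.inl x)) (Quot.sound h)
          · exact congrArg (fun x => φ (.inr x)) (Quot.sound h)
          · exact hφ k)
      have : ∀ v, φ v = φ' (π v) := by
        rintro (v | v) <;> (induction v using Quot.ind; rfl)
      rw [this v, this w, hvw]) c
  refine ⟨g, ?_⟩
  refine Eq.trans ?_ hg
  have e1 := pushW_sum π (Sum.elim (pushW (Quot.mk P.r) P.w) (pushW (Quot.mk Q.r) Q.w)) c
  have e2 := pushW_sum (Quot.mk (GlueRel P Q)) (Sum.elim P.w Q.w) c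
  have e3 := pushW_pushW (Quot.mk P.r) (fun v => π (.inl v)) P.w c
  have e4 := pushW_pushW (Quot.mk Q.r) (fun v => π (.inr v)) Q.w c
  refine e2.trans (Eq.trans ?_ e1.symm)
  exact congrArg₂ (· + ·) e3.symm e4.symm

theorem Eqv.comp {P P' : Pre W₀ W₁} {Q Q' : Pre W₁ W₂} {g : P.X → P'.X} {h : P'.X → P.X}
    {g' : Q.X → Q'.X} {h' : Q'.X → Q.X} (H : Eqv P P' g h) (H' : Eqv Q Q' g' h') :
    Eqv (P.comp Q) (P'.comp Q') (Sum.map g g') (Sum.map h h') where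
  hg := by
    rintro _ _ (r | r | k)
    · exact glue_left P' Q' (H.hg _ _ r)
    · exact glue_right P' Q' (H'.hg _ _ r)
    · exact (glue_left P' Q' (H.hf (.inr k))).trans ((glue_mid P' Q' k).trans
        (glue_right P' Q' (H'.hf (.inl k))).symm)
  hh := by
    rintro _ _ (r | r | k)
    · exact glue_left P Q (H.hh _ _ r)
    · exact glue_right P Q (H'.hh _ _ r)
    · exact (glue_left P Q (H.hf' (.inr k))).trans ((glue_mid P Q k).trans
        (glue_right P Q (H'.hf' (.inl k))).symm)
  hgh := by
    rintro (x | x)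
    · exact glue_left P Q (H.hgh x)
    · exact glue_right P Q (H'.hgh x)
  hhg := by
    rintro (x | x)
    · exact glue_left P' Q' (H.hhg x)
    · exact glue_right P' Q' (H'.hhg x)
  hf := by
    rintro (x | x)
    · exact glue_left P' Q' (H.hf (.inl x))
    · exact glue_right P' Q' (H'.hf (.inr x))
  hw := by
    intro c
    let π₁ : Quot P'.r → Quot (GlueRel P' Q') :=
      Quot.lift (fun x => Quot.mk _ (.inl x)) fun _ _ h => Quot.sound (.left h)
    let π₂ : Quot Q'.r → Quot (GlueRel P' Q') :=
      Quot.lift (fun x => Quot.mk _ (.inr x)) fun _ _ h => Quot.sound (.right h)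
    refine (pushW_sum (fun x => Quot.mk (GlueRel P' Q') (Sum.map g g' x)) (Sum.elim P.w Q.w) c).trans
      (Eq.trans ?_ (pushW_sum (Quot.mk (GlueRel P' Q')) (Sum.elim P'.w Q'.w) c).symm)
    have e1 := pushW_pushW (fun x => Quot.mk P'.r (g x)) π₁ P.w c
    have e2 := pushW_pushW (fun x => Quot.mk Q'.r (g' x)) π₂ Q.w c
    have e3 := pushW_pushW (Quot.mk P'.r) π₁ P'.w c
    have e4 := pushW_pushW (Quot.mk Q'.r) π₂ Q'.w c
    rw [funext H.hw] at e1
    rw [funext H'.hw] at e2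
    exact congrArg₂ (· + ·) (e1.symm.trans e3) (e2.symm.trans e4)

end Pre

namespace BHom

/-- Composition of bordisms (`b` is stacked on `a`). -/
noncomputable def comp (a : BHom W₀ W₁) (b : BHom W₁ W₂) : BHom W₀ W₂ :=
  (a.rep.comp b.rep).cls (Pre.comp_surf a.rep_surf b.rep_surf)

theorem comp_cls {P : Pre W₀ W₁} {Q : Pre W₁ W₂} (hP : P.Surf) (hQ : Q.Surf) :
    comp (P.cls hP) (Q.cls hQ) = (P.comp Q).cls (Pre.comp_surf hP hQ) := by
  obtain ⟨g, h, H⟩ := Pre.exists_eqv (rep_surf (P.cls hP)) hP (rep_cls _)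
  obtain ⟨g', h', H'⟩ := Pre.exists_eqv (rep_surf (Q.cls hQ)) hQ (rep_cls _)
  exact (H.comp H').cls _ _

/-- The class of `W × [0,1]`. -/
noncomputable def one (W : OneMfd Z) : BHom W W := (Pre.one W).cls (Pre.one_surf W)

theorem assoc (a : BHom W₀ W₁) (b : BHom W₁ W₂) (c : BHom W₂ W₃) :
    (a.comp b).comp c = a.comp (b.comp c) := by
  obtain ⟨P, hP, rfl⟩ := a.exists_pre
  obtain ⟨Q, hQ, rfl⟩ := b.exists_pre
  obtain ⟨R, hR, rfl⟩ := c.exists_pre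
  rw [comp_cls, comp_cls, comp_cls, comp_cls]
  refine Pre.Eqv.cls (g := Equiv.sumAssoc _ _ _) (h := (Equiv.sumAssoc _ _ _).symm) ?_ _ _
  constructor
  · rintro _ _ ((r | r | k) | r | k)
    · exact Quot.sound (.left r)
    · exact Pre.glue_right P (Q.comp R) (Quot.sound (.left r))
    · exact Quot.sound (.mid k)
    · exact Pre.glue_right P (Q.comp R) (Quot.sound (.right r))
    · exact Pre.glue_right P (Q.comp R) (Quot.sound (.mid k))
  · rintro _ _ (r | (r | r | k) | k)
    · exact Pre.glue_left (P.comp Q) R (Quot.sound (.left r))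
    · exact Pre.glue_left (P.comp Q) R (Quot.sound (.right r))
    · exact Quot.sound (.right r)
    · exact Quot.sound (.mid k)
    · exact Pre.glue_left (P.comp Q) R (Quot.sound (.mid k))
  · rintro ((x | x) | x) <;> rfl
  · rintro (x | x | x) <;> rfl
  · rintro (x | x) <;> rfl
  · intro c
    refine Eq.trans ?_ (pushW_equiv (Equiv.sumAssoc P.X Q.X R.X) (Quot.mk (P.comp (Q.comp R)).r)
      (P.comp (Q.comp R)).w c)
    congr 1
    funext x
    rcases x with (x | x) | x <;> rfl

theorem one_comp (a : BHom W₀ W₁) : (one W₀).comp a = a := by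
  obtain ⟨P, hP, rfl⟩ := a.exists_pre
  rw [one, comp_cls]
  refine Pre.Eqv.cls (g := Sum.elim (fun x => P.f (.inl x)) id) (h := Sum.inr) ?_ _ _
  constructor
  · rintro _ _ ((x | j) | r | k)
    · exact (P.hE (.inl _)).symm
    · exact (P.hL (.inl (.inl j))).symm
    · exact Quot.sound r
    · rfl
  · exact fun x y r => Quot.sound (.right r)
  · rintro (x | x)
    · exact (Pre.glue_mid (Pre.one W₀) P x).symm
    · rfl
  · exact fun x => rfl
  · rintro (x | x) <;> rfl
  · intro c
    refine (pushW_sum _ (Sum.elim (fun _ => 0) P.w) c).trans ?_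
    refine (congrArg₂ (· + ·) (pushW_zero _ _) rfl).trans (zero_add _)

theorem comp_one (a : BHom W₀ W₁) : a.comp (one W₁) = a := by
  obtain ⟨P, hP, rfl⟩ := a.exists_pre
  rw [one, comp_cls]
  refine Pre.Eqv.cls (g := Sum.elim id (fun x => P.f (.inr x))) (h := Sum.inl) ?_ _ _
  constructor
  · rintro _ _ (r | (x | j) | k)
    · exact Quot.sound r
    · exact (P.hE (.inr _)).symm
    · exact (P.hL (.inr (.inl j))).symm
    · rfl
  · exact fun x y r => Quot.sound (.left r)
  · rintro (x | x)
    · rfl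
    · exact (Pre.glue_mid P (Pre.one W₁) x)
  · exact fun x => rfl
  · rintro (x | x) <;> rfl
  · intro c
    refine (pushW_sum _ (Sum.elim P.w (fun _ => 0)) c).trans ?_
    refine (congrArg₂ (· + ·) rfl (pushW_zero _ _)).trans (add_zero _)

end BHom

end

/-! ### Sewing along boundary points -/

/-- A pattern for gluing an object with boundary points `E₁` and one with boundary points `E₂` along
pairs of boundary points, indexed by `Y`, leaving the boundary points `E'`. -/
structure Glue (E₁ E₂ E' : Type) where
  Y : Type
  [fin : Finite Y]
  eqv : E₁ ⊕ E₂ ≃ (Y ⊕ Y) ⊕ E'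

attribute [instance] Glue.fin

namespace Glue
variable {E₁ E₂ E' : Type} (g : Glue E₁ E₂ E')

/-- The ends of a glued object are those of the two pieces. -/
def ends (J₁ J₂ : Type) : ((J₁ ⊕ J₂) ⊕ (g.Y ⊕ g.Y)) ⊕ E' ≃ (J₁ ⊕ E₁) ⊕ (J₂ ⊕ E₂) where
  toFun
    | .inl (.inl (.inl j)) => .inl (.inl j)
    | .inl (.inl (.inr j)) => .inr (.inl j)
    | .inl (.inr y) => Sum.map .inr .inr (g.eqv.symm (.inl y))
    | .inr z => Sum.map .inr .inr (g.eqv.symm (.inr z))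
  invFun
    | .inl (.inl j) => .inl (.inl (.inl j))
    | .inr (.inl j) => .inl (.inl (.inr j))
    | .inl (.inr z) => Sum.map .inr id (g.eqv (.inl z))
    | .inr (.inr z) => Sum.map .inr id (g.eqv (.inr z))
  left_inv := by
    rintro (((j | j) | y) | z)
    · rfl
    · rfl
    · generalize h : g.eqv.symm (.inl y) = x
      have h' := (Equiv.symm_apply_eq _).1 h
      rcases x with x | x <;> simp [h, ← h']
    · generalize h : g.eqv.symm (.inr z) = x
      have h' := (Equiv.symm_apply_eq _).1 h
      rcases x with x | x <;> simp [h, ← h']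
  right_inv := by
    rintro ((j | z) | (j | z))
    · rfl
    · generalize h : g.eqv (.inl z) = x
      have h' := (Equiv.eq_symm_apply _).2 h
      rcases x with x | x <;> simp [h, ← h']
    · rfl
    · generalize h : g.eqv (.inr z) = x
      have h' := (Equiv.eq_symm_apply _).2 h
      rcases x with x | x <;> simp [h, ← h']

/-- Stacking: a boundary `Q ⊔ R` and a boundary `P ⊔ Q` are glued along `Q`. -/
def stack (P Q R : Type) [Finite Q] : Glue (Q ⊕ R) (P ⊕ Q) (P ⊕ R) where
  Y := Q
  eqv :=
    { toFun := Sum.elim (Sum.map .inl .inr) (Sum.elim (fun p => .inr (.inl p)) (fun q => .inl (.inr q)))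
      invFun := Sum.elim (Sum.elim (fun q => .inl (.inl q)) (fun q => .inr (.inr q)))
        (Sum.elim (fun p => .inr (.inl p)) (fun r => .inl (.inr r)))
      left_inv := by rintro ((q | r) | (p | q)) <;> rfl
      right_inv := by rintro ((q | q) | (p | r)) <;> rfl }

/-- Juxtaposition: nothing is glued. -/
def side (P Q P' Q' : Type) : Glue (P ⊕ Q) (P' ⊕ Q') ((P ⊕ P') ⊕ (Q ⊕ Q')) where
  Y := Empty
  eqv := (Equiv.sumSumSumComm P Q P' Q').trans (Equiv.emptySum (Empty ⊕ Empty) _).symm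

end Glue

/-- A pattern for gluing along pairs of oppositely signed boundary points. -/
structure Sew (Z₁ Z₂ Z' : Signed) extends Glue Z₁.pt Z₂.pt Z'.pt where
  pos_rest : ∀ z, Sum.elim Z₁.pos Z₂.pos (eqv.symm (.inr z)) = Z'.pos z
  pos_pair : ∀ y, Sum.elim Z₁.pos Z₂.pos (eqv.symm (.inl (.inr y)))
    = !Sum.elim Z₁.pos Z₂.pos (eqv.symm (.inl (.inl y)))

namespace Sew
variable {Z₁ Z₂ Z' : Signed} (s : Sew Z₁ Z₂ Z')

/-- The pattern for the horizontal composition `Cob(Y₁, Y₂) × Cob(Y₀, Y₁) → Cob(Y₀, Y₂)`. -/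
def stack (Y₀ Y₁ Y₂ : Signed) : Sew (Y₁.sum Y₂.neg) (Y₀.sum Y₁.neg) (Y₀.sum Y₂.neg) where
  toGlue := Glue.stack Y₀.pt Y₁.pt Y₂.pt
  pos_rest := by rintro (z | z) <;> rfl
  pos_pair _ := rfl

/-- The pattern for the tensor product
`Cob(Y₀, Y₁) × Cob(Y₀', Y₁') → Cob(Y₀ ⊗ Y₀', Y₁ ⊗ Y₁')`. -/
def side (Y₀ Y₁ Y₀' Y₁' : Signed) :
    Sew (Y₀.sum Y₁.neg) (Y₀'.sum Y₁'.neg) ((Y₀.sum Y₀').sum (Y₁.sum Y₁').neg) where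
  toGlue := Glue.side Y₀.pt Y₁.pt Y₀'.pt Y₁'.pt
  pos_rest := by rintro ((z | z) | (z | z)) <;> rfl
  pos_pair := by rintro ⟨⟩

/-- The glued `1`-manifold. -/
def mfd (W₁ : OneMfd Z₁) (W₂ : OneMfd Z₂) : OneMfd Z' where
  J := (W₁.J ⊕ W₂.J) ⊕ (s.Y ⊕ s.Y)
  e x := (s.ends _ _).symm (Sum.map W₁.e W₂.e (s.ends _ _ x))
  l := Sum.map (Sum.map W₁.l W₂.l) Sum.swap
  o j := Sum.elim W₁.dir W₂.dir (s.ends _ _ (.inl j))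
  e_e x := by
    rw [Equiv.apply_symm_apply, Equiv.symm_apply_eq]
    generalize s.ends _ _ x = y
    rcases y with y | y
    · exact congrArg Sum.inl (W₁.e_e y)
    · exact congrArg Sum.inr (W₂.e_e y)
  e_o x := by
    have key : ∀ x, Sum.elim (fun j => Sum.elim W₁.dir W₂.dir (s.ends W₁.J W₂.J (.inl j))) Z'.pos x
        = Sum.elim W₁.dir W₂.dir (s.ends _ _ x) := by
      rintro (x | z)
      · rfl
      · refine (s.pos_rest z).symm.trans ?_
        show _ = Sum.elim W₁.dir W₂.dir (Sum.map .inr .inr (s.eqv.symm (.inr z)))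
        generalize s.eqv.symm (.inr z) = y
        rcases y with y | y <;> rfl
    rw [key, key, Equiv.apply_symm_apply]
    generalize s.ends _ _ x = y
    rcases y with y | y
    · exact W₁.e_o y
    · exact W₂.e_o y
  l_l := by rintro ((j | j) | (y | y)) <;> simp [W₁.l_l, W₂.l_l]
  l_o := by
    have key : ∀ y, Sum.elim W₁.dir W₂.dir (s.ends W₁.J W₂.J (.inl (.inr y)))
        = Sum.elim Z₁.pos Z₂.pos (s.eqv.symm (.inl y)) := by
      intro y
      show Sum.elim W₁.dir W₂.dir (Sum.map .inr .inr (s.eqv.symm (.inl y))) = _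
      generalize s.eqv.symm (.inl y) = y
      rcases y with y | y <;> rfl
    rintro ((j | j) | (y | y))
    · exact W₁.l_o j
    · exact W₂.l_o j
    · exact (key (.inr y)).trans ((s.pos_pair y).trans (congrArg (fun b => !b) (key (.inl y)).symm))
    · refine (key (.inl y)).trans (Eq.trans ?_ (congrArg (fun b => !b) (key (.inr y)).symm))
      rw [s.pos_pair, Bool.not_not]

variable {W₁ W₁' : OneMfd Z₁} {W₂ W₂' : OneMfd Z₂}

/-- The boundary ends of a glued surface are those of the two pieces. -/
def spread (W₁ W₁' : OneMfd Z₁) (W₂ W₂' : OneMfd Z₂) : (s.mfd W₁ W₂).H ⊕ (s.mfd W₁' W₂').H ≃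
    (W₁.H ⊕ W₁'.H) ⊕ (W₂.H ⊕ W₂'.H) :=
  (Equiv.sumCongr (s.ends _ _) (s.ends _ _)).trans (Equiv.sumSumSumComm _ _ _ _)

theorem spread_inl (k) :
    s.spread W₁ W₁' W₂ W₂' (.inl k) = Sum.map .inl .inl (s.ends _ _ k) := by
  show Equiv.sumSumSumComm _ _ _ _ (.inl (s.ends _ _ k)) = _
  generalize s.ends _ _ k = k
  rcases k with k | k <;> rfl

theorem spread_inr (k) :
    s.spread W₁ W₁' W₂ W₂' (.inr k) = Sum.map .inr .inr (s.ends _ _ k) := by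
  show Equiv.sumSumSumComm _ _ _ _ (.inr (s.ends _ _ k)) = _
  generalize s.ends _ _ k = k
  rcases k with k | k <;> rfl

theorem ends_e (W₁ : OneMfd Z₁) (W₂ : OneMfd Z₂) (k) :
    s.ends _ _ ((s.mfd W₁ W₂).e k) = Sum.map W₁.e W₂.e (s.ends _ _ k) :=
  Equiv.apply_symm_apply _ _

theorem spread_bdE (k) : s.spread W₁ W₁' W₂ W₂' (bdE _ _ k)
    = Sum.map (bdE W₁ W₁') (bdE W₂ W₂') (s.spread W₁ W₁' W₂ W₂' k) := by
  rcases k with k | k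
  · refine (s.spread_inl _).trans ?_
    rw [spread_inl, ends_e]
    generalize s.ends _ _ k = k
    rcases k with k | k <;> rfl
  · refine (s.spread_inr _).trans ?_
    rw [spread_inr, ends_e]
    generalize s.ends _ _ k = k
    rcases k with k | k <;> rfl

/-- A glued-along or remaining boundary point, as an end. -/
def back (J : Type) : (s.Y ⊕ s.Y) ⊕ Z'.pt → (J ⊕ (s.Y ⊕ s.Y)) ⊕ Z'.pt := Sum.map .inr id

theorem ends_back (J₁ J₂ : Type) (p) :
    s.ends J₁ J₂ (s.back _ p) = Sum.map .inr .inr (s.eqv.symm p) := by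
  rcases p with p | p <;> rfl

/-- The cut points before gluing. -/
def oldL (W₁ W₁' : OneMfd Z₁) (W₂ W₂' : OneMfd Z₂) (k : (s.mfd W₁ W₂).H ⊕ (s.mfd W₁' W₂').H) :
    (s.mfd W₁ W₂).H ⊕ (s.mfd W₁' W₂').H :=
  (s.spread W₁ W₁' W₂ W₂').symm
    (Sum.map (bdL W₁ W₁') (bdL W₂ W₂') (s.spread W₁ W₁' W₂ W₂' k))

theorem oldL_left (p) : s.oldL W₁ W₁' W₂ W₂' (.inl (s.back _ p)) = .inr (s.back _ p) := by
  unfold oldL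
  rw [Equiv.symm_apply_eq]
  have e1 := (s.spread_inl (W₁ := W₁) (W₁' := W₁') (W₂ := W₂) (W₂' := W₂') (s.back _ p)).trans
    (congrArg _ (s.ends_back _ _ p))
  have e2 := (s.spread_inr (W₁ := W₁) (W₁' := W₁') (W₂ := W₂) (W₂' := W₂') (s.back _ p)).trans
    (congrArg _ (s.ends_back _ _ p))
  refine (congrArg _ e1).trans (Eq.trans ?_ e2.symm)
  generalize s.eqv.symm p = x
  rcases x with x | x <;> rfl

theorem oldL_oldL (k) : s.oldL W₁ W₁' W₂ W₂' (s.oldL W₁ W₁' W₂ W₂' k) = k := by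
  unfold oldL
  rw [Equiv.apply_symm_apply, Equiv.symm_apply_eq]
  generalize s.spread W₁ W₁' W₂ W₂' k = k
  rcases k with k | k
  · exact congrArg Sum.inl ((flip_bdL W₁ W₁').inv k)
  · exact congrArg Sum.inr ((flip_bdL W₂ W₂').inv k)

theorem oldL_right (p) : s.oldL W₁ W₁' W₂ W₂' (.inr (s.back _ p)) = .inl (s.back _ p) := by
  rw [← oldL_left, oldL_oldL]

theorem bdO_spread (k) : bdO (s.mfd W₁ W₂) (s.mfd W₁' W₂') k
    = Sum.elim (bdO W₁ W₁') (bdO W₂ W₂') (s.spread W₁ W₁' W₂ W₂' k) := by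
  have key : ∀ (V₁ : OneMfd Z₁) (V₂ : OneMfd Z₂) x,
      (s.mfd V₁ V₂).dir x = Sum.elim V₁.dir V₂.dir (s.ends V₁.J V₂.J x) := by
    rintro V₁ V₂ (x | z)
    · rfl
    · refine (s.pos_rest z).symm.trans ?_
      show _ = Sum.elim V₁.dir V₂.dir (Sum.map .inr .inr (s.eqv.symm (.inr z)))
      generalize s.eqv.symm (.inr z) = y
      rcases y with y | y <;> rfl
  rcases k with k | k
  · refine (key W₁ W₂ k).trans ?_
    show _ = Sum.elim _ _ (Equiv.sumSumSumComm _ _ _ _ (.inl (s.ends _ _ k)))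
    generalize s.ends _ _ k = k
    rcases k with k | k <;> rfl
  · refine (congrArg (fun b => !b) (key W₁' W₂' k)).trans ?_
    show _ = Sum.elim _ _ (Equiv.sumSumSumComm _ _ _ _ (.inr (s.ends _ _ k)))
    generalize s.ends _ _ k = k
    rcases k with k | k <;> rfl

theorem flip_oldL : Flip (bdO (s.mfd W₁ W₂) (s.mfd W₁' W₂')) (s.oldL W₁ W₁' W₂ W₂') := by
  refine ⟨s.oldL_oldL, fun k => ?_⟩
  rw [bdO_spread, bdO_spread, oldL, Equiv.apply_symm_apply]
  exact ((flip_bdL W₁ W₁').sum (flip_bdL W₂ W₂')).flip _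

theorem oldL_comm (k) : s.oldL W₁ W₁' W₂ W₂' (bdL (s.mfd W₁ W₂) (s.mfd W₁' W₂') k)
    = bdL (s.mfd W₁ W₂) (s.mfd W₁' W₂') (s.oldL W₁ W₁' W₂ W₂' k) := by
  rcases k with (((j | j) | y) | z) | (((j | j) | y) | z)
  · rfl
  · rfl
  · refine (s.oldL_left (.inl y.swap)).trans ?_
    exact (congrArg (bdL _ _) (s.oldL_left (W₁ := W₁) (W₁' := W₁') (W₂ := W₂) (W₂' := W₂') (.inl y))).symm
  · refine (s.oldL_right (.inr z)).trans ?_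
    exact (congrArg (bdL _ _) (s.oldL_left (W₁ := W₁) (W₁' := W₁') (W₂ := W₂) (W₂' := W₂') (.inr z))).symm
  · rfl
  · rfl
  · refine (s.oldL_right (.inl y.swap)).trans ?_
    exact (congrArg (bdL _ _) (s.oldL_right (W₁ := W₁) (W₁' := W₁') (W₂ := W₂) (W₂' := W₂') (.inl y))).symm
  · refine (s.oldL_left (.inr z)).trans ?_
    exact (congrArg (bdL _ _) (s.oldL_right (W₁ := W₁) (W₁' := W₁') (W₂ := W₂) (W₂' := W₂') (.inr z))).symm

/-- Ends at which the gluing changes nothing, respectively something. -/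
def fixEqv (W₁ W₁' : OneMfd Z₁) (W₂ W₂' : OneMfd Z₂) :
    {k // s.oldL W₁ W₁' W₂ W₂' k = bdL (s.mfd W₁ W₂) (s.mfd W₁' W₂') k}
      ⊕ ((s.Y ⊕ s.Y) ⊕ (s.Y ⊕ s.Y)) ≃ (s.mfd W₁ W₂).H ⊕ (s.mfd W₁' W₂').H where
  toFun := Sum.elim Subtype.val
    (Sum.elim (fun y => .inl (.inl (.inr y))) (fun y => .inr (.inl (.inr y))))
  invFun
    | .inl (.inl (.inl j)) => .inl ⟨.inl (.inl (.inl j)), by rcases j with j | j <;> rfl⟩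
    | .inl (.inl (.inr y)) => .inr (.inl y)
    | .inl (.inr z) => .inl ⟨.inl (.inr z), s.oldL_left (.inr z)⟩
    | .inr (.inl (.inl j)) => .inl ⟨.inr (.inl (.inl j)), by rcases j with j | j <;> rfl⟩
    | .inr (.inl (.inr y)) => .inr (.inr y)
    | .inr (.inr z) => .inl ⟨.inr (.inr z), s.oldL_right (.inr z)⟩
  left_inv := by
    rintro (⟨((j | y) | z) | ((j | y) | z), h⟩ | (y | y))
    · rfl
    · exact absurd ((s.oldL_left (.inl y)).symm.trans h) (by rintro ⟨⟩)
    · rfl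
    · rfl
    · exact absurd ((s.oldL_right (.inl y)).symm.trans h) (by rintro ⟨⟩)
    · rfl
    · rfl
    · rfl
  right_inv := by rintro (((j | y) | z) | ((j | y) | z)) <;> rfl

end Sew

namespace Sew
variable {Z₁ Z₂ Z' : Signed} (s : Sew Z₁ Z₂ Z') {W₁ W₁' W₁'' : OneMfd Z₁} {W₂ W₂' W₂'' : OneMfd Z₂}

/-- A label for boundary circles as a label for ends. -/
def lab {V V' : Type} (b : BdCirc W₁ W₁' → V) (b' : BdCirc W₂ W₂' → V') :
    (W₁.H ⊕ W₁'.H) ⊕ (W₂.H ⊕ W₂'.H) → V ⊕ V' :=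
  Sum.map (fun k => b (Quot.mk _ k)) (fun k => b' (Quot.mk _ k))

/-- A label for boundary circles as a label for boundary points. -/
def labZ {V V' : Type} (b : BdCirc W₁ W₁' → V) (b' : BdCirc W₂ W₂' → V') :
    Z₁.pt ⊕ Z₂.pt → V ⊕ V' :=
  Sum.map (fun z => b (Quot.mk _ (.inl (.inr z)))) (fun z => b' (Quot.mk _ (.inl (.inr z))))

theorem lab_left {V V' : Type} (b : BdCirc W₁ W₁' → V) (b' : BdCirc W₂ W₂' → V') (p) :
    lab b b' (s.spread _ _ _ _ (.inl (s.back _ p))) = labZ b b' (s.eqv.symm p) := by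
  rw [(s.spread_inl (W₁ := W₁) (W₁' := W₁') (W₂ := W₂) (W₂' := W₂') (s.back _ p)).trans
    (congrArg _ (s.ends_back _ _ p))]
  generalize s.eqv.symm p = x
  rcases x with x | x <;> rfl

theorem lab_right {V V' : Type} (b : BdCirc W₁ W₁' → V) (b' : BdCirc W₂ W₂' → V') (p) :
    lab b b' (s.spread _ _ _ _ (.inr (s.back _ p))) = labZ b b' (s.eqv.symm p) := by
  rw [(s.spread_inr (W₁ := W₁) (W₁' := W₁') (W₂ := W₂) (W₂' := W₂') (s.back _ p)).trans
    (congrArg _ (s.ends_back _ _ p))]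
  generalize s.eqv.symm p = x
  rcases x with x | x
  · exact congrArg (fun x => Sum.inl (b x)) (joint_right (bdE W₁ W₁') (bdL W₁ W₁') (.inl (.inr x)))
  · exact congrArg (fun x => Sum.inr (b' x)) (joint_right (bdE W₂ W₂') (bdL W₂ W₂') (.inl (.inr x)))

/-- The circles before gluing. -/
def oldCirc (W₁ W₁' : OneMfd Z₁) (W₂ W₂' : OneMfd Z₂) :
    Quot (Joint (bdE (s.mfd W₁ W₂) (s.mfd W₁' W₂')) (s.oldL W₁ W₁' W₂ W₂')) ≃
      BdCirc W₁ W₁' ⊕ BdCirc W₂ W₂' :=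
  (Quot.congr (s.spread W₁ W₁' W₂ W₂') (by
    intro a b
    refine or_congr ?_ ?_
    · rw [← (s.spread _ _ _ _).injective.eq_iff]
      exact Eq.congr rfl (s.spread_bdE a)
    · rw [← (s.spread _ _ _ _).injective.eq_iff]
      exact Eq.congr rfl (Equiv.apply_symm_apply _ _))).trans (quotJointSum _ _ _ _)

theorem sew_count {V V' C : Type} [Finite V] [Finite V'] {b : BdCirc W₁ W₁' → V}
    {b' : BdCirc W₂ W₂' → V'} {w : V → ℤ} {w' : V' → ℤ} (hw : IsSurf b w) (hw' : IsSurf b' w')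
    (π : V ⊕ V' → C) (β : BdCirc (s.mfd W₁ W₂) (s.mfd W₁' W₂') → C)
    (hβ : ∀ k, β (Quot.mk _ k) = π (lab b b' (s.spread _ _ _ _ k)))
    (hconn : ∀ φ : V ⊕ V' → ℚ,
      (∀ y, φ (labZ b b' (s.eqv.symm (.inl (.inl y)))) = φ (labZ b b' (s.eqv.symm (.inl (.inr y))))) →
      ∀ v w, π v = π w → φ v = φ w) (c : C) :
    ∃ g : ℕ, pushW π (Sum.elim w w') c = 2 - 2 * g - cnt β c - arcs β c := by
  obtain ⟨G, hG⟩ := hw.push (fun v => π (.inl v)) c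
  obtain ⟨G', hG'⟩ := hw'.push (fun v => π (.inr v)) c
  let p : Quot (Joint (bdE (s.mfd W₁ W₂) (s.mfd W₁' W₂')) (s.oldL W₁ W₁' W₂ W₂')) → V ⊕ V' :=
    fun x => Sum.map b b' (s.oldCirc _ _ _ _ x)
  have hp : ∀ k, p (Quot.mk _ k) = lab b b' (s.spread _ _ _ _ k) := by
    intro k
    show Sum.map b b' (Sum.map (Quot.mk _) (Quot.mk _) (s.spread _ _ _ _ k)) = _
    generalize s.spread _ _ _ _ k = k
    rcases k with k | k <;> rfl
  obtain ⟨m, hm⟩ := reglue_class (flip_bdE (s.mfd W₁ W₂) (s.mfd W₁' W₂')) s.flip_oldL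
    (flip_bdL (s.mfd W₁ W₂) (s.mfd W₁' W₂')) s.oldL_comm p π β (fun k => by rw [hβ, hp])
    (by
      intro φ hφ
      refine hconn φ fun y => ?_
      have h1 := s.lab_left b b' (.inl (.inl y))
      have h2 := s.lab_left b b' (.inl (.inr y))
      rw [← h1, ← h2, ← hp, ← hp]
      exact (hφ (.inl (.inl (.inr (.inl y))))).symm) c
  have bY : ∀ y, β (Quot.mk _ (.inl (.inl (.inr (.inr y)))))
      = β (Quot.mk _ (.inl (.inl (.inr (.inl y))))) := fun y =>
    congrArg β (joint_right (bdE (s.mfd W₁ W₂) (s.mfd W₁' W₂')) (bdL _ _)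
      (.inl (.inl (.inr (.inl y)))))
  have bL : ∀ q, β (Quot.mk _ (.inl (s.back _ q))) = π (labZ b b' (s.eqv.symm q)) := fun q => by
    rw [hβ, lab_left]
  have bR : ∀ q, β (Quot.mk _ (.inr (s.back _ q))) = π (labZ b b' (s.eqv.symm q)) := fun q => by
    rw [hβ, lab_right]
  let y₀ : s.Y → C := fun y => π (labZ b b' (s.eqv.symm (.inl (.inl y))))
  have bY' : ∀ y, π (labZ b b' (s.eqv.symm (.inl (.inr y)))) = y₀ y := fun y => by
    rw [← bL (.inl (.inr y))]
    exact (bY y).trans (bL (.inl (.inl y)))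
  have c1 : cnt π c = cnt (fun v => π (.inl v)) c + cnt (fun v => π (.inr v)) c := cnt_sum _ _
  have c5 : cnt (fun x => π (p x)) c = cnt (fun x => π (.inl (b x))) c
      + cnt (fun x => π (.inr (b' x))) c := by
    rw [cnt_congr (s.oldCirc W₁ W₁' W₂ W₂')
      (fun x => π (p x)) (fun y => π (Sum.map b b' y)) c c (fun x => Iff.rfl), cnt_sum]
    rfl
  have c6 : cnt (fun k => β (Quot.mk _ k)) c
      = cnt (fun k : {k // s.oldL W₁ W₁' W₂ W₂' k = bdL (s.mfd W₁ W₂) (s.mfd W₁' W₂') k} =>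
          β (Quot.mk _ k.1)) c + 4 * cnt y₀ c := by
    rw [← cnt_congr (s.fixEqv W₁ W₁' W₂ W₂') (fun x => β (Quot.mk _ (s.fixEqv W₁ W₁' W₂ W₂' x))) _ c c
      (fun x => Iff.rfl), cnt_sum]
    congr 1
    have e1 : (fun y => β (Quot.mk _ (s.fixEqv W₁ W₁' W₂ W₂' (.inr (.inl y))))) = Sum.elim y₀ y₀ := by
      funext y
      rcases y with y | y
      · exact bL (.inl (.inl y))
      · exact (bL (.inl (.inr y))).trans (bY' y)
    have e2 : (fun y => β (Quot.mk _ (s.fixEqv W₁ W₁' W₂ W₂' (.inr (.inr y))))) = Sum.elim y₀ y₀ := by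
      funext y
      rcases y with y | y
      · exact bR (.inl (.inl y))
      · exact (bR (.inl (.inr y))).trans (bY' y)
    rw [cnt_sum, e1, e2, cnt_sum]
    show cnt y₀ c + cnt y₀ c + (cnt y₀ c + cnt y₀ c) = _
    ring
  have c7 : (arcs (fun x => π (.inl (b x))) c : ℤ) + arcs (fun x => π (.inr (b' x))) c
      = arcs β c + cnt y₀ c := by
    have e1 := pushW_sum (fun z => π (labZ b b' z))
      (fun z => if Sum.elim Z₁.pos Z₂.pos z then 1 else 0) c
    rw [arcs_pushW, arcs_pushW]
    refine e1.symm.trans ?_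
    have e2 := pushW_equiv s.eqv.symm (fun z => π (labZ b b' z))
      (fun z => if Sum.elim Z₁.pos Z₂.pos z then 1 else 0) c
    refine e2.symm.trans ?_
    rw [pushW_sum, pushW_sum]
    have e3 : (fun y => π (labZ b b' (s.eqv.symm (.inl (.inr y))))) = y₀ := funext bY'
    rw [e3, show (fun y => π (labZ b b' (s.eqv.symm (.inl (.inl y))))) = y₀ from rfl, ← pushW_add,
      arcs_pushW, add_comm]
    congr 1
    · have e4 : (fun z => π (labZ b b' (s.eqv.symm (.inr z))))
          = fun z => β (Quot.mk _ (.inl (.inr z))) := by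
        funext z; exact (bL (.inr z)).symm
      rw [e4]
      simp only [s.pos_rest]
    · rw [← pushW_one]
      congr 1
      funext y
      rw [s.pos_pair]
      cases Sum.elim Z₁.pos Z₂.pos (s.eqv.symm (.inl (.inl y))) <;> rfl
  have c10 : pushW π (Sum.elim w w') c
      = pushW (fun v => π (.inl v)) w c + pushW (fun v => π (.inr v)) w' c := by
    rw [pushW_sum]; rfl
  refine ⟨G + G' + m, ?_⟩
  rw [c10, hG, hG']
  rw [c1, c5, c6] at hm
  push_cast
  omega

end Sew

namespace Sew
variable {Z₁ Z₂ Z' : Signed} (s : Sew Z₁ Z₂ Z') {W₁ W₁' W₁'' : OneMfd Z₁} {W₂ W₂' W₂'' : OneMfd Z₂}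

/-- The piece containing a boundary point. -/
def ptZ (P : Pre W₁ W₁') (Q : Pre W₂ W₂') : Z₁.pt ⊕ Z₂.pt → P.X ⊕ Q.X :=
  Sum.map (fun z => P.f (.inl (.inr z))) (fun z => Q.f (.inl (.inr z)))

/-- The gluing relation of a sewn pair of surfaces. -/
inductive Rel (P : Pre W₁ W₁') (Q : Pre W₂ W₂') : P.X ⊕ Q.X → P.X ⊕ Q.X → Prop
  | left {x y} (h : P.r x y) : Rel P Q (.inl x) (.inl y)
  | right {x y} (h : Q.r x y) : Rel P Q (.inr x) (.inr y)
  | mid (y : s.Y) : Rel P Q (ptZ P Q (s.eqv.symm (.inl (.inl y)))) (ptZ P Q (s.eqv.symm (.inl (.inr y))))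

theorem rel_left (P : Pre W₁ W₁') (Q : Pre W₂ W₂') {x y : P.X} (h : Quot.mk P.r x = Quot.mk P.r y) :
    Quot.mk (s.Rel P Q) (.inl x) = Quot.mk _ (.inl y) :=
  congrArg (Quot.lift (fun x => Quot.mk (s.Rel P Q) (.inl x)) fun _ _ h =>
    Quot.sound (.left h)) h

theorem rel_right (P : Pre W₁ W₁') (Q : Pre W₂ W₂') {x y : Q.X} (h : Quot.mk Q.r x = Quot.mk Q.r y) :
    Quot.mk (s.Rel P Q) (.inr x) = Quot.mk _ (.inr y) :=
  congrArg (Quot.lift (fun x => Quot.mk (s.Rel P Q) (.inr x)) fun _ _ h =>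
    Quot.sound (.right h)) h

theorem rel_mid (P : Pre W₁ W₁') (Q : Pre W₂ W₂') (y : s.Y) :
    Quot.mk (s.Rel P Q) (ptZ P Q (s.eqv.symm (.inl (.inl y))))
      = Quot.mk _ (ptZ P Q (s.eqv.symm (.inl (.inr y)))) :=
  Quot.sound (.mid y)

theorem f_left (P : Pre W₁ W₁') (Q : Pre W₂ W₂') (p) :
    Sum.map P.f Q.f (s.spread _ _ _ _ (.inl (s.back _ p))) = ptZ P Q (s.eqv.symm p) := by
  rw [(s.spread_inl (W₁ := W₁) (W₁' := W₁') (W₂ := W₂) (W₂' := W₂') (s.back _ p)).trans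
    (congrArg _ (s.ends_back _ _ p))]
  generalize s.eqv.symm p = x
  rcases x with x | x <;> rfl

theorem f_right (P : Pre W₁ W₁') (Q : Pre W₂ W₂') (p) :
    Quot.mk (s.Rel P Q) (Sum.map P.f Q.f (s.spread _ _ _ _ (.inr (s.back _ p))))
      = Quot.mk (s.Rel P Q) (ptZ P Q (s.eqv.symm p)) := by
  rw [(s.spread_inr (W₁ := W₁) (W₁' := W₁') (W₂ := W₂) (W₂' := W₂') (s.back _ p)).trans
    (congrArg _ (s.ends_back _ _ p))]
  generalize s.eqv.symm p = x
  rcases x with x | x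
  · exact s.rel_left P Q (P.hL (.inl (.inr x)))
  · exact s.rel_right P Q (Q.hL (.inl (.inr x)))

/-- Sew two surfaces along `Y × [0,1]`. -/
def pre (P : Pre W₁ W₁') (Q : Pre W₂ W₂') : Pre (s.mfd W₁ W₂) (s.mfd W₁' W₂') where
  X := P.X ⊕ Q.X
  r := s.Rel P Q
  f k := Sum.map P.f Q.f (s.spread _ _ _ _ k)
  hE k := by
    rw [spread_bdE]
    generalize s.spread _ _ _ _ k = k
    rcases k with k | k
    · exact s.rel_left P Q (P.hE k)
    · exact s.rel_right P Q (Q.hE k)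
  hL := by
    rintro ((((j | j) | y) | z) | (((j | j) | y) | z))
    · exact s.rel_left P Q (P.hL (.inl (.inl j)))
    · exact s.rel_right P Q (Q.hL (.inl (.inl j)))
    · have key := fun p => congrArg (Quot.mk (s.Rel P Q)) (s.f_left P Q p)
      refine (key (.inl y.swap)).trans (Eq.trans ?_ (key (.inl y)).symm)
      rcases y with y | y
      · exact (s.rel_mid P Q y).symm
      · exact s.rel_mid P Q y
    · exact (s.f_right P Q (.inr z)).trans
        (congrArg (Quot.mk (s.Rel P Q)) (s.f_left P Q (.inr z))).symm
    · exact s.rel_left P Q (P.hL (.inr (.inl j)))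
    · exact s.rel_right P Q (Q.hL (.inr (.inl j)))
    · have key := s.f_right P Q
      refine (key (.inl y.swap)).trans (Eq.trans ?_ (key (.inl y)).symm)
      rcases y with y | y
      · exact (s.rel_mid P Q y).symm
      · exact s.rel_mid P Q y
    · exact (congrArg (Quot.mk (s.Rel P Q)) (s.f_left P Q (.inr z))).trans
        (s.f_right P Q (.inr z)).symm
  w := Sum.elim P.w Q.w

theorem pre_surf {P : Pre W₁ W₁'} {Q : Pre W₂ W₂'} (hP : P.Surf) (hQ : Q.Surf) :
    (s.pre P Q).Surf := by
  intro c
  let π : Quot P.r ⊕ Quot Q.r → Quot (s.Rel P Q) := Sum.elim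
    (Quot.lift (fun x => Quot.mk _ (.inl x)) fun _ _ h => Quot.sound (.left h))
    (Quot.lift (fun x => Quot.mk _ (.inr x)) fun _ _ h => Quot.sound (.right h))
  obtain ⟨g, hg⟩ := s.sew_count hP hQ π (s.pre P Q).bd (by
      intro k
      show Quot.mk (s.Rel P Q) (Sum.map P.f Q.f (s.spread _ _ _ _ k)) = _
      generalize s.spread _ _ _ _ k = k
      rcases k with k | k <;> rfl) (by
      intro φ hφ v w hvw
      let φ' : Quot (s.Rel P Q) → ℚ := Quot.lift
        (Sum.elim (fun x => φ (.inl (Quot.mk _ x))) (fun x => φ (.inr (Quot.mk _ x)))) (by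
          have key : ∀ z, φ (labZ P.bd Q.bd z) = Sum.elim (fun x => φ (.inl (Quot.mk _ x)))
              (fun x => φ (.inr (Quot.mk _ x))) (ptZ P Q z) := by
            rintro (z | z) <;> rfl
          rintro _ _ (h | h | y)
          · exact congrArg (fun x => φ (.inl x)) (Quot.sound h)
          · exact congrArg (fun x => φ (.inr x)) (Quot.sound h)
          · rw [← key, ← key]; exact hφ y)
      have : ∀ v, φ v = φ' (π v) := by
        rintro (v | v) <;> (induction v using Quot.ind; rfl)
      rw [this v, this w, hvw]) c
  refine ⟨g, ?_⟩
  refine Eq.trans ?_ hg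
  have e1 := pushW_sum π (Sum.elim (pushW (Quot.mk P.r) P.w) (pushW (Quot.mk Q.r) Q.w)) c
  have e2 := pushW_sum (Quot.mk (s.Rel P Q)) (Sum.elim P.w Q.w) c
  have e3 := pushW_pushW (Quot.mk P.r) (fun v => π (.inl v)) P.w c
  have e4 := pushW_pushW (Quot.mk Q.r) (fun v => π (.inr v)) Q.w c
  refine e2.trans (Eq.trans ?_ e1.symm)
  exact congrArg₂ (· + ·) e3.symm e4.symm

theorem _root_.Pre.Eqv.sew {P P' : Pre W₁ W₁'} {Q Q' : Pre W₂ W₂'} {g : P.X → P'.X} {h : P'.X → P.X}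
    {g' : Q.X → Q'.X} {h' : Q'.X → Q.X} (H : Pre.Eqv P P' g h) (H' : Pre.Eqv Q Q' g' h') :
    Pre.Eqv (s.pre P Q) (s.pre P' Q') (Sum.map g g') (Sum.map h h') where
  hg := by
    have key : ∀ z, Quot.mk (s.Rel P' Q') (Sum.map g g' (ptZ P Q z)) = Quot.mk _ (ptZ P' Q' z) := by
      rintro (z | z)
      · exact s.rel_left P' Q' (H.hf _)
      · exact s.rel_right P' Q' (H'.hf _)
    rintro _ _ (r | r | y)
    · exact s.rel_left P' Q' (H.hg _ _ r)
    · exact s.rel_right P' Q' (H'.hg _ _ r)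
    · exact (key _).trans ((s.rel_mid P' Q' y).trans (key _).symm)
  hh := by
    have key : ∀ z, Quot.mk (s.Rel P Q) (Sum.map h h' (ptZ P' Q' z)) = Quot.mk _ (ptZ P Q z) := by
      rintro (z | z)
      · exact s.rel_left P Q (H.hf' _)
      · exact s.rel_right P Q (H'.hf' _)
    rintro _ _ (r | r | y)
    · exact s.rel_left P Q (H.hh _ _ r)
    · exact s.rel_right P Q (H'.hh _ _ r)
    · exact (key _).trans ((s.rel_mid P Q y).trans (key _).symm)
  hgh := by
    rintro (x | x)
    · exact s.rel_left P Q (H.hgh x)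
    · exact s.rel_right P Q (H'.hgh x)
  hhg := by
    rintro (x | x)
    · exact s.rel_left P' Q' (H.hhg x)
    · exact s.rel_right P' Q' (H'.hhg x)
  hf := by
    intro k
    show Quot.mk (s.Rel P' Q') (Sum.map g g' (Sum.map P.f Q.f (s.spread _ _ _ _ k)))
      = Quot.mk (s.Rel P' Q') (Sum.map P'.f Q'.f (s.spread _ _ _ _ k))
    generalize s.spread _ _ _ _ k = k
    rcases k with k | k
    · exact s.rel_left P' Q' (H.hf k)
    · exact s.rel_right P' Q' (H'.hf k)
  hw := by
    intro c
    let π₁ : Quot P'.r → Quot (s.Rel P' Q') :=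
      Quot.lift (fun x => Quot.mk _ (.inl x)) fun _ _ h => Quot.sound (.left h)
    let π₂ : Quot Q'.r → Quot (s.Rel P' Q') :=
      Quot.lift (fun x => Quot.mk _ (.inr x)) fun _ _ h => Quot.sound (.right h)
    refine (pushW_sum (fun x => Quot.mk (s.Rel P' Q') (Sum.map g g' x)) (Sum.elim P.w Q.w) c).trans
      (Eq.trans ?_ (pushW_sum (Quot.mk (s.Rel P' Q')) (Sum.elim P'.w Q'.w) c).symm)
    have e1 := pushW_pushW (fun x => Quot.mk P'.r (g x)) π₁ P.w c
    have e2 := pushW_pushW (fun x => Quot.mk Q'.r (g' x)) π₂ Q.w c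
    have e3 := pushW_pushW (Quot.mk P'.r) π₁ P'.w c
    have e4 := pushW_pushW (Quot.mk Q'.r) π₂ Q'.w c
    rw [funext H.hw] at e1
    rw [funext H'.hw] at e2
    exact congrArg₂ (· + ·) (e1.symm.trans e3) (e2.symm.trans e4)

/-- Sewing of bordisms. -/
noncomputable def hom (a : BHom W₁ W₁') (b : BHom W₂ W₂') : BHom (s.mfd W₁ W₂) (s.mfd W₁' W₂') :=
  (s.pre a.rep b.rep).cls (s.pre_surf a.rep_surf b.rep_surf)

theorem hom_cls {P : Pre W₁ W₁'} {Q : Pre W₂ W₂'} (hP : P.Surf) (hQ : Q.Surf) :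
    s.hom (P.cls hP) (Q.cls hQ) = (s.pre P Q).cls (s.pre_surf hP hQ) := by
  obtain ⟨g, h, H⟩ := Pre.exists_eqv (BHom.rep_surf (P.cls hP)) hP (BHom.rep_cls _)
  obtain ⟨g', h', H'⟩ := Pre.exists_eqv (BHom.rep_surf (Q.cls hQ)) hQ (BHom.rep_cls _)
  exact (H.sew s H').cls _ _

theorem e_ends (W₁ : OneMfd Z₁) (W₂ : OneMfd Z₂) (k) :
    (s.mfd W₁ W₂).e ((s.ends _ _).symm k) = (s.ends _ _).symm (Sum.map W₁.e W₂.e k) :=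
  congrArg (fun k => (s.ends _ _).symm (Sum.map W₁.e W₂.e k)) (Equiv.apply_symm_apply _ _)

theorem hom_one (W₁ : OneMfd Z₁) (W₂ : OneMfd Z₂) :
    s.hom (BHom.one W₁) (BHom.one W₂) = BHom.one (s.mfd W₁ W₂) := by
  unfold BHom.one
  rw [hom_cls]
  have pz : ∀ z, ptZ (Pre.one W₁) (Pre.one W₂) z = Sum.map .inr .inr z := by
    rintro (z | z) <;> rfl
  have key : ∀ p, (s.ends W₁.J W₂.J).symm (Sum.map .inr .inr (s.eqv.symm p)) = s.back _ p := by
    intro p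
    rw [Equiv.symm_apply_eq, ends_back]
  have kf : ∀ k, Sum.map (Sum.elim id id) (Sum.elim id id) (s.spread W₁ W₁ W₂ W₂ k)
      = s.ends _ _ (Sum.elim id id k) := by
    rintro (k | k)
    · rw [spread_inl]
      show _ = s.ends _ _ k
      generalize s.ends _ _ k = k
      rcases k with k | k <;> rfl
    · rw [spread_inr]
      show _ = s.ends _ _ k
      generalize s.ends _ _ k = k
      rcases k with k | k <;> rfl
  refine Pre.Eqv.cls (g := (s.ends W₁.J W₂.J).symm) (h := s.ends W₁.J W₂.J) ?_ _ _
  constructor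
  · rintro _ _ ((x | j) | (x | j) | y)
    · exact ((s.mfd W₁ W₂).mk_e _).symm.trans (congrArg (Quot.mk _) (s.e_ends W₁ W₂ (.inl _)))
    · exact ((s.mfd W₁ W₂).mk_l (.inl (.inl j))).symm
    · exact ((s.mfd W₁ W₂).mk_e _).symm.trans (congrArg (Quot.mk _) (s.e_ends W₁ W₂ (.inr _)))
    · exact ((s.mfd W₁ W₂).mk_l (.inl (.inr j))).symm
    · rw [pz, pz]
      refine (congrArg (Quot.mk _) (key _)).trans (Eq.trans ?_ (congrArg (Quot.mk _) (key _)).symm)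
      exact ((s.mfd W₁ W₂).mk_l (.inr (.inl y))).symm
  · rintro _ _ (x | j)
    · refine Eq.trans ?_ (congrArg (Quot.mk _) (s.ends_e W₁ W₂ _)).symm
      have key2 : ∀ x, Quot.mk (s.Rel (Pre.one W₁) (Pre.one W₂)) x = Quot.mk _ (Sum.map W₁.e W₂.e x) := by
        rintro (x | x)
        · exact Quot.sound (.left (.e x))
        · exact Quot.sound (.right (.e x))
      exact key2 _
    · rcases j with (j | j) | y
      · exact Quot.sound (.left (.l j))
      · exact Quot.sound (.right (.l j))
      · have e : ∀ y, s.ends W₁.J W₂.J (.inl (.inr y)) = ptZ (Pre.one W₁) (Pre.one W₂) (s.eqv.symm (.inl y)) :=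
          fun y => (s.ends_back _ _ (.inl y)).trans (pz _).symm
        refine (congrArg (Quot.mk (s.Rel (Pre.one W₁) (Pre.one W₂))) (e y)).trans
          (Eq.trans ?_ (congrArg (Quot.mk (s.Rel (Pre.one W₁) (Pre.one W₂))) (e y.swap)).symm)
        rcases y with y | y
        · exact s.rel_mid _ _ y
        · exact (s.rel_mid _ _ y).symm
  · intro x
    exact congrArg (Quot.mk _) (Equiv.apply_symm_apply _ _)
  · intro x
    exact congrArg (Quot.mk _) (Equiv.symm_apply_apply _ _)
  · intro k
    refine congrArg (Quot.mk _) ?_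
    refine (congrArg _ (kf k)).trans (Equiv.symm_apply_apply _ _)
  · intro c
    refine Eq.trans ?_ (pushW_zero _ _).symm
    have : (s.pre (Pre.one W₁) (Pre.one W₂)).w = fun _ => 0 := by
      funext x; rcases x with x | x <;> rfl
    rw [this]
    exact pushW_zero _ _

theorem hom_comp (a : BHom W₁ W₁') (b : BHom W₂ W₂') (a' : BHom W₁' W₁'') (b' : BHom W₂' W₂'') :
    s.hom (a.comp a') (b.comp b') = (s.hom a b).comp (s.hom a' b') := by
  obtain ⟨P, hP, rfl⟩ := a.exists_pre
  obtain ⟨Q, hQ, rfl⟩ := b.exists_pre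
  obtain ⟨P', hP', rfl⟩ := a'.exists_pre
  obtain ⟨Q', hQ', rfl⟩ := b'.exists_pre
  rw [BHom.comp_cls, BHom.comp_cls, hom_cls, hom_cls, hom_cls, BHom.comp_cls]
  have SC : ∀ z, Equiv.sumSumSumComm P.X P'.X Q.X Q'.X (ptZ (P.comp P') (Q.comp Q') z)
      = .inl (ptZ P Q z) := by
    rintro (z | z) <;> rfl
  have kf : ∀ k : (s.mfd W₁ W₂).H ⊕ (s.mfd W₁'' W₂'').H,
      Equiv.sumSumSumComm P.X P'.X Q.X Q'.X
        (Sum.map (P.comp P').f (Q.comp Q').f (s.spread _ _ _ _ k))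
      = ((s.pre P Q).comp (s.pre P' Q')).f k := by
    rintro (k | k)
    · rw [spread_inl]
      show _ = Sum.inl (Sum.map P.f Q.f (s.spread _ _ _ _ (.inl k)))
      rw [spread_inl]
      generalize s.ends _ _ k = k
      rcases k with k | k <;> rfl
    · rw [spread_inr]
      show _ = Sum.inr (Sum.map P'.f Q'.f (s.spread _ _ _ _ (.inr k)))
      rw [spread_inr]
      generalize s.ends _ _ k = k
      rcases k with k | k <;> rfl
  -- how the middle boundary sits in the sewn composites
  have hm : ∀ k : (s.mfd W₁' W₂').H,
      Quot.mk (s.pre (P.comp P') (Q.comp Q')).r ((Equiv.sumSumSumComm P.X P'.X Q.X Q'.X).symm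
        (.inl ((s.pre P Q).f (.inr k)))) = Quot.mk _ ((Equiv.sumSumSumComm P.X P'.X Q.X Q'.X).symm
        (.inr ((s.pre P' Q').f (.inl k)))) := by
    intro k
    show Quot.mk (s.pre (P.comp P') (Q.comp Q')).r ((Equiv.sumSumSumComm P.X P'.X Q.X Q'.X).symm
        (.inl (Sum.map P.f Q.f (s.spread _ _ _ _ (.inr k))))) = Quot.mk _
        ((Equiv.sumSumSumComm P.X P'.X Q.X Q'.X).symm
        (.inr (Sum.map P'.f Q'.f (s.spread _ _ _ _ (.inl k)))))
    rw [spread_inl, spread_inr]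
    generalize s.ends _ _ k = k
    rcases k with k | k
    · exact Quot.sound (.left (.mid k))
    · exact Quot.sound (.right (.mid k))
  refine Pre.Eqv.cls (g := Equiv.sumSumSumComm _ _ _ _) (h := (Equiv.sumSumSumComm _ _ _ _).symm)
    ?_ _ _
  constructor
  · rintro _ _ ((r | r | k) | (r | r | k) | y)
    · exact Pre.glue_left (s.pre P Q) (s.pre P' Q') (s.rel_left P Q (Quot.sound r))
    · exact Pre.glue_right (s.pre P Q) (s.pre P' Q') (s.rel_left P' Q' (Quot.sound r))
    · have := Pre.glue_mid (s.pre P Q) (s.pre P' Q') ((s.ends _ _).symm (.inl k))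
      have e1 : (s.pre P Q).f (.inr ((s.ends _ _).symm (.inl k))) = .inl (P.f (.inr k)) :=
        (congrArg (Sum.map P.f Q.f) (s.spread_inr _)).trans
          (congrArg (fun k => Sum.map P.f Q.f (Sum.map Sum.inr Sum.inr k))
            (Equiv.apply_symm_apply (s.ends _ _) _))
      have e2 : (s.pre P' Q').f (.inl ((s.ends _ _).symm (.inl k))) = .inl (P'.f (.inl k)) :=
        (congrArg (Sum.map P'.f Q'.f) (s.spread_inl _)).trans
          (congrArg (fun k => Sum.map P'.f Q'.f (Sum.map Sum.inl Sum.inl k))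
            (Equiv.apply_symm_apply (s.ends _ _) _))
      rw [e1, e2] at this
      exact this
    · exact Pre.glue_left (s.pre P Q) (s.pre P' Q') (s.rel_right P Q (Quot.sound r))
    · exact Pre.glue_right (s.pre P Q) (s.pre P' Q') (s.rel_right P' Q' (Quot.sound r))
    · have := Pre.glue_mid (s.pre P Q) (s.pre P' Q') ((s.ends _ _).symm (.inr k))
      have e1 : (s.pre P Q).f (.inr ((s.ends _ _).symm (.inr k))) = .inr (Q.f (.inr k)) :=
        (congrArg (Sum.map P.f Q.f) (s.spread_inr _)).trans
          (congrArg (fun k => Sum.map P.f Q.f (Sum.map Sum.inr Sum.inr k))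
            (Equiv.apply_symm_apply (s.ends _ _) _))
      have e2 : (s.pre P' Q').f (.inl ((s.ends _ _).symm (.inr k))) = .inr (Q'.f (.inl k)) :=
        (congrArg (Sum.map P'.f Q'.f) (s.spread_inl _)).trans
          (congrArg (fun k => Sum.map P'.f Q'.f (Sum.map Sum.inl Sum.inl k))
            (Equiv.apply_symm_apply (s.ends _ _) _))
      rw [e1, e2] at this
      exact this
    · exact (congrArg (Quot.mk _) (SC _)).trans ((Pre.glue_left (s.pre P Q) (s.pre P' Q')
        (s.rel_mid P Q y)).trans (congrArg (Quot.mk _) (SC _)).symm)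
  · have L1 : ∀ z, Quot.mk (s.pre (P.comp P') (Q.comp Q')).r
        ((Equiv.sumSumSumComm P.X P'.X Q.X Q'.X).symm (.inl (ptZ P Q z)))
        = Quot.mk _ (ptZ (P.comp P') (Q.comp Q') z) := by
      rintro (z | z) <;> rfl
    have L2 : ∀ z, Quot.mk (s.pre (P.comp P') (Q.comp Q')).r
        ((Equiv.sumSumSumComm P.X P'.X Q.X Q'.X).symm (.inr (ptZ P' Q' z)))
        = Quot.mk _ (ptZ (P.comp P') (Q.comp Q') z) := by
      rintro (z | z)
      · exact s.rel_left (P.comp P') (Q.comp Q') ((Pre.glue_mid P P' (.inr z)).symm.trans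
          (Pre.glue_left P P' (P.hL (.inl (.inr z)))))
      · exact s.rel_right (P.comp P') (Q.comp Q') ((Pre.glue_mid Q Q' (.inr z)).symm.trans
          (Pre.glue_left Q Q' (Q.hL (.inl (.inr z)))))
    rintro _ _ ((r | r | y) | (r | r | y) | k)
    · exact s.rel_left (P.comp P') (Q.comp Q') (Pre.glue_left P P' (Quot.sound r))
    · exact s.rel_right (P.comp P') (Q.comp Q') (Pre.glue_left Q Q' (Quot.sound r))
    · exact (L1 _).trans ((s.rel_mid _ _ y).trans (L1 _).symm)
    · exact s.rel_left (P.comp P') (Q.comp Q') (Pre.glue_right P P' (Quot.sound r))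
    · exact s.rel_right (P.comp P') (Q.comp Q') (Pre.glue_right Q Q' (Quot.sound r))
    · exact (L2 _).trans ((s.rel_mid _ _ y).trans (L2 _).symm)
    · exact hm k
  · intro x
    exact congrArg (Quot.mk _) (Equiv.symm_apply_apply _ _)
  · intro x
    exact congrArg (Quot.mk _) (Equiv.apply_symm_apply _ _)
  · intro k
    exact congrArg (Quot.mk _) (kf k)
  · intro c
    refine Eq.trans ?_ (pushW_equiv (Equiv.sumSumSumComm P.X P'.X Q.X Q'.X)
      (Quot.mk ((s.pre P Q).comp (s.pre P' Q')).r) ((s.pre P Q).comp (s.pre P' Q')).w c)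
    congr 1
    funext x
    rcases x with (x | x) | (x | x) <;> rfl

end Sew

/-! ### Local modifications of surfaces -/

section
variable {Z : Signed} {W₀ W₁ W₂ : OneMfd Z}

/-- Add a closed component of Euler characteristic `n`. -/
def Pre.add (P : Pre W₀ W₁) (n : ℤ) : Pre W₀ W₁ where
  X := P.X ⊕ Unit
  r x y := ∃ a b, x = .inl a ∧ y = .inl b ∧ P.r a b
  f k := .inl (P.f k)
  hE k := congrArg (Quot.lift (fun a => Quot.mk (fun x y : P.X ⊕ Unit =>
      ∃ a b, x = .inl a ∧ y = .inl b ∧ P.r a b) (.inl a))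
    fun a b h => Quot.sound ⟨a, b, rfl, rfl, h⟩) (P.hE k)
  hL k := congrArg (Quot.lift (fun a => Quot.mk (fun x y : P.X ⊕ Unit =>
      ∃ a b, x = .inl a ∧ y = .inl b ∧ P.r a b) (.inl a))
    fun a b h => Quot.sound ⟨a, b, rfl, rfl, h⟩) (P.hL k)
  w := Sum.elim P.w (fun _ => n)

theorem Pre.add_mk (P : Pre W₀ W₁) (n : ℤ) {x y : P.X} (h : Quot.mk P.r x = Quot.mk P.r y) :
    Quot.mk (P.add n).r (.inl x) = Quot.mk (P.add n).r (.inl y) :=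
  congrArg (Quot.lift (fun a => Quot.mk (P.add n).r (.inl a))
    fun a b h => Quot.sound ⟨a, b, rfl, rfl, h⟩) h

/-- The components after adding a closed one. -/
def Pre.addQuot (P : Pre W₀ W₁) (n : ℤ) : Quot (P.add n).r ≃ Quot P.r ⊕ Unit where
  toFun := Quot.lift (Sum.map (Quot.mk _) id) (by
    rintro _ _ ⟨a, b, rfl, rfl, h⟩
    exact congrArg Sum.inl (Quot.sound h))
  invFun := Sum.elim (Quot.lift (fun a => Quot.mk _ (.inl a))
    fun a b h => Quot.sound ⟨a, b, rfl, rfl, h⟩) (fun u => Quot.mk _ (.inr u))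
  left_inv q := by
    induction q using Quot.ind with
    | mk x => rcases x with x | x <;> rfl
  right_inv q := by
    rcases q with q | q
    · induction q using Quot.ind; rfl
    · rfl

theorem cnt_of_forall_ne {X Y : Type} (g : X → Y) (y : Y) (h : ∀ x, g x ≠ y) : cnt g y = 0 := by
  have : IsEmpty {x // g x = y} := ⟨fun x => h x.1 x.2⟩
  exact Nat.card_of_isEmpty

theorem pushW_of_forall_ne {X Y : Type} [Finite X] (g : X → Y) (w : X → ℤ) (y : Y)
    (h : ∀ x, g x ≠ y) : pushW g w y = 0 := by
  have := Fintype.ofFinite X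
  classical
  rw [pushW_eq]
  exact Finset.sum_eq_zero fun x _ => if_neg (h x)

theorem Pre.add_surf {P : Pre W₀ W₁} (hP : P.Surf) {n : ℤ} (g : ℕ) (hn : n = 2 - 2 * g) :
    (P.add n).Surf := by
  intro c
  obtain ⟨c, rfl⟩ := (P.addQuot n).symm.surjective c
  have hbd : ∀ x, (P.addQuot n).symm (.inl (P.bd x)) = (P.add n).bd x := by
    intro x; induction x using Quot.ind; rfl
  have hinj : Function.Injective fun x => (P.addQuot n).symm (.inl x) :=
    (P.addQuot n).symm.injective.comp Sum.inl_injective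
  have e0 := pushW_sum (Quot.mk (P.add n).r) (Sum.elim P.w (fun _ => n)) ((P.addQuot n).symm c)
  rcases c with c | c
  · obtain ⟨m, hm⟩ := hP c
    refine ⟨m, ?_⟩
    have e1 : cnt (P.add n).bd ((P.addQuot n).symm (.inl c)) = cnt P.bd c :=
      (cnt_congr (Equiv.refl _) _ _ _ _ fun x => by rw [Equiv.refl_apply, ← hbd, hinj.eq_iff]).symm
    have e2 : arcs (P.add n).bd ((P.addQuot n).symm (.inl c)) = arcs P.bd c :=
      (cnt_congr (Equiv.refl _) _ _ _ _ fun x => by rw [Equiv.refl_apply, ← hbd, hinj.eq_iff]).symm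
    rw [e1, e2]
    refine (e0.trans ?_).trans hm
    have e3 := pushW_inj (Quot.mk P.r) _ hinj P.w c
    have e4 := pushW_of_forall_ne (fun x : Unit => Quot.mk (P.add n).r (.inr x)) (fun _ => n)
      ((P.addQuot n).symm (.inl c)) (by
        intro x h
        have := (Equiv.eq_symm_apply (P.addQuot n)).1 h
        cases this)
    exact (congrArg₂ (· + ·) e3 e4).trans (add_zero _)
  · refine ⟨g, ?_⟩
    have hne : ∀ x, (P.add n).bd x ≠ (P.addQuot n).symm (.inr c) := by
      intro x h
      rw [← hbd] at h
      have := (P.addQuot n).symm.injective h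
      cases this
    have e1 : cnt (P.add n).bd ((P.addQuot n).symm (.inr c)) = 0 := cnt_of_forall_ne _ _ hne
    have e2 : arcs (P.add n).bd ((P.addQuot n).symm (.inr c)) = 0 :=
      cnt_of_forall_ne _ _ fun z => hne _
    rw [e1, e2]
    refine e0.trans ?_
    have e3 := pushW_of_forall_ne (fun x : P.X => Quot.mk (P.add n).r (.inl x)) P.w
      ((P.addQuot n).symm (.inr c)) (by
        intro x h
        have := (Equiv.eq_symm_apply (P.addQuot n)).1 h
        cases this)
    have e4 := pushW_self (fun x : Unit => Quot.mk (P.add n).r (.inr x))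
      (fun _ _ _ => rfl) (fun _ => n) c
    refine (congrArg₂ (· + ·) e3 e4).trans ?_
    rw [hn]; simp

open scoped Classical in
/-- Remove two small discs at the pieces `x` and `y` and connect their boundaries by a tube. -/
noncomputable def Pre.tube (P : Pre W₀ W₁) (x y : P.X) : Pre W₀ W₁ where
  X := P.X
  r a b := P.r a b ∨ (a = x ∧ b = y)
  f := P.f
  hE k := congrArg (Quot.lift (fun a => Quot.mk (fun a b => P.r a b ∨ (a = x ∧ b = y)) a)
    fun _ _ h => Quot.sound (Or.inl h)) (P.hE k)
  hL k := congrArg (Quot.lift (fun a => Quot.mk (fun a b => P.r a b ∨ (a = x ∧ b = y)) a)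
    fun _ _ h => Quot.sound (Or.inl h)) (P.hL k)
  w a := P.w a + if a = x then -2 else 0

/-- The map on components induced by attaching a tube. -/
def Pre.tubeQuot (P : Pre W₀ W₁) (x y : P.X) : Quot P.r → Quot (P.tube x y).r :=
  Quot.lift (fun a => Quot.mk _ a) fun _ _ h => Quot.sound (Or.inl h)

theorem Pre.tube_mk (P : Pre W₀ W₁) (x y : P.X) {a b : P.X} (h : Quot.mk P.r a = Quot.mk P.r b) :
    Quot.mk (P.tube x y).r a = Quot.mk (P.tube x y).r b := congrArg (P.tubeQuot x y) h

theorem Pre.tube_xy (P : Pre W₀ W₁) (x y : P.X) :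
    Quot.mk (P.tube x y).r x = Quot.mk (P.tube x y).r y := Quot.sound (Or.inr ⟨rfl, rfl⟩)

theorem Pre.tube_surf {P : Pre W₀ W₁} (hP : P.Surf) (x y : P.X) : (P.tube x y).Surf := by
  classical
  intro c
  obtain ⟨G, hG⟩ := IsSurf.push hP (P.tubeQuot x y) c
  have e1 : pushW (P.tubeQuot x y) (pushW (Quot.mk P.r) P.w) c = pushW (Quot.mk (P.tube x y).r) P.w c :=
    pushW_pushW _ _ _ _
  have e2 : pushW (Quot.mk (P.tube x y).r) (P.tube x y).w c = pushW (Quot.mk (P.tube x y).r) P.w c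
      + if Quot.mk (P.tube x y).r x = c then -2 else 0 := by
    refine (pushW_add _ _ _ _).trans (congrArg₂ (· + ·) rfl ?_)
    have : Fintype P.X := Fintype.ofFinite _
    refine (pushW_eq (X := P.X) _ _ _).trans ?_
    rw [Finset.sum_eq_single x]
    · simp
    · intro b _ hb; simp [hb]
    · simp
  have e3 : ∀ z, (P.tube x y).bd z = P.tubeQuot x y (P.bd z) := by
    intro z; induction z using Quot.ind; rfl
  have e4 : cnt (P.tube x y).bd c = cnt (fun z => P.tubeQuot x y (P.bd z)) c := by
    rw [← funext e3]
  have e5 : arcs (P.tube x y).bd c = arcs (fun z => P.tubeQuot x y (P.bd z)) c := by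
    rw [← funext e3]
  -- the fibres of the map on components
  let κ : Quot (P.tube x y).r → Quot P.r := Quot.lift
    (fun a => if Quot.mk P.r a = Quot.mk P.r y then Quot.mk P.r x else Quot.mk P.r a) (by
      rintro a b (h | ⟨h1, h2⟩)
      · exact congrArg (fun q => if q = Quot.mk P.r y then Quot.mk P.r x else q) (Quot.sound h)
      · let F : P.X → Quot P.r := fun a =>
          if Quot.mk P.r a = Quot.mk P.r y then Quot.mk P.r x else Quot.mk P.r a
        have hF : F x = F y := by simp [F]
        exact (congrArg F h1).trans (hF.trans (congrArg F h2).symm))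
  have hκ : ∀ v, κ (P.tubeQuot x y v) = if v = Quot.mk P.r y then Quot.mk P.r x else v := by
    intro v; induction v using Quot.ind; rfl
  have hπ : ∀ a, P.tubeQuot x y (Quot.mk P.r a) = Quot.mk (P.tube x y).r a := fun a => rfl
  have hsurj : Function.Surjective (P.tubeQuot x y) := by
    intro c; induction c using Quot.ind with
    | mk a => exact ⟨Quot.mk _ a, rfl⟩
  have hcnt : cnt (P.tubeQuot x y) c = 1 ∨
      (cnt (P.tubeQuot x y) c = 2 ∧ Quot.mk (P.tube x y).r x = c) := by
    have : Fintype (Quot P.r) := Fintype.ofFinite _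
    have hc : cnt (P.tubeQuot x y) c = (Finset.univ.filter fun v => P.tubeQuot x y v = c).card := by
      rw [cnt, Nat.card_eq_fintype_card, Fintype.card_subtype]
    rw [hc]
    by_cases h : Quot.mk (P.tube x y).r x = c
    · have hset : (Finset.univ.filter fun v => P.tubeQuot x y v = c)
          = {Quot.mk P.r x, Quot.mk P.r y} := by
        ext v
        simp only [Finset.mem_filter, Finset.mem_univ, true_and, Finset.mem_insert,
          Finset.mem_singleton]
        constructor
        · intro hv
          have h1 := congrArg κ (hv.trans h.symm)
          rw [← hπ, hκ, hκ] at h1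
          by_cases hvy : v = Quot.mk P.r y
          · exact Or.inr hvy
          · rw [if_neg hvy] at h1
            left
            rw [h1]; split <;> rfl
        · rintro (rfl | rfl)
          · exact h
          · exact (P.tube_xy x y).symm.trans h
      rw [hset]
      by_cases hxy : Quot.mk P.r x = Quot.mk P.r y
      · left; rw [hxy]; simp
      · right; exact ⟨Finset.card_pair hxy, h⟩
    · left
      obtain ⟨v, rfl⟩ := hsurj c
      have hx : ∀ u, P.tubeQuot x y u = P.tubeQuot x y v → u ≠ Quot.mk P.r y := by
        rintro _ hu rfl
        exact h ((P.tube_xy x y).trans hu)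
      have hset : (Finset.univ.filter fun u => P.tubeQuot x y u = P.tubeQuot x y v) = {v} := by
        ext u
        simp only [Finset.mem_filter, Finset.mem_univ, true_and, Finset.mem_singleton]
        constructor
        · intro hu
          have h1 := congrArg κ hu
          rwa [hκ, hκ, if_neg (hx u hu), if_neg (hx v rfl)] at h1
        · rintro rfl; rfl
      rw [hset]; simp
  rw [e4, e5, e2, ← e1, hG]
  rcases hcnt with h | ⟨h, h'⟩
  · by_cases hx : Quot.mk (P.tube x y).r x = c
    · rw [if_pos hx, h]
      exact ⟨G + 1, by push_cast; ring⟩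
    · rw [if_neg hx, h]
      exact ⟨G, by push_cast; ring⟩
  · rw [if_pos h', h]
    exact ⟨G, by push_cast; ring⟩

end

/-! ### Smoothings of a checkerboard coloured 4-valent diagram, and saddles between them -/

/-- The pairing of the four ends at a smoothed vertex: `0-3, 1-2` (`true`) or `0-1, 2-3` (`false`). -/
def pairing (b : Bool) (i : Fin 4) : Fin 4 := if b then ![3, 2, 1, 0] i else ![1, 0, 3, 2] i

theorem pairing_pairing (b : Bool) (i : Fin 4) : pairing b (pairing b i) = i := by
  revert b i; decide

theorem pairing_comm (b b' : Bool) (i : Fin 4) :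
    pairing b (pairing b' i) = pairing b' (pairing b i) := by
  revert b b' i; decide

theorem pairing_ne {b b' : Bool} (h : b ≠ b') (i : Fin 4) : pairing b i ≠ pairing b' i := by
  revert b b' i; decide

/-- A coloured 4-valent diagram with boundary `Z`: 4-valent vertices `N` with their four ends in
counterclockwise order, 2-valent vertices `M`, an involution `e` exchanging the two ends of each edge,
and the colouring `o` (whether the region to the left, as seen from the end of an edge, is black),
which changes between neighbouring ends at a vertex and between the two ends of an edge. -/
structure Frame (Z : Signed) where
  N : Type
  M : Type
  [finN : Finite N]
  [finM : Finite M]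
  e : (N × Fin 4 ⊕ M × Bool) ⊕ Z.pt → (N × Fin 4 ⊕ M × Bool) ⊕ Z.pt
  o : N × Fin 4 ⊕ M × Bool → Bool
  e_e : ∀ x, e (e x) = x
  e_o : ∀ x, Sum.elim o Z.pos (e x) = !Sum.elim o Z.pos x
  o_N : ∀ n i, o (.inl (n, i + 1)) = !o (.inl (n, i))
  o_M : ∀ m, o (.inr (m, true)) = !o (.inr (m, false))

namespace Frame
attribute [instance] finN finM
variable {Z : Signed} (F : Frame Z)

/-- The ends at the vertices. -/
abbrev J : Type := F.N × Fin 4 ⊕ F.M × Bool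
/-- All ends. -/
abbrev H : Type := F.J ⊕ Z.pt

/-- How ends are joined in the smoothing `σ`. -/
def join (σ : F.N → Bool) : F.J → F.J
  | .inl (n, i) => .inl (n, pairing (σ n) i)
  | .inr (m, b) => .inr (m, !b)

theorem o_pairing (n : F.N) (b : Bool) (i : Fin 4) :
    F.o (.inl (n, pairing b i)) = !F.o (.inl (n, i)) := by
  have h0 := F.o_N n 0
  have h1 := F.o_N n 1
  have h2 := F.o_N n 2
  simp only [Fin.isValue, zero_add, Fin.reduceAdd] at h0 h1 h2
  fin_cases i <;> cases b <;> simp [pairing, h0, h1, h2]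

/-- The smoothing `σ` of the diagram, an oriented `1`-manifold. -/
def smooth (σ : F.N → Bool) : OneMfd Z where
  J := F.J
  e := F.e
  l := F.join σ
  o := F.o
  e_e := F.e_e
  e_o := F.e_o
  l_l := by rintro (⟨n, i⟩ | ⟨m, b⟩) <;> simp [join, pairing_pairing]
  l_o := by
    rintro (⟨n, i⟩ | ⟨m, b⟩)
    · exact F.o_pairing n _ i
    · cases b
      · exact F.o_M m
      · simp [join, F.o_M m]

/-- Two ends lie on the same edge, or are joined in one of the smoothings `σ`, `σ'`. -/
inductive Rel (σ σ' : F.N → Bool) : F.H → F.H → Prop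
  | e (x) : Rel σ σ' x (F.e x)
  | l (j) : Rel σ σ' (.inl j) (.inl (F.join σ j))
  | l' (j) : Rel σ σ' (.inl j) (.inl (F.join σ' j))

open scoped Classical in
/-- Each vertex where the smoothings differ contributes a saddle, of Euler characteristic `-1`. -/
noncomputable def wt (σ σ' : F.N → Bool) : F.H → ℤ
  | .inl (.inl (n, i)) => if i = 0 ∧ σ n ≠ σ' n then -1 else 0
  | _ => 0

/-- The bordism between two smoothings with one saddle at each vertex where they differ. -/
noncomputable def saddle (σ σ' : F.N → Bool) : Pre (F.smooth σ) (F.smooth σ') where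
  X := F.H
  r := F.Rel σ σ'
  f := Sum.elim id id
  hE := by rintro (x | x) <;> exact (Quot.sound (.e x)).symm
  hL := by
    rintro ((j | z) | (j | z))
    exacts [(Quot.sound (.l j)).symm, rfl, (Quot.sound (.l' j)).symm, rfl]
  w := F.wt σ σ'

/-- The ends at which two smoothings differ. -/
def diffEqv (σ σ' : F.N → Bool) : {k // bdL (F.smooth σ) (F.smooth σ) k = bdL (F.smooth σ) (F.smooth σ') k}
    ⊕ ({n // σ n ≠ σ' n} × Fin 4) ≃ F.H ⊕ F.H where
  toFun := Sum.elim Subtype.val (fun p => .inr (.inl (.inl (p.1.1, p.2))))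
  invFun
    | .inl (.inl j) => .inl ⟨.inl (.inl j), rfl⟩
    | .inl (.inr z) => .inl ⟨.inl (.inr z), rfl⟩
    | .inr (.inr z) => .inl ⟨.inr (.inr z), rfl⟩
    | .inr (.inl (.inr m)) => .inl ⟨.inr (.inl (.inr m)), rfl⟩
    | .inr (.inl (.inl (n, i))) => if h : σ n = σ' n then .inl ⟨.inr (.inl (.inl (n, i))), by
        simp [bdL, smooth, join, h]⟩ else .inr (⟨n, h⟩, i)
  left_inv := by
    rintro (⟨(j | z) | ((⟨n, i⟩ | m) | z), h⟩ | ⟨⟨n, h⟩, i⟩)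
    · rfl
    · rfl
    · have hn : σ n = σ' n := by
        by_contra hn
        simp only [bdL, smooth, join, Sum.inr.injEq, Sum.inl.injEq, Prod.mk.injEq, true_and] at h
        exact pairing_ne hn i h
      exact dif_pos hn
    · rfl
    · rfl
    · exact dif_neg h
  right_inv := by
    rintro ((j | z) | ((⟨n, i⟩ | m) | z))
    · rfl
    · rfl
    · by_cases hn : σ n = σ' n
      · exact congrArg (Sum.elim Subtype.val _) (dif_pos hn)
      · exact congrArg (Sum.elim Subtype.val _) (dif_neg hn)
    · rfl
    · rfl

theorem mk_l (σ σ' : F.N → Bool) (j) :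
    Quot.mk (F.Rel σ σ') (.inl (F.join σ j)) = Quot.mk _ (.inl j) := (Quot.sound (.l j)).symm
theorem mk_l' (σ σ' : F.N → Bool) (j) :
    Quot.mk (F.Rel σ σ') (.inl (F.join σ' j)) = Quot.mk _ (.inl j) := (Quot.sound (.l' j)).symm
theorem mk_e (σ σ' : F.N → Bool) (x) :
    Quot.mk (F.Rel σ σ') (F.e x) = Quot.mk _ x := (Quot.sound (.e x)).symm

/-- All four ends at a differing vertex lie on the same component. -/
theorem mk_vertex {σ σ' : F.N → Bool} {n : F.N} (h : σ n ≠ σ' n) (i : Fin 4) :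
    Quot.mk (F.Rel σ σ') (.inl (.inl (n, i))) = Quot.mk _ (.inl (.inl (n, 0))) := by
  have h1 := fun i => F.mk_l σ σ' (.inl (n, i))
  have h2 := fun i => F.mk_l' σ σ' (.inl (n, i))
  simp only [join] at h1 h2
  have key : ∀ i, Quot.mk (F.Rel σ σ') (.inl (.inl (n, pairing true i))) = Quot.mk _ (.inl (.inl (n, i)))
      ∧ Quot.mk (F.Rel σ σ') (.inl (.inl (n, pairing false i))) = Quot.mk _ (.inl (.inl (n, i))) := by
    intro i
    cases hσ : σ n <;> cases hσ' : σ' n <;> simp only [hσ, hσ'] at h h1 h2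
    · exact absurd rfl h
    · exact ⟨h2 i, h1 i⟩
    · exact ⟨h1 i, h2 i⟩
    · exact absurd rfl h
  have e3 := (key 0).1
  have e1 := (key 0).2
  have e2 := (key 3).2
  simp only [pairing, if_true] at e3
  simp [pairing] at e1 e2
  fin_cases i
  · rfl
  · exact e1
  · exact e2.trans e3
  · exact e3

theorem saddle_count (σ σ' : F.N → Bool) (b : BdCirc (F.smooth σ) (F.smooth σ') → Quot (F.Rel σ σ'))
    (hb : ∀ k, b (Quot.mk _ k) = Quot.mk (F.Rel σ σ') (Sum.elim id id k)) (c : Quot (F.Rel σ σ')) :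
    ∃ m : ℕ, pushW (Quot.mk (F.Rel σ σ')) (F.wt σ σ') c = 2 - 2 * m - cnt b c - arcs b c := by
  classical
  let W := F.smooth σ
  let W' := F.smooth σ'
  let π : Quot W.Rel → Quot (F.Rel σ σ') := Quot.lift (fun x => Quot.mk _ x) (by
    rintro _ _ (x | j)
    · exact (F.mk_e σ σ' _).symm
    · exact (F.mk_l σ σ' j).symm)
  have hs : IsSurf (Pre.one W).bd (fun _ : Quot W.Rel => 0) := by
    intro c
    obtain ⟨g, hg⟩ := Pre.one_surf W c
    exact ⟨g, (pushW_zero _ _).symm.trans hg⟩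
  obtain ⟨G, hG⟩ := hs.push π c
  replace hG := (pushW_zero π c).symm.trans hG
  let p : BdCirc W W → Quot W.Rel := (Pre.one W).bd
  have hp : ∀ k, p (Quot.mk _ k) = Quot.mk W.Rel (Sum.elim id id k) := fun k => rfl
  obtain ⟨m, hm⟩ := reglue_class (flip_bdE W W) (flip_bdL W W) (flip_bdL W W')
    (by
      rintro ((j | z) | (j | z))
      · rfl
      · rfl
      · refine congrArg (fun j => Sum.inr (Sum.inl j)) ?_
        rcases j with ⟨n, i⟩ | ⟨m, b⟩
        · exact congrArg (fun i => Sum.inl (n, i)) (pairing_comm _ _ _)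
        · rfl
      · rfl) p π b (by
      intro k
      refine (hb k).trans ?_
      rfl)
    (by
      intro φ hφ v w hvw
      have h1 : ∀ x y, F.Rel σ σ' x y → φ (Quot.mk _ x) = φ (Quot.mk _ y) := by
        rintro _ _ (x | j | j)
        · exact congrArg φ (W.mk_e _).symm
        · exact congrArg φ (W.mk_l j).symm
        · exact (hφ (.inr (.inl j))).symm
      have h2 : ∀ v, φ v = Quot.lift (fun x => φ (Quot.mk _ x)) h1 (π v) := by
        intro v; induction v using Quot.ind; rfl
      rw [h2 v, h2 w, hvw]) c
  let ν : {n // σ n ≠ σ' n} → Quot (F.Rel σ σ') := fun n => Quot.mk _ (.inl (.inl (n.1, 0)))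
  have c1 : cnt (fun k => b (Quot.mk _ k)) c
      = cnt (fun k : {k // bdL W W k = bdL W W' k} => b (Quot.mk _ k.1)) c + 4 * cnt ν c := by
    refine (cnt_congr (F.diffEqv σ σ') (fun x => b (Quot.mk _ (F.diffEqv σ σ' x)))
      (fun k => b (Quot.mk _ k)) c c (fun x => Iff.rfl)).symm.trans ((cnt_sum _ _).trans ?_)
    refine congrArg₂ (· + ·) rfl ?_
    have e1 : (fun x => b (Quot.mk _ (F.diffEqv σ σ' (.inr x)))) = fun x => ν x.1 := by
      funext ⟨n, i⟩
      exact (hb _).trans (F.mk_vertex n.2 i)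
    have e2 : Nat.card ({n // ν n = c} × Fin 4) = 4 * cnt ν c := by
      rw [Nat.card_prod, Nat.card_eq_fintype_card (α := Fin 4), Fintype.card_fin, mul_comm]; rfl
    rw [e1]
    refine Eq.trans (Nat.card_congr ?_) e2
    exact
      { toFun := fun x => (⟨x.1.1, x.2⟩, x.1.2)
        invFun := fun x => ⟨(x.1.1, x.2), x.1.2⟩
        left_inv := fun _ => rfl
        right_inv := fun _ => rfl }
  have c2 : pushW (Quot.mk (F.Rel σ σ')) (F.wt σ σ') c = -cnt ν c := by
    have : Fintype F.N := Fintype.ofFinite _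
    have : Fintype F.M := Fintype.ofFinite _
    have : Fintype Z.pt := Fintype.ofFinite _
    have e1 : pushW (fun n : F.N => Quot.mk (F.Rel σ σ') (.inl (.inl (n, 0))))
        (fun n => if σ n ≠ σ' n then -1 else 0) c = -cnt ν c := by
      rw [pushW_eq, cnt, Nat.card_congr (Equiv.subtypeSubtypeEquivSubtypeInter (fun n => σ n ≠ σ' n)
        (fun n => Quot.mk (F.Rel σ σ') (.inl (.inl (n, 0))) = c)), Nat.card_eq_fintype_card,
        Fintype.card_subtype, ← Finset.sum_boole, ← Finset.sum_neg_distrib]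
      refine Finset.sum_congr rfl fun n _ => ?_
      by_cases h : Quot.mk (F.Rel σ σ') (.inl (.inl (n, 0))) = c <;> by_cases h' : σ n = σ' n <;>
        simp [h, h']
    rw [← e1, pushW_eq, pushW_eq, Fintype.sum_sum_type, Fintype.sum_sum_type, Fintype.sum_prod_type]
    simp only [wt, ite_self, Finset.sum_const_zero, add_zero]
    refine Finset.sum_congr rfl fun n _ => ?_
    rw [Finset.sum_eq_single 0]
    · simp
    · intro i _ hi; simp [hi]
    · simp
  have c3 : cnt (fun k => b (Quot.mk _ k)) c = cnt (fun k => π (p (Quot.mk _ k))) c := by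
    congr 1; funext k; exact hb k
  have c4 : arcs (fun x => π (p x)) c = arcs b c := by
    unfold arcs
    congr 1; funext z; exact (hb (.inl (.inr z.1))).symm
  change (0 : ℤ) = 2 * cnt π c - 2 * G - cnt (fun x => π (p x)) c - arcs (fun x => π (p x)) c at hG
  rw [c4] at hG
  have hm' : 8 * cnt π c + 8 * m + 4 * cnt b c
      + cnt (fun k : {k // bdL W W k = bdL W W' k} => b (Quot.mk _ k.1)) c
    = 8 + 4 * cnt (fun x => π (p x)) c + cnt (fun k => π (p (Quot.mk _ k))) c := hm.trans (by rw [← c3]; rfl)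
  rw [c3] at c1
  rw [c1] at hm'
  refine ⟨G + m, ?_⟩
  rw [c2]
  push_cast
  omega

theorem saddle_surf (σ σ' : F.N → Bool) : (F.saddle σ σ').Surf := fun c =>
  F.saddle_count σ σ' (F.saddle σ σ').bd (fun _ => rfl) c

end Frame

/-! ### Compatibility of local modifications with gluing -/

namespace Pre
variable {Z : Signed} {W₀ W₁ W₂ : OneMfd Z}

theorem Eqv.ofEquiv {P P' : Pre W₀ W₁} (φ : P.X ≃ P'.X)
    (h1 : ∀ x y, P.r x y → Quot.mk P'.r (φ x) = Quot.mk P'.r (φ y))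
    (h2 : ∀ x y, P'.r x y → Quot.mk P.r (φ.symm x) = Quot.mk P.r (φ.symm y))
    (hf : ∀ k, φ (P.f k) = P'.f k) (hw : ∀ x, P.w x = P'.w (φ x)) : Eqv P P' φ φ.symm where
  hg := h1
  hh := h2
  hgh x := by rw [Equiv.symm_apply_apply]
  hhg x := by rw [Equiv.apply_symm_apply]
  hf k := by rw [hf]
  hw c := by rw [funext hw]; exact pushW_equiv φ (Quot.mk P'.r) P'.w c

theorem Eqv.tube {P P' : Pre W₀ W₁} {g : P.X → P'.X} {h : P'.X → P.X} (H : Eqv P P' g h) (x y : P.X) :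
    Eqv (P.tube x y) (P'.tube (g x) (g y)) g h where
  hg := by
    rintro a b (r | ⟨h1, h2⟩)
    · exact P'.tube_mk _ _ (H.hg _ _ r)
    · exact (congrArg (fun a => Quot.mk (P'.tube (g x) (g y)).r (g a)) h1).trans
        ((P'.tube_xy _ _).trans (congrArg (fun a => Quot.mk (P'.tube (g x) (g y)).r (g a)) h2).symm)
  hh := by
    rintro a b (r | ⟨h1, h2⟩)
    · exact P.tube_mk _ _ (H.hh _ _ r)
    · exact (congrArg (fun a => Quot.mk (P.tube x y).r (h a)) h1).trans
        ((P.tube_mk x y (H.hgh x)).trans ((P.tube_xy x y).trans ((P.tube_mk x y (H.hgh y)).symm.trans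
        (congrArg (fun a => Quot.mk (P.tube x y).r (h a)) h2).symm)))
  hgh a := P.tube_mk x y (H.hgh a)
  hhg a := P'.tube_mk _ _ (H.hhg a)
  hf k := P'.tube_mk _ _ (H.hf k)
  hw c := by
    classical
    have e1 := pushW_pushW (fun a => Quot.mk P'.r (g a)) (P'.tubeQuot (g x) (g y)) P.w c
    have e2 := pushW_pushW (fun a => Quot.mk P'.r a) (P'.tubeQuot (g x) (g y)) P'.w c
    rw [funext H.hw] at e1
    have key : ∀ {A C : Type} [Finite A] (q : A → C) (x : A) (c : C),
        pushW q (fun a => if a = x then -2 else 0) c = if q x = c then -2 else 0 := by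
      intro A C _ q x c
      have : Fintype A := Fintype.ofFinite _
      rw [pushW_eq, Finset.sum_eq_single x]
      · simp
      · intro b _ hb; simp [hb]
      · simp
    refine (pushW_add (X := P.X) _ _ _ _).trans (Eq.trans ?_ (pushW_add (X := P'.X) _ _ _ _).symm)
    refine congrArg₂ (· + ·) (e1.symm.trans e2) ?_
    exact (key (fun a => Quot.mk (P'.tube (g x) (g y)).r (g a)) x c).trans
      (key (fun a => Quot.mk (P'.tube (g x) (g y)).r a) (g x) c).symm

theorem tube_congr {P : Pre W₀ W₁} {x y x' y' : P.X} (hx : Quot.mk P.r x = Quot.mk P.r x')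
    (hy : Quot.mk P.r y = Quot.mk P.r y') : Eqv (P.tube x y) (P.tube x' y') id id := by
  refine ⟨?_, ?_, fun _ => rfl, fun _ => rfl, fun _ => rfl, ?_⟩
  · rintro a b (r | ⟨h1, h2⟩)
    · exact Quot.sound (Or.inl r)
    · exact (congrArg _ h1).trans ((P.tube_mk x' y' hx).trans ((P.tube_xy x' y').trans
        ((P.tube_mk x' y' hy).symm.trans (congrArg _ h2).symm)))
  · rintro a b (r | ⟨h1, h2⟩)
    · exact Quot.sound (Or.inl r)
    · exact (congrArg _ h1).trans ((P.tube_mk x y hx).symm.trans ((P.tube_xy x y).trans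
        ((P.tube_mk x y hy).trans (congrArg _ h2).symm)))
  · intro c
    classical
    have key : ∀ {A C : Type} [Finite A] (q : A → C) (x : A) (c : C),
        pushW q (fun a => if a = x then -2 else 0) c = if q x = c then -2 else 0 := by
      intro A C _ q x c
      have : Fintype A := Fintype.ofFinite _
      rw [pushW_eq, Finset.sum_eq_single x]
      · simp
      · intro b _ hb; simp [hb]
      · simp
    refine (pushW_add (X := P.X) _ _ _ _).trans (Eq.trans ?_ (pushW_add (X := P.X) _ _ _ _).symm)
    refine congrArg₂ (· + ·) rfl ?_
    refine (key (Quot.mk (P.tube x' y').r) x c).trans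
      (Eq.trans ?_ (key (Quot.mk (P.tube x' y').r) x' c).symm)
    rw [P.tube_mk x' y' hx]

theorem tube_tube (P : Pre W₀ W₁) (x y z t : P.X) :
    Eqv ((P.tube x y).tube z t) ((P.tube z t).tube x y) id id := by
  refine Eqv.ofEquiv (P := (P.tube x y).tube z t) (P' := (P.tube z t).tube x y) (Equiv.refl P.X)
    ?_ ?_ (fun _ => rfl) (fun a => add_right_comm (P.w a) _ _)
  · rintro a b ((r | r) | r)
    exacts [Quot.sound (Or.inl (Or.inl r)), Quot.sound (Or.inr r), Quot.sound (Or.inl (Or.inr r))]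
  · rintro a b ((r | r) | r)
    exacts [Quot.sound (Or.inl (Or.inl r)), Quot.sound (Or.inr r), Quot.sound (Or.inl (Or.inr r))]

theorem tube_comp (P : Pre W₀ W₁) (x y : P.X) (Q : Pre W₁ W₂) :
    Eqv ((P.tube x y).comp Q) ((P.comp Q).tube (.inl x) (.inl y)) id id := by
  refine Eqv.ofEquiv (P := (P.tube x y).comp Q) (P' := (P.comp Q).tube (.inl x) (.inl y))
    (Equiv.refl (P.X ⊕ Q.X)) ?_ ?_ (fun k => by rcases k with k | k <;> rfl) ?_
  · rintro _ _ ((r | ⟨h1, h2⟩) | r | k)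
    · exact Quot.sound (Or.inl (.left r))
    · exact Quot.sound (Or.inr ⟨congrArg Sum.inl h1, congrArg Sum.inl h2⟩)
    · exact Quot.sound (Or.inl (.right r))
    · exact Quot.sound (Or.inl (.mid k))
  · rintro a b ((r | r | k) | ⟨h1, h2⟩)
    · exact Quot.sound (.left (Or.inl r))
    · exact Quot.sound (.right r)
    · exact Quot.sound (.mid (P := P.tube x y) k)
    · exact (congrArg (Quot.mk ((P.tube x y).comp Q).r) h1).trans ((glue_left (P.tube x y) Q
        (P.tube_xy x y)).trans (congrArg (Quot.mk ((P.tube x y).comp Q).r) h2).symm)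
  · classical
    rintro (a | a)
    · exact congrArg (P.w a + ·) (if_congr Sum.inl_injective.eq_iff.symm rfl rfl)
    · exact (add_zero (Q.w a)).symm.trans (congrArg (Q.w a + ·) (if_neg Sum.inr_ne_inl).symm)

theorem comp_tube (P : Pre W₀ W₁) (Q : Pre W₁ W₂) (x y : Q.X) :
    Eqv (P.comp (Q.tube x y)) ((P.comp Q).tube (.inr x) (.inr y)) id id := by
  refine Eqv.ofEquiv (P := P.comp (Q.tube x y)) (P' := (P.comp Q).tube (.inr x) (.inr y))
    (Equiv.refl (P.X ⊕ Q.X)) ?_ ?_ (fun k => by rcases k with k | k <;> rfl) ?_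
  · rintro _ _ (r | (r | ⟨h1, h2⟩) | k)
    · exact Quot.sound (Or.inl (.left r))
    · exact Quot.sound (Or.inl (.right r))
    · exact Quot.sound (Or.inr ⟨congrArg Sum.inr h1, congrArg Sum.inr h2⟩)
    · exact Quot.sound (Or.inl (.mid k))
  · rintro a b ((r | r | k) | ⟨h1, h2⟩)
    · exact Quot.sound (.left r)
    · exact Quot.sound (.right (Or.inl r))
    · exact Quot.sound (.mid (Q := Q.tube x y) k)
    · exact (congrArg (Quot.mk (P.comp (Q.tube x y)).r) h1).trans ((glue_right P (Q.tube x y)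
        (Q.tube_xy x y)).trans (congrArg (Quot.mk (P.comp (Q.tube x y)).r) h2).symm)
  · classical
    rintro (a | a)
    · exact (add_zero (P.w a)).symm.trans (congrArg (P.w a + ·) (if_neg Sum.inl_ne_inr).symm)
    · exact congrArg (Q.w a + ·) (if_congr Sum.inr_injective.eq_iff.symm rfl rfl)

theorem add_comp (P : Pre W₀ W₁) (n : ℤ) (Q : Pre W₁ W₂) :
    ∃ g h, Eqv ((P.add n).comp Q) ((P.comp Q).add n) g h := by
  refine ⟨_, _, Eqv.ofEquiv ((Equiv.sumAssoc P.X Unit Q.X).trans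
    (((Equiv.refl P.X).sumCongr (Equiv.sumComm Unit Q.X)).trans (Equiv.sumAssoc P.X Q.X Unit).symm))
    ?_ ?_ ?_ ?_⟩
  · rintro _ _ (⟨a, b, h1, h2, r⟩ | r | k)
    · refine (congrArg (fun a => Quot.mk ((P.comp Q).add n).r _) h1).trans ?_
      rw [h1, h2]
      exact (P.comp Q).add_mk n (Quot.sound (.left r))
    · exact (P.comp Q).add_mk n (Quot.sound (.right r))
    · exact (P.comp Q).add_mk n (Quot.sound (.mid k))
  · rintro _ _ ⟨a, b, rfl, rfl, (r | r | k)⟩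
    · exact glue_left (P.add n) Q (P.add_mk n (Quot.sound r))
    · exact Quot.sound (.right r)
    · exact Quot.sound (.mid (P := P.add n) k)
  · rintro (k | k) <;> rfl
  · rintro ((a | a) | a) <;> rfl

theorem comp_add (P : Pre W₀ W₁) (n : ℤ) (Q : Pre W₁ W₂) :
    ∃ g h, Eqv (P.comp (Q.add n)) ((P.comp Q).add n) g h := by
  refine ⟨_, _, Eqv.ofEquiv (Equiv.sumAssoc P.X Q.X Unit).symm ?_ ?_ ?_ ?_⟩
  · rintro _ _ (r | ⟨a, b, h1, h2, r⟩ | k)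
    · exact (P.comp Q).add_mk n (Quot.sound (.left r))
    · rw [h1, h2]
      exact (P.comp Q).add_mk n (Quot.sound (.right r))
    · exact (P.comp Q).add_mk n (Quot.sound (.mid k))
  · rintro _ _ ⟨a, b, rfl, rfl, (r | r | k)⟩
    · exact Quot.sound (.left r)
    · exact glue_right P (Q.add n) (Q.add_mk n (Quot.sound r))
    · exact Quot.sound (.mid (Q := Q.add n) k)
  · rintro (k | k) <;> rfl
  · rintro (a | (a | a)) <;> rfl

end Pre

namespace Sew
variable {Z₁ Z₂ Z' : Signed} (s : Sew Z₁ Z₂ Z') {W₁ W₁' : OneMfd Z₁} {W₂ W₂' : OneMfd Z₂}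

theorem tube_pre (P : Pre W₁ W₁') (x y : P.X) (Q : Pre W₂ W₂') :
    Pre.Eqv (s.pre (P.tube x y) Q) ((s.pre P Q).tube (.inl x) (.inl y)) id id := by
  refine Pre.Eqv.ofEquiv (P := s.pre (P.tube x y) Q) (P' := (s.pre P Q).tube (.inl x) (.inl y))
    (Equiv.refl (P.X ⊕ Q.X)) ?_ ?_ (fun _ => rfl) ?_
  · rintro _ _ ((r | ⟨h1, h2⟩) | r | k)
    · exact Quot.sound (Or.inl (.left r))
    · exact Quot.sound (Or.inr ⟨congrArg Sum.inl h1, congrArg Sum.inl h2⟩)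
    · exact Quot.sound (Or.inl (.right r))
    · exact Quot.sound (Or.inl (.mid k))
  · rintro a b ((r | r | k) | ⟨h1, h2⟩)
    · exact Quot.sound (.left (Or.inl r))
    · exact Quot.sound (.right r)
    · exact s.rel_mid (P.tube x y) Q k
    · exact (congrArg (Quot.mk (s.pre (P.tube x y) Q).r) h1).trans ((s.rel_left (P.tube x y) Q
        (P.tube_xy x y)).trans (congrArg (Quot.mk (s.pre (P.tube x y) Q).r) h2).symm)
  · classical
    rintro (a | a)
    · exact congrArg (P.w a + ·) (if_congr Sum.inl_injective.eq_iff.symm rfl rfl)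
    · exact (add_zero (Q.w a)).symm.trans (congrArg (Q.w a + ·) (if_neg Sum.inr_ne_inl).symm)

theorem pre_tube (P : Pre W₁ W₁') (Q : Pre W₂ W₂') (x y : Q.X) :
    Pre.Eqv (s.pre P (Q.tube x y)) ((s.pre P Q).tube (.inr x) (.inr y)) id id := by
  refine Pre.Eqv.ofEquiv (P := s.pre P (Q.tube x y)) (P' := (s.pre P Q).tube (.inr x) (.inr y))
    (Equiv.refl (P.X ⊕ Q.X)) ?_ ?_ (fun _ => rfl) ?_
  · rintro _ _ (r | (r | ⟨h1, h2⟩) | k)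
    · exact Quot.sound (Or.inl (.left r))
    · exact Quot.sound (Or.inl (.right r))
    · exact Quot.sound (Or.inr ⟨congrArg Sum.inr h1, congrArg Sum.inr h2⟩)
    · exact Quot.sound (Or.inl (.mid k))
  · rintro a b ((r | r | k) | ⟨h1, h2⟩)
    · exact Quot.sound (.left r)
    · exact Quot.sound (.right (Or.inl r))
    · exact s.rel_mid P (Q.tube x y) k
    · exact (congrArg (Quot.mk (s.pre P (Q.tube x y)).r) h1).trans ((s.rel_right P (Q.tube x y)
        (Q.tube_xy x y)).trans (congrArg (Quot.mk (s.pre P (Q.tube x y)).r) h2).symm)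
  · classical
    rintro (a | a)
    · exact (add_zero (P.w a)).symm.trans (congrArg (P.w a + ·) (if_neg Sum.inl_ne_inr).symm)
    · exact congrArg (Q.w a + ·) (if_congr Sum.inr_injective.eq_iff.symm rfl rfl)

theorem add_pre (P : Pre W₁ W₁') (n : ℤ) (Q : Pre W₂ W₂') :
    ∃ g h, Pre.Eqv (s.pre (P.add n) Q) ((s.pre P Q).add n) g h := by
  have hp : ∀ z, (Equiv.sumAssoc P.X Unit Q.X).trans
    (((Equiv.refl P.X).sumCongr (Equiv.sumComm Unit Q.X)).trans (Equiv.sumAssoc P.X Q.X Unit).symm)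
    (ptZ (P.add n) Q z) = .inl (ptZ P Q z) := by rintro (z | z) <;> rfl
  refine ⟨_, _, Pre.Eqv.ofEquiv ((Equiv.sumAssoc P.X Unit Q.X).trans
    (((Equiv.refl P.X).sumCongr (Equiv.sumComm Unit Q.X)).trans (Equiv.sumAssoc P.X Q.X Unit).symm))
    ?_ ?_ ?_ ?_⟩
  · rintro _ _ (⟨a, b, h1, h2, r⟩ | r | k)
    · rw [h1, h2]
      exact (s.pre P Q).add_mk n (Quot.sound (.left r))
    · exact (s.pre P Q).add_mk n (Quot.sound (.right r))
    · exact (congrArg (Quot.mk _) (hp _)).trans (((s.pre P Q).add_mk n (s.rel_mid P Q k)).trans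
        (congrArg (Quot.mk _) (hp _)).symm)
  · rintro _ _ ⟨a, b, rfl, rfl, (r | r | k)⟩
    · exact s.rel_left (P.add n) Q (P.add_mk n (Quot.sound r))
    · exact Quot.sound (.right r)
    · have hq := fun z => ((Equiv.symm_apply_eq _).2 (hp z).symm)
      exact (congrArg (Quot.mk _) (hq _)).trans ((s.rel_mid (P.add n) Q k).trans
        (congrArg (Quot.mk _) (hq _)).symm)
  · intro k
    show _ = Sum.inl (Sum.map P.f Q.f (s.spread _ _ _ _ k))
    show (Equiv.sumAssoc P.X Unit Q.X).trans _ (Sum.map (P.add n).f Q.f (s.spread _ _ _ _ k)) = _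
    generalize s.spread _ _ _ _ k = k
    rcases k with k | k <;> rfl
  · rintro ((a | a) | a) <;> rfl

theorem pre_add (P : Pre W₁ W₁') (n : ℤ) (Q : Pre W₂ W₂') :
    ∃ g h, Pre.Eqv (s.pre P (Q.add n)) ((s.pre P Q).add n) g h := by
  have hp : ∀ z, (Equiv.sumAssoc P.X Q.X Unit).symm (ptZ P (Q.add n) z) = .inl (ptZ P Q z) := by
    rintro (z | z) <;> rfl
  refine ⟨_, _, Pre.Eqv.ofEquiv (Equiv.sumAssoc P.X Q.X Unit).symm ?_ ?_ ?_ ?_⟩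
  · rintro _ _ (r | ⟨a, b, h1, h2, r⟩ | k)
    · exact (s.pre P Q).add_mk n (Quot.sound (.left r))
    · rw [h1, h2]
      exact (s.pre P Q).add_mk n (Quot.sound (.right r))
    · exact (congrArg (Quot.mk _) (hp _)).trans (((s.pre P Q).add_mk n (s.rel_mid P Q k)).trans
        (congrArg (Quot.mk _) (hp _)).symm)
  · rintro _ _ ⟨a, b, rfl, rfl, (r | r | k)⟩
    · exact Quot.sound (.left r)
    · exact s.rel_right P (Q.add n) (Q.add_mk n (Quot.sound r))
    · have hq := fun z => ((Equiv.symm_apply_eq _).2 (hp z).symm)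
      exact (congrArg (Quot.mk _) (hq _)).trans ((s.rel_mid P (Q.add n) k).trans
        (congrArg (Quot.mk _) (hq _)).symm)
  · intro k
    show _ = Sum.inl (Sum.map P.f Q.f (s.spread _ _ _ _ k))
    show (Equiv.sumAssoc P.X Q.X Unit).symm (Sum.map P.f (Q.add n).f (s.spread _ _ _ _ k)) = _
    generalize s.spread _ _ _ _ k = k
    rcases k with k | k <;> rfl
  · rintro (a | (a | a)) <;> rfl

end Sew

namespace Frame
variable {Z : Signed} (F : Frame Z)

theorem saddle_comp {σ σ' σ'' : F.N → Bool} (h : ∀ n, σ n = σ' n ∨ σ' n = σ'' n) :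
    Pre.Eqv ((F.saddle σ σ').comp (F.saddle σ' σ'')) (F.saddle σ σ'') (Sum.elim id id) Sum.inl := by
  have hl : ∀ j, Quot.mk (F.Rel σ σ'') (.inl j) = Quot.mk _ (.inl (F.join σ' j)) := by
    rintro (⟨n, i⟩ | m)
    · rcases h n with h | h
      · have := F.mk_l σ σ'' (.inl (n, i))
        simp only [join, h] at this ⊢
        exact this.symm
      · have := F.mk_l' σ σ'' (.inl (n, i))
        simp only [join, ← h] at this ⊢
        exact this.symm
    · exact (F.mk_l σ σ'' (.inr m)).symm
  have gm := Pre.glue_mid (F.saddle σ σ') (F.saddle σ' σ'')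
  constructor
  · rintro _ _ ((x | j | j) | (x | j | j) | k)
    · exact Quot.sound (.e _)
    · exact Quot.sound (.l _)
    · exact hl _
    · exact Quot.sound (.e _)
    · exact hl _
    · exact Quot.sound (.l' _)
    · rfl
  · rintro _ _ (x | j | j)
    · exact Quot.sound (.left (.e _))
    · exact Quot.sound (.left (.l _))
    · exact (gm (.inl j)).trans ((Pre.glue_right (F.saddle σ σ') (F.saddle σ' σ'')
        (Quot.sound (.l' j))).trans (gm (.inl (F.join σ'' j))).symm)
  · rintro (x | x)
    · rfl
    · exact gm x
  · intro x; rfl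
  · rintro (k | k) <;> rfl
  · intro c
    refine (pushW_sum _ (Sum.elim (F.wt σ σ') (F.wt σ' σ'')) c).trans ?_
    refine (pushW_add (Quot.mk (F.Rel σ σ'')) (F.wt σ σ') (F.wt σ' σ'') c).symm.trans ?_
    refine congrArg (fun w => pushW (Quot.mk (F.Rel σ σ'')) w c) ?_
    funext x
    rcases x with (⟨n, i⟩ | m) | z
    · show F.wt σ σ' (.inl (.inl (n, i))) + F.wt σ' σ'' (.inl (.inl (n, i)))
        = F.wt σ σ'' (.inl (.inl (n, i)))
      simp only [wt]
      rcases h n with h | h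
      · simp [h]
      · simp [h]
    · rfl
    · rfl

end Frame

/-! ### The `k`-linear bordism category modulo the local relations -/

section
variable (k : Type*) [CommRing k]

/-- Bilinear extension of a binary operation to formal linear combinations. -/
noncomputable def extend₂ {A B C : Type*} (op : A → B → C) : (A →₀ k) →ₗ[k] (B →₀ k) →ₗ[k] (C →₀ k) :=
  Finsupp.linearCombination k fun a => Finsupp.lmapDomain k k (op a)

theorem extend₂_single {A B C : Type*} (op : A → B → C) (a : A) (b : B) :
    extend₂ k op (.single a 1) (.single b 1) = .single (op a b) 1 := by
  simp [extend₂, Finsupp.mapDomain_single]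

/-- Bilinear extension of a binary operation to quotients of the modules of formal combinations. -/
noncomputable def extendQ {A B C : Type*} (op : A → B → C) (SA : Set (A →₀ k)) (SB : Set (B →₀ k))
    (SC : Set (C →₀ k))
    (hA : ∀ f ∈ SA, ∀ b, extend₂ k op f (.single b 1) ∈ Submodule.span k SC)
    (hB : ∀ g ∈ SB, ∀ a, extend₂ k op (.single a 1) g ∈ Submodule.span k SC) :
    ((A →₀ k) ⧸ Submodule.span k SA) →ₗ[k] ((B →₀ k) ⧸ Submodule.span k SB) →ₗ[k]
      ((C →₀ k) ⧸ Submodule.span k SC) :=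
  have hA' : ∀ f ∈ Submodule.span k SA, ∀ g, extend₂ k op f g ∈ Submodule.span k SC := by
    intro f hf g
    induction g using Finsupp.induction_linear with
    | zero => rw [map_zero]; exact zero_mem _
    | add g g' h h' => rw [map_add]; exact add_mem h h'
    | single b r =>
      rw [show Finsupp.single b r = r • Finsupp.single b 1 by simp, map_smul]
      refine Submodule.smul_mem _ _ ?_
      induction hf using Submodule.span_induction with
      | mem f hf => exact hA f hf b
      | zero => rw [map_zero]; exact zero_mem _
      | add f f' _ _ h h' => rw [map_add]; exact add_mem h h'
      | smul r f _ h => rw [map_smul]; exact Submodule.smul_mem _ _ h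
  have hB' : ∀ f, ∀ g ∈ Submodule.span k SB, extend₂ k op f g ∈ Submodule.span k SC := by
    intro f g hg
    induction f using Finsupp.induction_linear with
    | zero => rw [map_zero]; exact zero_mem _
    | add g g' h h' => rw [map_add]; exact add_mem h h'
    | single a r =>
      rw [show Finsupp.single a r = r • Finsupp.single a 1 by simp, map_smul]
      refine Submodule.smul_mem _ _ ?_
      induction hg using Submodule.span_induction with
      | mem f hf => exact hB f hf a
      | zero => rw [map_zero]; exact zero_mem _
      | add f f' _ _ h h' => rw [map_add]; exact add_mem h h'
      | smul r f _ h => rw [map_smul]; exact Submodule.smul_mem _ _ h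
  (Submodule.span k SA).liftQ
    { toFun := fun f => (Submodule.span k SB).liftQ ((Submodule.mkQ _).comp (extend₂ k op f))
        fun g hg => (Submodule.Quotient.mk_eq_zero _).2 (hB' f g hg)
      map_add' := fun f f' => LinearMap.ext fun g => by
        obtain ⟨g, rfl⟩ := Submodule.Quotient.mk_surjective _ g
        show Submodule.Quotient.mk (extend₂ k op (f + f') g)
          = (Submodule.Quotient.mk (extend₂ k op f g) + Submodule.Quotient.mk (extend₂ k op f' g) :
            (C →₀ k) ⧸ Submodule.span k SC)
        rw [map_add]; rfl
      map_smul' := fun r f => LinearMap.ext fun g => by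
        obtain ⟨g, rfl⟩ := Submodule.Quotient.mk_surjective _ g
        show Submodule.Quotient.mk (extend₂ k op (r • f) g)
          = (r • Submodule.Quotient.mk (extend₂ k op f g) : (C →₀ k) ⧸ Submodule.span k SC)
        rw [map_smul]; rfl }
    fun f hf => LinearMap.ext fun g => by
      obtain ⟨g, rfl⟩ := Submodule.Quotient.mk_surjective _ g
      exact (Submodule.Quotient.mk_eq_zero _).2 (hA' f hf g)

theorem extendQ_mk {A B C : Type*} (op : A → B → C) (SA : Set (A →₀ k)) (SB : Set (B →₀ k))
    (SC : Set (C →₀ k)) (hA hB) (f : A →₀ k) (g : B →₀ k) :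
    extendQ k op SA SB SC hA hB (Submodule.Quotient.mk f) (Submodule.Quotient.mk g)
      = Submodule.Quotient.mk (extend₂ k op f g) := rfl

variable {Z : Signed}

/-- The local relations: a surface with a sphere component is zero, a torus component can be
replaced by the factor `2`, and the four-tube relation. -/
inductive LocalRel {W W' : OneMfd Z} : (BHom W W' →₀ k) → Prop
  | sphere (P : Pre W W') (hP : P.Surf) :
      LocalRel (.single ((P.add 2).cls (Pre.add_surf hP 0 (by norm_num))) 1)
  | torus (P : Pre W W') (hP : P.Surf) :
      LocalRel (.single ((P.add 0).cls (Pre.add_surf hP 1 (by norm_num))) 1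
        - (2 : k) • .single (P.cls hP) 1)
  | fourTu (P : Pre W W') (hP : P.Surf) (x₁ x₂ x₃ x₄ : P.X) :
      LocalRel (.single ((P.tube x₁ x₂).cls (Pre.tube_surf hP _ _)) 1
        + .single ((P.tube x₃ x₄).cls (Pre.tube_surf hP _ _)) 1
        - .single ((P.tube x₁ x₃).cls (Pre.tube_surf hP _ _)) 1
        - .single ((P.tube x₂ x₄).cls (Pre.tube_surf hP _ _)) 1)

/-- Formal linear combinations of bordisms modulo the local relations. -/
abbrev LHom (W W' : OneMfd Z) : Type _ :=
  (BHom W W' →₀ k) ⧸ Submodule.span k {f : BHom W W' →₀ k | LocalRel k f}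

variable {k}

theorem Pre.Surf.congr {W W' : OneMfd Z} {P P' : Pre W W'} {g h} (H : Pre.Eqv P P' g h)
    (hP : P.Surf) : P'.Surf := by
  have H' := hP
  let φ : Quot P.r ≃ Quot P'.r := quotEquiv g h H.hg H.hh H.hgh H.hhg
  intro c
  obtain ⟨c, rfl⟩ := φ.surjective c
  obtain ⟨m, hm⟩ := hP c
  have hbd : ∀ x, φ (P.bd x) = P'.bd x := by
    intro x; induction x using Quot.ind; exact H.hf _
  refine ⟨m, ?_⟩
  rw [← H.hw, arcs_equiv _ _ φ hbd, cnt_equiv _ _ φ hbd]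
  exact (pushW_inj (Quot.mk P.r) φ φ.injective P.w c).trans hm

/-- A local modification is compatible with an operation on glued surfaces. -/
theorem localRel_map {Z Z' : Signed} {W W' : OneMfd Z} {V V' : OneMfd Z'}
    (Op : Pre W W' → Pre V V') (hOp : ∀ P, P.Surf → (Op P).Surf) (op : BHom W W' → BHom V V')
    (hop : ∀ P hP, op (P.cls hP) = (Op P).cls (hOp P hP))
    (hadd : ∀ P n, ∃ g h, Pre.Eqv (Op (P.add n)) ((Op P).add n) g h)
    (htube : ∀ P : Pre W W', ∃ j : P.X → (Op P).X, ∀ x y,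
      ∃ g h, Pre.Eqv (Op (P.tube x y)) ((Op P).tube (j x) (j y)) g h)
    (f : BHom W W' →₀ k) (hf : LocalRel k f) : LocalRel k (Finsupp.mapDomain op f) := by
  rcases hf with ⟨P, hP⟩ | ⟨P, hP⟩ | ⟨P, hP, x₁, x₂, x₃, x₄⟩
  · obtain ⟨g, h, H⟩ := hadd P 2
    rw [Finsupp.mapDomain_single, hop, H.cls _ (Pre.add_surf (hOp P hP) 0 (by norm_num))]
    exact .sphere _ (hOp P hP)
  · obtain ⟨g, h, H⟩ := hadd P 0
    have e : Finsupp.mapDomain op (Finsupp.single ((P.add 0).cls (Pre.add_surf hP 1 (by norm_num))) (1 : k)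
        - (2 : k) • Finsupp.single (P.cls hP) 1)
      = Finsupp.single (((Op P).add 0).cls (Pre.add_surf (hOp P hP) 1 (by norm_num))) (1 : k)
        - (2 : k) • Finsupp.single ((Op P).cls (hOp P hP)) 1 := by
      refine (map_sub (Finsupp.lmapDomain k k op) _ _).trans ?_
      rw [map_smul]
      simp only [Finsupp.lmapDomain_apply, Finsupp.mapDomain_single, hop]
      rw [H.cls _ (Pre.add_surf (hOp P hP) 1 (by norm_num))]
    rw [e]
    exact .torus _ _
  · obtain ⟨j, hj⟩ := htube P
    have ht : ∀ x y, op ((P.tube x y).cls (Pre.tube_surf hP x y))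
        = ((Op P).tube (j x) (j y)).cls (Pre.tube_surf (hOp P hP) _ _) := by
      intro x y
      obtain ⟨g, h, H⟩ := hj x y
      rw [hop, H.cls]
    have e : Finsupp.mapDomain op
        (Finsupp.single ((P.tube x₁ x₂).cls (Pre.tube_surf hP _ _)) (1 : k)
        + Finsupp.single ((P.tube x₃ x₄).cls (Pre.tube_surf hP _ _)) 1
        - Finsupp.single ((P.tube x₁ x₃).cls (Pre.tube_surf hP _ _)) 1
        - Finsupp.single ((P.tube x₂ x₄).cls (Pre.tube_surf hP _ _)) 1)
      = Finsupp.single (((Op P).tube (j x₁) (j x₂)).cls (Pre.tube_surf (hOp P hP) _ _)) 1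
        + Finsupp.single (((Op P).tube (j x₃) (j x₄)).cls (Pre.tube_surf (hOp P hP) _ _)) 1
        - Finsupp.single (((Op P).tube (j x₁) (j x₃)).cls (Pre.tube_surf (hOp P hP) _ _)) 1
        - Finsupp.single (((Op P).tube (j x₂) (j x₄)).cls (Pre.tube_surf (hOp P hP) _ _)) 1 := by
      refine (map_sub (Finsupp.lmapDomain k k op) _ _).trans ?_
      rw [map_sub, map_add]
      simp only [Finsupp.lmapDomain_apply, Finsupp.mapDomain_single, ht]
    rw [e]
    exact .fourTu _ (hOp P hP) _ _ _ _

theorem extend₂_right {A B C : Type*} (op : A → B → C) (a : A) (g : B →₀ k) :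
    extend₂ k op (.single a 1) g = Finsupp.mapDomain (op a) g := by
  simp [extend₂]

theorem extend₂_left {A B C : Type*} (op : A → B → C) (f : A →₀ k) (b : B) :
    extend₂ k op f (.single b 1) = Finsupp.mapDomain (fun a => op a b) f := by
  induction f using Finsupp.induction_linear with
  | zero => simp
  | add f f' h h' => rw [map_add, LinearMap.add_apply, h, h', Finsupp.mapDomain_add]
  | single a r => simp [extend₂, Finsupp.mapDomain_single]

namespace LHom

variable (k) in
/-- The morphism given by a bordism. -/
noncomputable def of {W W' : OneMfd Z} (a : BHom W W') : LHom k W W' :=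
  Submodule.Quotient.mk (.single a 1)

@[elab_as_elim]
theorem induction {W W' : OneMfd Z} {p : LHom k W W' → Prop} (h0 : p 0) (hof : ∀ a, p (of k a))
    (hadd : ∀ a b, p a → p b → p (a + b)) (hsmul : ∀ (r : k) a, p a → p (r • a)) (a : LHom k W W') :
    p a := by
  obtain ⟨f, rfl⟩ := Submodule.Quotient.mk_surjective _ a
  induction f using Finsupp.induction_linear with
  | zero => exact h0
  | add f f' h h' => exact hadd _ _ h h'
  | single a r =>
    have := hsmul r _ (hof a)
    rwa [of, ← Submodule.Quotient.mk_smul, Finsupp.smul_single, smul_eq_mul, mul_one] at this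

/-- Composition, extended bilinearly. -/
noncomputable def comp {W₀ W₁ W₂ : OneMfd Z} :
    LHom k W₀ W₁ →ₗ[k] LHom k W₁ W₂ →ₗ[k] LHom k W₀ W₂ :=
  extendQ k BHom.comp {f | LocalRel k f} {f | LocalRel k f} {f | LocalRel k f}
    (fun f hf b => by
      rw [extend₂_left]
      refine Submodule.subset_span (localRel_map (fun P => P.comp b.rep)
        (fun P hP => Pre.comp_surf hP b.rep_surf) _ (fun P hP => ?_)
        (fun P n => Pre.add_comp P n _) (fun P => ⟨Sum.inl, fun x y => ⟨_, _, Pre.tube_comp P x y _⟩⟩)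
        f hf)
      conv_lhs => rw [← b.rep_cls]
      exact BHom.comp_cls _ _)
    (fun f hf a => by
      rw [extend₂_right]
      refine Submodule.subset_span (localRel_map (fun P => a.rep.comp P)
        (fun P hP => Pre.comp_surf a.rep_surf hP) _ (fun P hP => ?_)
        (fun P n => Pre.comp_add _ n P) (fun P => ⟨Sum.inr, fun x y => ⟨_, _, Pre.comp_tube _ P x y⟩⟩)
        f hf)
      conv_lhs => rw [← a.rep_cls]
      exact BHom.comp_cls _ _)

theorem comp_of {W₀ W₁ W₂ : OneMfd Z} (a : BHom W₀ W₁) (b : BHom W₁ W₂) :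
    comp (of k a) (of k b) = of k (a.comp b) :=
  (extendQ_mk k _ _ _ _ _ _ _ _).trans (congrArg _ (extend₂_single k _ a b))

theorem comp_assoc {W₀ W₁ W₂ W₃ : OneMfd Z} (a : LHom k W₀ W₁) (b : LHom k W₁ W₂)
    (c : LHom k W₂ W₃) : comp (comp a b) c = comp a (comp b c) := by
  induction a using LHom.induction with
  | h0 => simp
  | hadd a a' h h' => simp only [map_add, LinearMap.add_apply, h, h']
  | hsmul r a h => simp only [map_smul, LinearMap.smul_apply, h]
  | hof a =>
  induction b using LHom.induction with
  | h0 => simp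
  | hadd a a' h h' => simp only [map_add, LinearMap.add_apply, h, h']
  | hsmul r a h => simp only [map_smul, LinearMap.smul_apply, h]
  | hof b =>
  induction c using LHom.induction with
  | h0 => simp
  | hadd a a' h h' => simp only [map_add, h, h']
  | hsmul r a h => simp only [map_smul, h]
  | hof c => simp only [comp_of, BHom.assoc]

theorem one_comp {W₀ W₁ : OneMfd Z} (a : LHom k W₀ W₁) : comp (of k (BHom.one W₀)) a = a := by
  induction a using LHom.induction with
  | h0 => simp
  | hadd a a' h h' => simp only [map_add, h, h']
  | hsmul r a h => simp only [map_smul, h]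
  | hof a => rw [comp_of, BHom.one_comp]

theorem comp_one {W₀ W₁ : OneMfd Z} (a : LHom k W₀ W₁) : comp a (of k (BHom.one W₁)) = a := by
  induction a using LHom.induction with
  | h0 => simp
  | hadd a a' h h' => simp only [map_add, LinearMap.add_apply, h, h']
  | hsmul r a h => simp only [map_smul, LinearMap.smul_apply, h]
  | hof a => rw [comp_of, BHom.comp_one]

end LHom

/-- The category of oriented `1`-manifolds with boundary `Z` and formal linear combinations of
`2`-bordisms modulo the local relations. -/
structure Cob (k : Type*) [CommRing k] (Z : Signed) where
  mfd : OneMfd Z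

open CategoryTheory

noncomputable instance : Category (Cob k Z) where
  Hom A B := LHom k A.mfd B.mfd
  id A := LHom.of k (BHom.one A.mfd)
  comp f g := LHom.comp f g
  id_comp := LHom.one_comp
  comp_id := LHom.comp_one
  assoc := LHom.comp_assoc

noncomputable instance (A B : Cob k Z) : AddCommGroup (A ⟶ B) :=
  inferInstanceAs (AddCommGroup (LHom k A.mfd B.mfd))

noncomputable instance : Preadditive (Cob k Z) where
  add_comp _ _ _ f f' g := by
    show LHom.comp (f + f') g = LHom.comp f g + LHom.comp f' g
    rw [map_add]; rfl
  comp_add _ _ _ f g g' := map_add (LHom.comp f) g g'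

namespace Sew
variable {Z₁ Z₂ Z' : Signed} (s : Sew Z₁ Z₂ Z')

/-- Sewing of bordisms, extended bilinearly. -/
noncomputable def lhom {W₁ W₁' : OneMfd Z₁} {W₂ W₂' : OneMfd Z₂} :
    LHom k W₁ W₁' →ₗ[k] LHom k W₂ W₂' →ₗ[k] LHom k (s.mfd W₁ W₂) (s.mfd W₁' W₂') :=
  extendQ k s.hom {f | LocalRel k f} {f | LocalRel k f} {f | LocalRel k f}
    (fun f hf b => by
      rw [extend₂_left]
      refine Submodule.subset_span (localRel_map (fun P => s.pre P b.rep)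
        (fun P hP => s.pre_surf hP b.rep_surf) _ (fun P hP => ?_)
        (fun P n => s.add_pre P n _) (fun P => ⟨Sum.inl, fun x y => ⟨_, _, s.tube_pre P x y _⟩⟩)
        f hf)
      conv_lhs => rw [← b.rep_cls]
      exact s.hom_cls _ _)
    (fun f hf a => by
      rw [extend₂_right]
      refine Submodule.subset_span (localRel_map (fun P => s.pre a.rep P)
        (fun P hP => s.pre_surf a.rep_surf hP) _ (fun P hP => ?_)
        (fun P n => s.pre_add _ n P) (fun P => ⟨Sum.inr, fun x y => ⟨_, _, s.pre_tube _ P x y⟩⟩)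
        f hf)
      conv_lhs => rw [← a.rep_cls]
      exact s.hom_cls _ _)

theorem lhom_of {W₁ W₁' : OneMfd Z₁} {W₂ W₂' : OneMfd Z₂} (a : BHom W₁ W₁') (b : BHom W₂ W₂') :
    s.lhom (LHom.of k a) (LHom.of k b) = LHom.of k (s.hom a b) :=
  (extendQ_mk k _ _ _ _ _ _ _ _).trans (congrArg _ (extend₂_single k _ a b))

theorem lhom_comp {W₁ W₁' W₁'' : OneMfd Z₁} {W₂ W₂' W₂'' : OneMfd Z₂} (a : LHom k W₁ W₁')
    (b : LHom k W₂ W₂') (a' : LHom k W₁' W₁'') (b' : LHom k W₂' W₂'') :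
    s.lhom (LHom.comp a a') (LHom.comp b b') = LHom.comp (s.lhom a b) (s.lhom a' b') := by
  induction a using LHom.induction with
  | h0 => simp
  | hadd a a' h h' => simp only [map_add, LinearMap.add_apply, h, h']
  | hsmul r a h => simp only [map_smul, LinearMap.smul_apply, h]
  | hof a =>
  induction b using LHom.induction with
  | h0 => simp
  | hadd a a' h h' => simp only [map_add, LinearMap.add_apply, h, h']
  | hsmul r a h => simp only [map_smul, LinearMap.smul_apply, h]
  | hof b =>
  induction a' using LHom.induction with
  | h0 => simp
  | hadd a a' h h' => simp only [map_add, LinearMap.add_apply, h, h']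
  | hsmul r a h => simp only [map_smul, LinearMap.smul_apply, h]
  | hof a' =>
  induction b' using LHom.induction with
  | h0 => simp
  | hadd a a' h h' => simp only [map_add, h, h']
  | hsmul r a h => simp only [map_smul, h]
  | hof b' => simp only [LHom.comp_of, lhom_of, hom_comp]

end Sew

end

/-! ### Finite complexes and their tensor products -/

section
open CategoryTheory

/-- A biadditive bifunctor. -/
structure BiFun (C D E : Type*) [Category C] [Category D] [Category E] [Preadditive C]
    [Preadditive D] [Preadditive E] where
  obj : C → D → E
  map : ∀ {A A' : C} {B B' : D}, (A ⟶ A') →+ (B ⟶ B') →+ (obj A B ⟶ obj A' B')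
  map_id : ∀ A B, map (𝟙 A) (𝟙 B) = 𝟙 (obj A B)
  map_comp : ∀ {A A' A'' : C} {B B' B'' : D} (f : A ⟶ A') (f' : A' ⟶ A'') (g : B ⟶ B')
    (g' : B' ⟶ B''), map (f ≫ f') (g ≫ g') = map f g ≫ map f' g'

/-- Gluing of `1`-manifolds and bordisms along a pattern, as a biadditive bifunctor. -/
noncomputable def Sew.biFun (k : Type*) [CommRing k] {Z₁ Z₂ Z' : Signed} (s : Sew Z₁ Z₂ Z') :
    BiFun (Cob k Z₁) (Cob k Z₂) (Cob k Z') where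
  obj A B := ⟨s.mfd A.mfd B.mfd⟩
  map {A A' B B'} := AddMonoidHom.mk' (fun f => (s.lhom (k := k) (W₁ := A.mfd) (W₁' := A'.mfd)
      (W₂ := B.mfd) (W₂' := B'.mfd) f).toAddMonoidHom) fun f f' => by
    refine AddMonoidHom.ext fun g => ?_
    exact congrArg (fun l => l g) (map_add (s.lhom (k := k)) f f')
  map_id A B := (s.lhom_of _ _).trans (congrArg _ (s.hom_one _ _))
  map_comp f f' g g' := s.lhom_comp f g f' g'

/-- A bounded complex in the additive closure of a preadditive category, given by the finite family
of all its summands `obj i`, placed in degree `deg i`, and the matrix entries of its differential. -/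
structure FinCx (C : Type*) [Category C] [Preadditive C] where
  idx : Type
  [fin : Fintype idx]
  deg : idx → ℤ
  obj : idx → C
  d : ∀ i j, obj i ⟶ obj j
  d_deg : ∀ i j, deg j ≠ deg i + 1 → d i j = 0
  d_d : ∀ i k, ∑ j, d i j ≫ d j k = 0

namespace FinCx
attribute [instance] fin
variable {C D E : Type*} [Category C] [Category D] [Category E] [Preadditive C]
    [Preadditive D] [Preadditive E]

/-- The underlying cochain complex in the additive closure. -/
noncomputable def toCochain (K : FinCx C) : CochainComplex (Mat_ C) ℤ where
  X n := ⟨{i // K.deg i = n}, fun i => K.obj i.1⟩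
  d n m := fun i j => K.d i.1 j.1
  shape n m h := by
    refine DMatrix.ext fun i j => ?_
    refine K.d_deg _ _ fun hd => h ?_
    rw [i.2, j.2] at hd
    exact hd.symm
  d_comp_d' n m l h _ := by
    refine DMatrix.ext fun i j => ?_
    refine Eq.trans ?_ (K.d_d i.1 j.1)
    show ∑ x : {x // K.deg x = m}, K.d i.1 x.1 ≫ K.d x.1 j.1 = _
    refine (Finset.sum_subtype (Finset.univ.filter fun x => K.deg x = m) (by simp)
      (fun x => K.d i.1 x ≫ K.d x j.1)).symm.trans ?_
    refine Finset.sum_subset (Finset.filter_subset _ _) fun x _ hx => ?_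
    rw [K.d_deg, Limits.zero_comp]
    intro hd
    apply hx
    rw [i.2] at hd
    have h' : n + 1 = m := h
    simp [hd, h']

open scoped Classical in
/-- The entries of the identity matrix. -/
noncomputable def one (K : FinCx C) (i j : K.idx) : K.obj i ⟶ K.obj j :=
  if h : i = j then eqToHom (congrArg K.obj h) else 0

theorem sum_one_comp (K : FinCx C) (i : K.idx) {A : C} (f : ∀ j, K.obj j ⟶ A) :
    ∑ j, K.one i j ≫ f j = f i := by
  rw [Finset.sum_eq_single i]
  · simp [one]
  · intro j _ h; simp [one, h.symm]
  · simp

theorem sum_comp_one (K : FinCx C) (i : K.idx) {A : C} (f : ∀ j, A ⟶ K.obj j) :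
    ∑ j, f j ≫ K.one j i = f i := by
  rw [Finset.sum_eq_single i]
  · simp [one]
  · intro j _ h; simp [one, h]
  · simp

/-- The tensor product of complexes along a bifunctor `T`, i.e. the total complex with
`d = T(d, 1) + (-1)^p T(1, d)` on the part of bidegree `(p, q)`. -/
noncomputable def tensor (T : BiFun C D E) (K : FinCx C) (L : FinCx D) : FinCx E where
  idx := K.idx × L.idx
  deg x := K.deg x.1 + L.deg x.2
  obj x := T.obj (K.obj x.1) (L.obj x.2)
  d x y := T.map (K.d x.1 y.1) (L.one x.2 y.2)
    + ((K.deg x.1).negOnePow : ℤ) • T.map (K.one x.1 y.1) (L.d x.2 y.2)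
  d_deg x y h := by
    have e1 : T.map (K.d x.1 y.1) (L.one x.2 y.2) = 0 := by
      by_cases hx : x.2 = y.2
      · rw [K.d_deg, map_zero]; rfl
        intro hd; apply h; rw [hd, hx]; ring
      · rw [one, dif_neg hx, map_zero]
    have e2 : T.map (K.one x.1 y.1) (L.d x.2 y.2) = 0 := by
      by_cases hx : x.1 = y.1
      · rw [L.d_deg, map_zero]
        intro hd; apply h; rw [hd, hx]; ring
      · rw [one, dif_neg hx, map_zero]; rfl
    rw [e1, e2, smul_zero, add_zero]
  d_d x z := by
    obtain ⟨i, j⟩ := x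
    obtain ⟨i'', j''⟩ := z
    have key : ∀ i' j', (T.map (K.d i i') (L.one j j')
          + ((K.deg i).negOnePow : ℤ) • T.map (K.one i i') (L.d j j')) ≫
        (T.map (K.d i' i'') (L.one j' j'')
          + ((K.deg i').negOnePow : ℤ) • T.map (K.one i' i'') (L.d j' j''))
        = T.map (K.d i i' ≫ K.d i' i'') (L.one j j' ≫ L.one j' j'')
          - ((K.deg i).negOnePow : ℤ) • T.map (K.d i i' ≫ K.one i' i'') (L.one j j' ≫ L.d j' j'')
          + ((K.deg i).negOnePow : ℤ) • T.map (K.one i i' ≫ K.d i' i'') (L.d j j' ≫ L.one j' j'')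
          + T.map (K.one i i' ≫ K.one i' i'') (L.d j j' ≫ L.d j' j'') := by
      intro i' j'
      have e1 : (((K.deg i').negOnePow : ℤ) • T.map (K.d i i' ≫ K.one i' i'') (L.one j j' ≫ L.d j' j''))
          = -(((K.deg i).negOnePow : ℤ) • T.map (K.d i i' ≫ K.one i' i'') (L.one j j' ≫ L.d j' j'')) := by
        by_cases h : K.deg i' = K.deg i + 1
        · rw [h, Int.negOnePow_succ]; simp
        · rw [K.d_deg _ _ h]; simp
      have e2 : (((K.deg i).negOnePow : ℤ) • ((K.deg i').negOnePow : ℤ) •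
            T.map (K.one i i' ≫ K.one i' i'') (L.d j j' ≫ L.d j' j''))
          = T.map (K.one i i' ≫ K.one i' i'') (L.d j j' ≫ L.d j' j'') := by
        by_cases h : i = i'
        · subst h
          rw [smul_smul, ← Units.val_mul, Int.units_mul_self, Units.val_one, one_smul]
        · rw [one, dif_neg h]; simp
      rw [Preadditive.add_comp, Preadditive.comp_add, Preadditive.comp_add, Preadditive.zsmul_comp,
        Preadditive.zsmul_comp, Preadditive.comp_zsmul, Preadditive.comp_zsmul, ← T.map_comp,
        ← T.map_comp, ← T.map_comp, ← T.map_comp, e1, e2]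
      abel
    have tsum : ∀ {A A' : C} {B B' : D} (f : K.idx → (A ⟶ A')) (g : L.idx → (B ⟶ B')),
        ∑ p : K.idx × L.idx, T.map (f p.1) (g p.2) = T.map (∑ i, f i) (∑ j, g j) := by
      intro A A' B B' f g
      rw [map_sum, map_sum, Fintype.sum_prod_type_right]
      simp
    refine (Finset.sum_congr rfl fun p _ => key p.1 p.2).trans ?_
    rw [Finset.sum_add_distrib, Finset.sum_add_distrib, Finset.sum_sub_distrib, ← Finset.smul_sum,
      ← Finset.smul_sum,
      tsum (fun i' => K.d i i' ≫ K.d i' i'') (fun j' => L.one j j' ≫ L.one j' j''),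
      tsum (fun i' => K.d i i' ≫ K.one i' i'') (fun j' => L.one j j' ≫ L.d j' j''),
      tsum (fun i' => K.one i i' ≫ K.d i' i'') (fun j' => L.d j j' ≫ L.one j' j''),
      tsum (fun i' => K.one i i' ≫ K.one i' i'') (fun j' => L.d j j' ≫ L.d j' j''),
      K.d_d, L.d_d]
    simp only [K.sum_comp_one, L.sum_one_comp, K.sum_one_comp, L.sum_comp_one]
    simp

end FinCx
end

/-! ### The bracket complex -/

namespace Frame
open CategoryTheory
variable {Z : Signed} (F : Frame Z)

section
variable (k : Type*) [CommRing k]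

/-- The saddle bordism between two smoothings as a morphism. -/
noncomputable def sad (σ σ' : F.N → Bool) : LHom k (F.smooth σ) (F.smooth σ') :=
  LHom.of k ((F.saddle σ σ').cls (F.saddle_surf σ σ'))

/-- The bordism between two smoothings with an additional tube between the components of the ends
`x` and `y` (a handle, if `x = y`). -/
noncomputable def tub (σ σ' : F.N → Bool) (x y : F.H) : LHom k (F.smooth σ) (F.smooth σ') :=
  LHom.of k (((F.saddle σ σ').tube x y).cls (Pre.tube_surf (F.saddle_surf σ σ') x y))

/-- The genus-one morphism at the vertex `b`, for `σ' = σ` containing the smoothing `0-3, 1-2` of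
`b`: a tube between the left strand `0-3` and the right strand `1-2`, minus a handle on the left
strand. -/
noncomputable def genusOne (σ σ' : F.N → Bool) (b : F.N) : LHom k (F.smooth σ) (F.smooth σ') :=
  F.tub k σ σ' (.inl (.inl (b, 0))) (.inl (.inl (b, 1)))
    - F.tub k σ σ' (.inl (.inl (b, 0))) (.inl (.inl (b, 0)))
end

section
variable {k : Type*} [CommRing k]

theorem sad_sad {σ σ' σ'' : F.N → Bool} (h : ∀ n, σ n = σ' n ∨ σ' n = σ'' n) :
    LHom.comp (F.sad k σ σ') (F.sad k σ' σ'') = F.sad k σ σ'' := by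
  refine (LHom.comp_of _ _).trans (congrArg _ ?_)
  exact (BHom.comp_cls _ _).trans ((F.saddle_comp h).cls _ _)

theorem tub_sad {σ σ' σ'' : F.N → Bool} (h : ∀ n, σ n = σ' n ∨ σ' n = σ'' n) (x y : F.H) :
    LHom.comp (F.tub k σ σ' x y) (F.sad k σ' σ'') = F.tub k σ σ'' x y := by
  refine (LHom.comp_of _ _).trans (congrArg _ ?_)
  refine (BHom.comp_cls _ _).trans ?_
  refine ((Pre.tube_comp (F.saddle σ σ') x y (F.saddle σ' σ'')).cls _ (Pre.tube_surf
    (Pre.comp_surf (F.saddle_surf σ σ') (F.saddle_surf σ' σ'')) _ _)).trans ?_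
  exact ((F.saddle_comp h).tube _ _).cls _ _

theorem sad_tub {σ σ' σ'' : F.N → Bool} (h : ∀ n, σ n = σ' n ∨ σ' n = σ'' n) (x y : F.H) :
    LHom.comp (F.sad k σ σ') (F.tub k σ' σ'' x y) = F.tub k σ σ'' x y := by
  refine (LHom.comp_of _ _).trans (congrArg _ ?_)
  refine (BHom.comp_cls _ _).trans ?_
  refine ((Pre.comp_tube (F.saddle σ σ') (F.saddle σ' σ'') x y).cls _ (Pre.tube_surf
    (Pre.comp_surf (F.saddle_surf σ σ') (F.saddle_surf σ' σ'')) _ _)).trans ?_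
  exact ((F.saddle_comp h).tube _ _).cls _ _

theorem tub_tub_comm {σ σ' σ'' ρ : F.N → Bool} (h : ∀ n, σ n = σ' n ∨ σ' n = σ'' n)
    (h' : ∀ n, σ n = ρ n ∨ ρ n = σ'' n) (x y z t : F.H) :
    LHom.comp (F.tub k σ σ' x y) (F.tub k σ' σ'' z t)
      = LHom.comp (F.tub k σ ρ z t) (F.tub k ρ σ'' x y) := by
  have key : ∀ {σ'} (_ : ∀ n, σ n = σ' n ∨ σ' n = σ'' n) (x y z t : F.H),
      LHom.comp (F.tub k σ σ' x y) (F.tub k σ' σ'' z t)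
      = LHom.of k ((((F.saddle σ σ'').tube x y).tube z t).cls
        (Pre.tube_surf (Pre.tube_surf (F.saddle_surf σ σ'') x y) z t)) := by
    intro σ' h x y z t
    refine (LHom.comp_of _ _).trans (congrArg _ ?_)
    refine (BHom.comp_cls _ _).trans ?_
    have hc := Pre.comp_surf (F.saddle_surf σ σ') (F.saddle_surf σ' σ'')
    refine ((Pre.comp_tube ((F.saddle σ σ').tube x y) (F.saddle σ' σ'') z t).cls _ (Pre.tube_surf
      (Pre.comp_surf (Pre.tube_surf (F.saddle_surf σ σ') x y) (F.saddle_surf σ' σ'')) _ _)).trans ?_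
    refine (((Pre.tube_comp (F.saddle σ σ') x y (F.saddle σ' σ'')).tube (.inr z) (.inr t)).cls _
      (Pre.tube_surf (Pre.tube_surf hc _ _) _ _)).trans ?_
    exact (((F.saddle_comp h).tube (.inl x) (.inl y)).tube (.inr z) (.inr t)).cls _ _
  refine (key h x y z t).trans (Eq.trans (congrArg _ ?_) (key h' z t x y).symm)
  exact (Pre.tube_tube (F.saddle σ σ'') x y z t).cls _ _

theorem genusOne_eq_zero {σ σ' : F.N → Bool} {b : F.N} (h : σ b ≠ σ' b) :
    F.genusOne k σ σ' b = 0 := by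
  refine sub_eq_zero.2 (congrArg (LHom.of k) ?_)
  exact (Pre.tube_congr (P := F.saddle σ σ') rfl (F.mk_vertex h 1)).cls _ _

theorem genusOne_sad {σ σ' σ'' : F.N → Bool} (h : ∀ n, σ n = σ' n ∨ σ' n = σ'' n) (b : F.N) :
    LHom.comp (F.genusOne k σ σ' b) (F.sad k σ' σ'') = F.genusOne k σ σ'' b := by
  rw [genusOne, map_sub, LinearMap.sub_apply, tub_sad _ h, tub_sad _ h, genusOne]

theorem sad_genusOne {σ σ' σ'' : F.N → Bool} (h : ∀ n, σ n = σ' n ∨ σ' n = σ'' n) (b : F.N) :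
    LHom.comp (F.sad k σ σ') (F.genusOne k σ' σ'' b) = F.genusOne k σ σ'' b := by
  rw [genusOne, map_sub, sad_tub _ h, sad_tub _ h, genusOne]

theorem genusOne_comm {σ σ' σ'' ρ : F.N → Bool} (h : ∀ n, σ n = σ' n ∨ σ' n = σ'' n)
    (h' : ∀ n, σ n = ρ n ∨ ρ n = σ'' n) (a b : F.N) :
    LHom.comp (F.genusOne k σ σ' a) (F.genusOne k σ' σ'' b)
      = LHom.comp (F.genusOne k σ ρ b) (F.genusOne k ρ σ'' a) := by
  simp only [genusOne, map_sub, LinearMap.sub_apply, F.tub_tub_comm h h']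
  abel

end

open scoped Classical

/-- The index set of the bracket complex: a set `r` of double points (those resolved to positive
crossings, the others are resolved to negative crossings), together with a state `s` of the
resulting diagram, i.e. a set of crossings.  Here `sing` tells which vertices are double points. -/
def Cube (sing : F.N → Bool) : Type :=
  {p : Finset F.N × Finset F.N // ∀ n ∈ p.1, sing n = true}

instance (sing : F.N → Bool) : Finite (F.Cube sing) := by
  have : Fintype F.N := Fintype.ofFinite _
  unfold Cube; infer_instance

variable {F} in
/-- The double points resolved to positive crossings. -/
def Cube.r {sing : F.N → Bool} (p : F.Cube sing) : Finset F.N := p.1.1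

variable {F} in
/-- The state. -/
def Cube.s {sing : F.N → Bool} (p : F.Cube sing) : Finset F.N := p.1.2

variable {F} in
/-- The smoothing in the state `s` of the resolution `r`.  An ordinary crossing and a negatively
resolved double point get the smoothing `0-3, 1-2` iff they lie in `s`, a positively resolved double
point gets it iff it does not lie in `s`. -/
noncomputable def Cube.smoothing {sing : F.N → Bool} (p : F.Cube sing) (n : F.N) : Bool :=
  xor (decide (n ∈ p.s)) (decide (n ∈ p.r))

variable {F} in
/-- `q` arises from `p` by adding the crossing `a` to the state. -/
def Cube.Saddle {sing : F.N → Bool} (p q : F.Cube sing) (a : F.N) : Prop :=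
  a ∉ p.s ∧ q.s = insert a p.s ∧ q.r = p.r

variable {F} in
/-- `q` arises from `p` by changing the resolution of the double point `b` from negative to positive,
and without changing the smoothing, which is the oriented one at `b`. -/
def Cube.Cross {sing : F.N → Bool} (p q : F.Cube sing) (b : F.N) : Prop :=
  b ∈ p.s ∧ q.s = p.s.erase b ∧ b ∉ p.r ∧ q.r = insert b p.r

/-- The sign `(-1)^#{b ∈ s | b < a}` with respect to the ordering given by `ν`. -/
noncomputable def sgn (ν : F.N → ℕ) (s : Finset F.N) (a : F.N) : ℤ :=
  (-1) ^ (s.filter fun b => ν b < ν a).card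

/-- The contribution of the vertex `a` to the differential. -/
noncomputable def entry (k : Type*) [CommRing k] (sing : F.N → Bool) (ν : F.N → ℕ)
    (p q : F.Cube sing) (a : F.N) : LHom k (F.smooth p.smoothing) (F.smooth q.smoothing) :=
  if p.Saddle q a then F.sgn ν p.s a • F.sad k p.smoothing q.smoothing
  else if p.Cross q a then F.sgn ν p.s a • F.genusOne k p.smoothing q.smoothing a
  else 0


section
variable {F} {k : Type*} [CommRing k] {sing : F.N → Bool}

theorem Cube.ext {p q : F.Cube sing} (hs : p.s = q.s) (hr : p.r = q.r) : p = q :=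
  Subtype.ext (Prod.ext hr hs)

/-- One of the two kinds of steps. -/
def Cube.Step (p q : F.Cube sing) (a : F.N) : Prop := p.Saddle q a ∨ p.Cross q a

theorem Cube.Step.s_eq {p q : F.Cube sing} {a : F.N} (h : p.Step q a) :
    q.s = if a ∈ p.s then p.s.erase a else insert a p.s := by
  rcases h with ⟨h1, h2, _⟩ | ⟨h1, h2, _⟩ <;> simp [h1, h2]

theorem Cube.Step.r_eq {p q : F.Cube sing} {a : F.N} (h : p.Step q a) :
    q.r = if a ∈ p.s then insert a p.r else p.r := by
  rcases h with ⟨h1, _, h2⟩ | ⟨h1, _, _, h2⟩ <;> simp [h1, h2]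

theorem Cube.Step.unique {p q q' : F.Cube sing} {a : F.N} (h : p.Step q a) (h' : p.Step q' a) :
    q = q' :=
  Cube.ext (h.s_eq.trans h'.s_eq.symm) (h.r_eq.trans h'.r_eq.symm)

theorem Cube.Step.ne {p q : F.Cube sing} {a n : F.N} (h : p.Step q a) (hn : n ≠ a) :
    (n ∈ q.s ↔ n ∈ p.s) ∧ (n ∈ q.r ↔ n ∈ p.r) := by
  rw [h.s_eq, h.r_eq]
  by_cases ha : a ∈ p.s <;> simp [ha, hn]

theorem Cube.Step.smoothing_ne {p q : F.Cube sing} {a n : F.N} (h : p.Step q a) (hn : n ≠ a) :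
    q.smoothing n = p.smoothing n := by
  simp [Cube.smoothing, h.ne hn]

theorem Cube.Saddle.smoothing {p q : F.Cube sing} {a : F.N} (h : p.Saddle q a) :
    p.smoothing a ≠ q.smoothing a := by
  obtain ⟨h1, h2, h3⟩ := h
  simp [Cube.smoothing, h1, h2, h3]

theorem Cube.Cross.smoothing {p q : F.Cube sing} {a : F.N} (h : p.Cross q a) :
    p.smoothing a = q.smoothing a := by
  obtain ⟨h1, h2, h3, h4⟩ := h
  simp [Cube.smoothing, h1, h2, h3, h4]

theorem Cube.Step.between {p q t : F.Cube sing} {a b : F.N} (h : p.Step q a) (h' : q.Step t b)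
    (hab : a ≠ b) (n : F.N) : p.smoothing n = q.smoothing n ∨ q.smoothing n = t.smoothing n := by
  by_cases hn : n = a
  · subst hn; exact .inr (h'.smoothing_ne hab).symm
  · exact .inl (h.smoothing_ne hn).symm

/-- The part of `entry` without the sign. -/
noncomputable def core (k : Type*) [CommRing k] (p q : F.Cube sing) (a : F.N) :
    LHom k (F.smooth p.smoothing) (F.smooth q.smoothing) :=
  if a ∈ p.s then F.genusOne k p.smoothing q.smoothing a else F.sad k p.smoothing q.smoothing

theorem entry_step (ν : F.N → ℕ) {p q : F.Cube sing} {a : F.N} (h : p.Step q a) :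
    F.entry k sing ν p q a = F.sgn ν p.s a • core k p q a := by
  rcases h with h | h
  · rw [entry, if_pos h, core, if_neg h.1]
  · rw [entry, if_neg fun h' => h'.1 h.1, if_pos h, core, if_pos h.1]

theorem entry_not (ν : F.N → ℕ) {p q : F.Cube sing} {a : F.N} (h : ¬ p.Step q a) :
    F.entry k sing ν p q a = 0 := by
  rw [entry, if_neg fun h' => h (.inl h'), if_neg fun h' => h (.inr h')]

theorem core_comm {p q q' t : F.Cube sing} {a b : F.N} (hab : a ≠ b) (h1 : p.Step q a)
    (h2 : q.Step t b) (h1' : p.Step q' b) (h2' : q'.Step t a) :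
    LHom.comp (core k p q a) (core k q t b) = LHom.comp (core k p q' b) (core k q' t a) := by
  have e1 : b ∈ q.s ↔ b ∈ p.s := (h1.ne hab.symm).1
  have e2 : a ∈ q'.s ↔ a ∈ p.s := (h1'.ne hab).1
  have B := h1.between h2 hab
  have B' := h1'.between h2' hab.symm
  unfold core
  by_cases ha : a ∈ p.s <;> by_cases hb : b ∈ p.s <;> simp only [ha, hb, e1, e2, if_true, if_false]
  · exact F.genusOne_comm B B' a b
  · rw [F.genusOne_sad B, F.sad_genusOne B']
  · rw [F.sad_genusOne B, F.genusOne_sad B']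
  · rw [F.sad_sad B, F.sad_sad B']

theorem core_self {p q t : F.Cube sing} {a : F.N} (h1 : p.Step q a) (h2 : q.Step t a) :
    LHom.comp (core k p q a) (core k q t a) = 0 := by
  have hb : ∀ n, p.smoothing n = q.smoothing n ∨ q.smoothing n = t.smoothing n := by
    intro n
    by_cases hn : n = a
    · subst hn
      rcases h1 with h1 | h1
      · rcases h2 with h2 | h2
        · exact absurd (h1.2.1 ▸ Finset.mem_insert_self _ _) h2.1
        · exact .inr h2.smoothing
      · exact .inl h1.smoothing
    · exact .inl (h1.smoothing_ne hn).symm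
  rcases h1 with h1 | h1
  · rcases h2 with h2 | h2
    · exact absurd (h1.2.1 ▸ Finset.mem_insert_self _ _) h2.1
    · rw [core, if_neg h1.1, core, if_pos h2.1, F.sad_genusOne hb]
      exact F.genusOne_eq_zero fun h => h1.smoothing (h.trans h2.smoothing.symm)
  · rcases h2 with h2 | h2
    · rw [core, if_pos h1.1, core, if_neg h2.1, F.genusOne_sad hb]
      exact F.genusOne_eq_zero fun h => h2.smoothing (h1.smoothing.symm.trans h)
    · exact absurd h2.1 (h1.2.1 ▸ Finset.notMem_erase _ _)

theorem sgn_step (ν : F.N → ℕ) {p q : F.Cube sing} {a b : F.N} (h : p.Step q a) :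
    F.sgn ν q.s b = (if ν a < ν b then -1 else 1) * F.sgn ν p.s b := by
  unfold sgn
  by_cases hab : ν a < ν b
  · rcases h with ⟨h1, h2, _⟩ | ⟨h1, h2, _⟩
    · rw [h2, Finset.filter_insert, if_pos hab, if_pos hab, Finset.card_insert_of_notMem
        (by simp [h1]), pow_succ]
      ring
    · have : p.s = insert a q.s := by rw [h2, Finset.insert_erase h1]
      have h3 : a ∉ q.s := by rw [h2]; exact Finset.notMem_erase _ _
      rw [this, Finset.filter_insert, if_pos hab, if_pos hab, Finset.card_insert_of_notMem
        (by simp [h3]), pow_succ]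
      ring
  · rcases h with ⟨h1, h2, _⟩ | ⟨h1, h2, _⟩
    · rw [h2, Finset.filter_insert, if_neg hab, if_neg hab, one_mul]
    · have : p.s = insert a q.s := by rw [h2, Finset.insert_erase h1]
      rw [this, Finset.filter_insert, if_neg hab, if_neg hab, one_mul]

/-- Two steps at different vertices can be done in the other order. -/
theorem Cube.Step.swap {p q t : F.Cube sing} {a b : F.N} (hab : a ≠ b) (h1 : p.Step q a)
    (h2 : q.Step t b) : ∃ q' : F.Cube sing, p.Step q' b ∧ q'.Step t a := by
  have e1 : b ∈ q.s ↔ b ∈ p.s := (h1.ne hab.symm).1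
  have e2 : b ∈ q.r ↔ b ∈ p.r := (h1.ne hab.symm).2
  have hba := hab.symm
  let q' : F.Cube sing := ⟨(if b ∈ p.s then insert b p.r else p.r,
      if b ∈ p.s then p.s.erase b else insert b p.s), by
    intro n hn
    refine t.2 n ?_
    show n ∈ t.r
    rw [h2.r_eq, h1.r_eq]
    by_cases hb : b ∈ p.s
    · simp only [hb, e1, if_true, Finset.mem_insert] at hn ⊢
      rcases hn with rfl | hn
      · exact .inl rfl
      · refine .inr ?_
        split_ifs <;> simp [show n ∈ p.r from hn]
    · simp only [hb, e1, if_false] at hn ⊢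
      split_ifs <;> simp [show n ∈ p.r from hn]⟩
  have hs : q'.s = if b ∈ p.s then p.s.erase b else insert b p.s := rfl
  have hr : q'.r = if b ∈ p.s then insert b p.r else p.r := rfl
  refine ⟨q', ?_, ?_⟩
  · by_cases hb : b ∈ p.s
    · rw [if_pos hb] at hs hr
      refine .inr ⟨hb, hs, ?_, hr⟩
      rcases h2 with h2 | h2
      · exact absurd (e1.2 hb) h2.1
      · exact fun h => h2.2.2.1 (e2.2 h)
    · rw [if_neg hb] at hs hr
      exact .inl ⟨hb, hs, hr⟩
  · have hts : ∀ n, n ∈ t.s ↔ if n = b then b ∉ p.s else n ∈ q.s := by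
      intro n
      rw [h2.s_eq]
      by_cases hb : b ∈ p.s <;> by_cases hn : n = b <;> simp [hb, hn, e1]
    have htr : ∀ n, n ∈ t.r ↔ (n = b ∧ b ∈ p.s) ∨ n ∈ q.r := by
      intro n
      rw [h2.r_eq]
      by_cases hb : b ∈ p.s <;> simp [hb, e1]
    have hsn : ∀ n, n ∈ q'.s ↔ if n = b then b ∉ p.s else n ∈ p.s := by
      intro n
      rw [hs]
      by_cases hb : b ∈ p.s <;> by_cases hn : n = b <;> simp [hb, hn]
    have hrn : ∀ n, n ∈ q'.r ↔ (n = b ∧ b ∈ p.s) ∨ n ∈ p.r := by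
      intro n
      rw [hr]
      by_cases hb : b ∈ p.s <;> simp [hb]
    rcases h1 with ⟨h1, h3, h4⟩ | ⟨h1, h3, h5, h4⟩
    · refine .inl ⟨?_, ?_, ?_⟩
      · simp [hsn, h1, hab]
      · ext n
        by_cases hn : n = b
        · subst hn; simp [hts, hsn, hba]
        · simp [hts, hsn, hn, h3]
      · ext n
        simp [htr, hrn, h4]
    · refine .inr ⟨?_, ?_, ?_, ?_⟩
      · simp [hsn, h1, hab]
      · ext n
        by_cases hn : n = b
        · subst hn; simp [hts, hsn, hba]
        · simp [hts, hsn, hn, h3]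
      · simp [hrn, h5, hab]
      · ext n
        simp only [htr, hrn, h4, Finset.mem_insert]
        tauto

end

/-- The (extended) universal bracket complex of a coloured diagram, with the ordering of its vertices
given by the injection `ν`. The summand of `(r, s)` is the smoothing of the resolution `r` in the state
`s`, placed in degree `|s| + 2 |r|`; the differential is the sum of the signed saddles `s → s ∪ {a}` and
the signed genus-one morphisms `(r, s) → (r ∪ {b}, s \ {b})`. -/
noncomputable def bracket (k : Type*) [CommRing k] (sing : F.N → Bool) (ν : F.N ↪ ℕ) :
    FinCx (Cob k Z) where
  idx := F.Cube sing
  fin := Fintype.ofFinite _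
  deg p := p.s.card + 2 * p.r.card
  obj p := ⟨F.smooth p.smoothing⟩
  d p q := letI := Fintype.ofFinite F.N; ∑ a, F.entry k sing ν p q a
  d_deg p q h := by
    refine Finset.sum_eq_zero fun a _ => entry_not ν ?_
    rintro (⟨h1, h2, h3⟩ | ⟨h1, h2, h3, h4⟩)
    · apply h; rw [h2, h3, Finset.card_insert_of_notMem h1]; push_cast; ring
    · apply h
      have := Finset.card_erase_add_one h1
      rw [h2, h4, Finset.card_insert_of_notMem h3, ← this]; push_cast; ring
  d_d p t := by
    let _ : Fintype F.N := Fintype.ofFinite F.N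
    let _ : Fintype (F.Cube sing) := Fintype.ofFinite (F.Cube sing)
    let X : F.N → F.N → LHom k (F.smooth p.smoothing) (F.smooth t.smoothing) := fun a b =>
      ∑ q, LHom.comp (F.entry k sing ν p q a) (F.entry k sing ν q t b)
    have hX : ∀ {q a b}, p.Step q a → q.Step t b → X a b
        = (F.sgn ν p.s a * F.sgn ν q.s b) • LHom.comp (core k p q a) (core k q t b) := by
      intro q a b h1 h2
      refine (Finset.sum_eq_single q ?_ (fun h => absurd (Finset.mem_univ _) h)).trans ?_
      · intro q' _ hq
        rw [entry_not ν fun h => hq (h.unique h1)]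
        simp
      · rw [entry_step ν h1, entry_step ν h2, map_zsmul, map_zsmul, LinearMap.smul_apply, smul_smul,
          mul_comm]
    have hX0 : ∀ {a b}, (¬ ∃ q, p.Step q a ∧ q.Step t b) → X a b = 0 := by
      intro a b h
      refine Finset.sum_eq_zero fun q _ => ?_
      by_cases h1 : p.Step q a
      · rw [entry_not ν (q := t) fun h2 => h ⟨q, h1, h2⟩, map_zero]
      · rw [entry_not ν h1, map_zero, LinearMap.zero_apply]
    have anti : ∀ a b, a ≠ b → X a b + X b a = 0 := by
      intro a b hab
      by_cases h : ∃ q, p.Step q a ∧ q.Step t b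
      · obtain ⟨q, h1, h2⟩ := h
        obtain ⟨q', h1', h2'⟩ := h1.swap hab h2
        rw [hX h1 h2, hX h1' h2', core_comm hab h1 h2 h1' h2', ← add_smul, sgn_step ν h1,
          sgn_step ν h1']
        have hν := ν.injective.ne hab
        rcases lt_or_gt_of_ne hν with h | h
        · rw [if_pos h, if_neg h.not_gt]
          refine (congrArg (fun m : ℤ => m • _) ?_).trans (zero_smul ℤ _)
          ring
        · rw [if_neg h.not_gt, if_pos h]
          refine (congrArg (fun m : ℤ => m • _) ?_).trans (zero_smul ℤ _)
          ring
      · rw [hX0 h, hX0 fun ⟨q, h1, h2⟩ => h ((h1.swap hab.symm h2).imp fun _ h => h), add_zero]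
    have diag : ∀ a, X a a = 0 := by
      intro a
      by_cases h : ∃ q, p.Step q a ∧ q.Step t a
      · obtain ⟨q, h1, h2⟩ := h
        rw [hX h1 h2, core_self h1 h2, smul_zero]
      · exact hX0 h
    have total : ∑ a, ∑ b, X a b = 0 := by
      rw [← Finset.sum_product', Finset.univ_product_univ]
      refine Finset.sum_involution (fun x _ => (x.2, x.1)) ?_ ?_ (fun _ _ => Finset.mem_univ _)
        (fun _ _ => rfl)
      · rintro ⟨a, b⟩ _
        by_cases hab : a = b
        · subst hab
          show X a a + X a a = 0
          rw [diag, add_zero]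
        · exact anti a b hab
      · rintro ⟨a, b⟩ _ h h'
        obtain rfl : b = a := congrArg Prod.fst h'
        exact h (diag b)
    refine Eq.trans ?_ total
    have comm : ∑ q, ∑ a, ∑ b, LHom.comp (F.entry k sing ν p q a) (F.entry k sing ν q t b)
        = ∑ a, ∑ b, X a b :=
      Finset.sum_comm.trans (Finset.sum_congr rfl fun a _ => Finset.sum_comm)
    refine Eq.trans (Finset.sum_congr rfl fun q _ => ?_) comm
    show LHom.comp (∑ a, F.entry k sing ν p q a) (∑ b, F.entry k sing ν q t b) = _
    simp only [map_sum, LinearMap.sum_apply]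
    exact Finset.sum_comm

end Frame

/-! ### Singular tangle diagrams -/

/-- A singular tangle diagram with boundary points `E`, as a combinatorial map: 4-valent vertices `N`,
each being an ordinary crossing or (if `sing`) a double point; 2-valent marking points `M`, which
have no meaning but allow to subdivide edges and circles; and the fixed point free involution `e`
exchanging the two ends of each edge.  An end of an edge is `(n, i)` at a vertex `n`, `(m, b)` at a
marking point, or a boundary point.  The ends `(n, 0), …, (n, 3)` are in counterclockwise order; at a
crossing `0` and `2` belong to the lower strand, and at a double point `0` and `1` are the
incoming ends and `2` and `3` the outgoing ones.  So the smoothing `0-3, 1-2` of a double point is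
the oriented one. -/
structure SDiagram (E : Type) where
  N : Type
  M : Type
  [finN : Finite N]
  [finM : Finite M]
  sing : N → Bool
  e : (N × Fin 4 ⊕ M × Bool) ⊕ E → (N × Fin 4 ⊕ M × Bool) ⊕ E
  e_e : ∀ x, e (e x) = x
  e_ne : ∀ x, e x ≠ x

namespace SDiagram
attribute [instance] finN finM

/-- The ends at the vertices. -/
abbrev J {E : Type} (D : SDiagram E) : Type := D.N × Fin 4 ⊕ D.M × Bool

variable {E₁ E₂ E' : Type} (g : Glue E₁ E₂ E') (D₁ : SDiagram E₁) (D₂ : SDiagram E₂)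

/-- The ends of a glued diagram are those of the two pieces; each glued pair of boundary points
becomes a marking point. -/
def gluedEnds : ((D₁.N ⊕ D₂.N) × Fin 4 ⊕ ((D₁.M ⊕ D₂.M) ⊕ g.Y) × Bool) ⊕ E' ≃
    (D₁.J ⊕ E₁) ⊕ (D₂.J ⊕ E₂) :=
  (Equiv.sumCongr
    { toFun
        | .inl (.inl n, i) => .inl (.inl (.inl (n, i)))
        | .inl (.inr n, i) => .inl (.inr (.inl (n, i)))
        | .inr (.inl (.inl m), b) => .inl (.inl (.inr (m, b)))
        | .inr (.inl (.inr m), b) => .inl (.inr (.inr (m, b)))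
        | .inr (.inr y, false) => .inr (.inl y)
        | .inr (.inr y, true) => .inr (.inr y)
      invFun
        | .inl (.inl (.inl (n, i))) => .inl (.inl n, i)
        | .inl (.inr (.inl (n, i))) => .inl (.inr n, i)
        | .inl (.inl (.inr (m, b))) => .inr (.inl (.inl m), b)
        | .inl (.inr (.inr (m, b))) => .inr (.inl (.inr m), b)
        | .inr (.inl y) => .inr (.inr y, false)
        | .inr (.inr y) => .inr (.inr y, true)
      left_inv := by rintro (⟨n | n, i⟩ | ⟨(m | m) | y, _ | _⟩) <;> rfl
      right_inv := by rintro (((⟨n, i⟩ | ⟨m, b⟩) | (⟨n, i⟩ | ⟨m, b⟩)) | (y | y)) <;> rfl }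
    (Equiv.refl E')).trans (g.ends D₁.J D₂.J)

/-- The diagram obtained by gluing boundary points. -/
def glue : SDiagram E' where
  N := D₁.N ⊕ D₂.N
  M := (D₁.M ⊕ D₂.M) ⊕ g.Y
  sing := Sum.elim D₁.sing D₂.sing
  e x := (gluedEnds g D₁ D₂).symm (Sum.map D₁.e D₂.e (gluedEnds g D₁ D₂ x))
  e_e x := by
    rw [Equiv.apply_symm_apply, Equiv.symm_apply_eq]
    generalize gluedEnds g D₁ D₂ x = y
    rcases y with y | y
    · exact congrArg Sum.inl (D₁.e_e y)
    · exact congrArg Sum.inr (D₂.e_e y)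
  e_ne x := by
    rw [ne_eq, Equiv.symm_apply_eq]
    generalize gluedEnds g D₁ D₂ x = y
    rcases y with y | y
    · exact fun h => D₁.e_ne y (Sum.inl_injective h)
    · exact fun h => D₂.e_ne y (Sum.inr_injective h)

/-- The composition of `D'' : Q → R` and `D' : P → Q`, i.e. `D''` stacked on top of `D'`.
A diagram `P → Q` is one with bottom boundary points `P` and top boundary points `Q`. -/
abbrev comp {P Q R : Type} [Finite Q] (D'' : SDiagram (Q ⊕ R)) (D' : SDiagram (P ⊕ Q)) :
    SDiagram (P ⊕ R) := glue (Glue.stack P Q R) D'' D'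

/-- The tensor product of `D' : P → Q` and `D'' : P' → Q'`, i.e. `D''` is put to the right of `D'`. -/
abbrev tensor {P Q P' Q' : Type} (D' : SDiagram (P ⊕ Q)) (D'' : SDiagram (P' ⊕ Q')) :
    SDiagram ((P ⊕ P') ⊕ (Q ⊕ Q')) := glue (Glue.side P Q P' Q') D' D''

end SDiagram

/-- A checkerboard colouring: `o x` says whether the region to the left of the edge, as seen from its
end `x`, is black; for a boundary point `z` this is `Z.pos z`.  Thus the colour to the left changes
between the two ends of an edge, and between neighbouring ends at a vertex. Orienting smoothings as
boundaries of the black regions, `Z` is the resulting oriented boundary. -/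
structure Coloring (Z : Signed) (D : SDiagram Z.pt) where
  o : D.J → Bool
  e_o : ∀ x, Sum.elim o Z.pos (D.e x) = !Sum.elim o Z.pos x
  o_N : ∀ n i, o (.inl (n, i + 1)) = !o (.inl (n, i))
  o_M : ∀ m, o (.inr (m, true)) = !o (.inr (m, false))

namespace Coloring

/-- The underlying coloured 4-valent diagram. -/
def frame {Z : Signed} {D : SDiagram Z.pt} (χ : Coloring Z D) : Frame Z where
  N := D.N
  M := D.M
  e := D.e
  o := χ.o
  e_e := D.e_e
  e_o := χ.e_o
  o_N := χ.o_N
  o_M := χ.o_M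

/-- The extended universal bracket complex `⟦D^χ⟧`, with the crossings and double points ordered by
the numbering `ν`. -/
noncomputable def bracket (k : Type*) [CommRing k] {Z : Signed} {D : SDiagram Z.pt} (χ : Coloring Z D)
    (ν : D.N ↪ ℕ) : FinCx (Cob k Z) := χ.frame.bracket k D.sing ν

section
variable {E₁ E₂ : Type} {Z' : Signed} {g : Glue E₁ E₂ Z'.pt} {D₁ : SDiagram E₁} {D₂ : SDiagram E₂}
  (χ : Coloring Z' (SDiagram.glue g D₁ D₂))

/-- The colours at all ends of the two pieces of a glued diagram. -/
def pieces (x : (D₁.J ⊕ E₁) ⊕ (D₂.J ⊕ E₂)) : Bool :=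
  Sum.elim χ.o Z'.pos ((SDiagram.gluedEnds g D₁ D₂).symm x)

theorem pieces_e (x) : χ.pieces (Sum.map D₁.e D₂.e x) = !χ.pieces x := by
  have h := χ.e_o ((SDiagram.gluedEnds g D₁ D₂).symm x)
  refine Eq.trans ?_ h
  show _ = Sum.elim χ.o Z'.pos ((SDiagram.gluedEnds g D₁ D₂).symm (Sum.map D₁.e D₂.e
    (SDiagram.gluedEnds g D₁ D₂ ((SDiagram.gluedEnds g D₁ D₂).symm x))))
  rw [Equiv.apply_symm_apply]
  rfl

end

section
variable {Z₁ Z₂ Z' : Signed} {g : Glue Z₁.pt Z₂.pt Z'.pt} {D₁ : SDiagram Z₁.pt} {D₂ : SDiagram Z₂.pt}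

/-- The induced colouring of the first piece of a glued diagram. -/
def fst (χ : Coloring Z' (SDiagram.glue g D₁ D₂))
    (h : ∀ z, χ.pieces (.inl (.inr z)) = Z₁.pos z) : Coloring Z₁ D₁ where
  o j := χ.pieces (.inl (.inl j))
  e_o x := by
    have key : ∀ x, Sum.elim (fun j => χ.pieces (.inl (.inl j))) Z₁.pos x = χ.pieces (.inl x) := by
      rintro (x | x)
      · rfl
      · exact (h x).symm
    rw [key, key]
    exact χ.pieces_e (.inl x)
  o_N n i := χ.o_N (.inl n) i
  o_M m := χ.o_M (.inl (.inl m))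

/-- The induced colouring of the second piece of a glued diagram. -/
def snd (χ : Coloring Z' (SDiagram.glue g D₁ D₂))
    (h : ∀ z, χ.pieces (.inr (.inr z)) = Z₂.pos z) : Coloring Z₂ D₂ where
  o j := χ.pieces (.inr (.inl j))
  e_o x := by
    have key : ∀ x, Sum.elim (fun j => χ.pieces (.inr (.inl j))) Z₂.pos x = χ.pieces (.inr x) := by
      rintro (x | x)
      · rfl
      · exact (h x).symm
    rw [key, key]
    exact χ.pieces_e (.inr x)
  o_N n i := χ.o_N (.inr n) i
  o_M m := χ.o_M (.inl (.inr m))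

end

section
variable {Y₀ Y₂ : Signed} {Q : Type} [Finite Q] {D'' : SDiagram (Q ⊕ Y₂.pt)}
  {D' : SDiagram (Y₀.pt ⊕ Q)} (χ : Coloring (Y₀.sum Y₂.neg) (SDiagram.comp D'' D'))

/-- The oriented `0`-manifold at which the two pieces of a coloured composition meet. -/
def mid : Signed := ⟨Q, fun q => χ.pieces (.inl (.inr (.inl q)))⟩

/-- The induced colouring of the upper piece of a composition. -/
def upper : Coloring (χ.mid.sum Y₂.neg) D'' :=
  χ.fst (Z₁ := χ.mid.sum Y₂.neg) (Z₂ := Y₀.sum χ.mid.neg) (Z' := Y₀.sum Y₂.neg)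
    (g := Glue.stack Y₀.pt Q Y₂.pt) (D₁ := D'')
    (D₂ := D') (by rintro (z | z) <;> rfl)

/-- The induced colouring of the lower piece of a composition. -/
def lower : Coloring (Y₀.sum χ.mid.neg) D' :=
  χ.snd (Z₁ := χ.mid.sum Y₂.neg) (Z₂ := Y₀.sum χ.mid.neg) (Z' := Y₀.sum Y₂.neg)
    (g := Glue.stack Y₀.pt Q Y₂.pt) (D₁ := D'')
    (D₂ := D') (by
      rintro (z | z)
      · rfl
      · exact χ.o_M (.inr z))

end

section
variable {Y₀ Y₁ Y₀' Y₁' : Signed} {D' : SDiagram (Y₀.pt ⊕ Y₁.pt)} {D'' : SDiagram (Y₀'.pt ⊕ Y₁'.pt)}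
  (χ : Coloring ((Y₀.sum Y₀').sum (Y₁.sum Y₁').neg) (SDiagram.tensor D' D''))

/-- The induced colouring of the left piece of a tensor product. -/
def left : Coloring (Y₀.sum Y₁.neg) D' :=
  χ.fst (Z₁ := Y₀.sum Y₁.neg) (Z₂ := Y₀'.sum Y₁'.neg) 
    (Z' := (Y₀.sum Y₀').sum (Y₁.sum Y₁').neg) (g := Glue.side Y₀.pt Y₁.pt Y₀'.pt Y₁'.pt)
    (D₁ := D') (D₂ := D'') (by rintro (z | z) <;> rfl)

/-- The induced colouring of the right piece of a tensor product. -/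
def right : Coloring (Y₀'.sum Y₁'.neg) D'' :=
  χ.snd (Z₁ := Y₀.sum Y₁.neg) (Z₂ := Y₀'.sum Y₁'.neg) 
    (Z' := (Y₀.sum Y₀').sum (Y₁.sum Y₁').neg) (g := Glue.side Y₀.pt Y₁.pt Y₀'.pt Y₁'.pt)
    (D₁ := D') (D₂ := D'') (by rintro (z | z) <;> rfl)

end

end Coloring

/-- The horizontal composition `∗` of complexes, for `K` over `Cob(Y₁, Y₂)` and `L` over
`Cob(Y₀, Y₁)`. -/
noncomputable def hcomp {k : Type*} [CommRing k] {Y₀ Y₁ Y₂ : Signed}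
    (K : FinCx (Cob k (Y₁.sum Y₂.neg))) (L : FinCx (Cob k (Y₀.sum Y₁.neg))) :
    FinCx (Cob k (Y₀.sum Y₂.neg)) :=
  FinCx.tensor ((Sew.stack Y₀ Y₁ Y₂).biFun k) K L

/-- The tensor product `⊗` of complexes, for `K` over `Cob(Y₀, Y₁)` and `L` over `Cob(Y₀', Y₁')`. -/
noncomputable def otimes {k : Type*} [CommRing k] {Y₀ Y₁ Y₀' Y₁' : Signed}
    (K : FinCx (Cob k (Y₀.sum Y₁.neg))) (L : FinCx (Cob k (Y₀'.sum Y₁'.neg))) :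
    FinCx (Cob k ((Y₀.sum Y₀').sum (Y₁.sum Y₁').neg)) :=
  FinCx.tensor ((Sew.side Y₀ Y₁ Y₀' Y₁').biFun k) K L

/-! ### Identifications of `1`-manifolds, transport of surfaces along them, and mapping cylinders.
-/

section
variable {Z : Signed}

/-! Stacking and juxtaposition are two cases of one operation: two diagrams are glued along pairs of
boundary points, and for the tensor product the set of pairs is empty. The theorem is therefore
proved once, for an arbitrary sewing pattern `s`, as `Coloring.bracket_glue`; both parts are
instances of it.

Summands. The vertices of a glued diagram are the disjoint union of those of the pieces, so a
resolution together with a state of the whole is a pair of such data for the pieces (`cubeEquiv`),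
and `|s|` and `|r|`, hence the degrees, add (`deg_cubeEquiv`). Smoothing a vertex is a local
operation, so a smoothing of the whole is glued from smoothings of the pieces (`smoothIso`). The two
`1`-manifolds are not literally equal, because their ends carry different names. The comparison
morphism is thus the mapping cylinder `BHom.cyl` of a renaming, which is invertible (`stateHom`,
`stateHom_iso`).

Entries of the differential. The surface with saddles between two smoothings of the whole is sewn
from the corresponding surfaces of the pieces (`saddle_glue`), and a tube attached inside one piece
remains a tube after sewing. Hence the saddle or the genus-one morphism at a vertex of one piece
corresponds, under the cylinders, to the same morphism of that piece sewn to an identity of the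
other (`core_inl`, `core_inr`). Conversely, a step in the cube of the whole is precisely a step in
one of the pieces with the state of the other piece unchanged (`step_inl`, `step_inr`). Up to signs
this is the differential of a tensor product of complexes.

Signs. Let the vertices of the first piece precede those of the second (`exists_lex`). A step in the
first piece then sees only smaller elements of its own state, while a step in the second piece sees
in addition all elements of the state `s₁` of the first, which yields the factor `(-1)^|s₁|`. As the
degree of the first factor is `|s₁| + 2 |r₁|`, this is the Koszul sign (`negOnePow_deg`). So for
this ordering the cylinders commute with the differentials (`gluedD_stateHom`). Any other ordering
is reached by multiplying the summand of `(r, s)` by the sign of the permutation of `s` relating the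
two orderings; this intertwines the differentials at saddles and at genus-one morphisms alike
(`reorder_step`). Finally `FinCx.toCochainIso` turns isomorphisms of summands that are compatible
with all matrix entries into an isomorphism of complexes. -/

/-- An identification of two `1`-manifolds with the same boundary that respects their subdivisions
into intervals. -/
structure OneMfd.Iso (W W' : OneMfd Z) where
  toEquiv : W.J ≃ W'.J
  map_e : ∀ x, Sum.map toEquiv id (W.e x) = W'.e (Sum.map toEquiv id x)
  map_l : ∀ j, toEquiv (W.l j) = W'.l (toEquiv j)
  map_o : ∀ j, W'.o (toEquiv j) = W.o j

namespace OneMfd.Iso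
variable {W W' : OneMfd Z}

/-- The identity. -/
def refl (W : OneMfd Z) : W.Iso W := ⟨Equiv.refl _, fun x => by simp, fun _ => rfl, fun _ => rfl⟩

/-- The bijection between all ends. -/
def ends (φ : W.Iso W') : W.H ≃ W'.H := Equiv.sumCongr φ.toEquiv (Equiv.refl _)

theorem ends_e (φ : W.Iso W') (x : W.H) : φ.ends (W.e x) = W'.e (φ.ends x) := φ.map_e x

end OneMfd.Iso

variable {V₀ V₁ V₂ W₀ W₁ W₂ : OneMfd Z}

theorem bdE_iso (φ₀ : V₀.Iso W₀) (φ₁ : V₁.Iso W₁) (x) :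
    Sum.map φ₀.ends φ₁.ends (bdE V₀ V₁ x) = bdE W₀ W₁ (Sum.map φ₀.ends φ₁.ends x) := by
  rcases x with x | x
  · exact congrArg Sum.inl (φ₀.ends_e x)
  · exact congrArg Sum.inr (φ₁.ends_e x)

theorem bdL_iso (φ₀ : V₀.Iso W₀) (φ₁ : V₁.Iso W₁) (x) :
    Sum.map φ₀.ends φ₁.ends (bdL V₀ V₁ x) = bdL W₀ W₁ (Sum.map φ₀.ends φ₁.ends x) := by
  rcases x with (j | z) | (j | z)
  · exact congrArg (fun j => Sum.inl (Sum.inl j)) (φ₀.map_l j)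
  · rfl
  · exact congrArg (fun j => Sum.inr (Sum.inl j)) (φ₁.map_l j)
  · rfl

/-- The boundary circles under identifications of the boundary. -/
def circIso (φ₀ : V₀.Iso W₀) (φ₁ : V₁.Iso W₁) : BdCirc V₀ V₁ ≃ BdCirc W₀ W₁ :=
  Quot.congr (Equiv.sumCongr φ₀.ends φ₁.ends) fun a b => by
    refine or_congr ?_ ?_
    · rw [← (Equiv.sumCongr φ₀.ends φ₁.ends).injective.eq_iff]
      exact Eq.congr rfl (bdE_iso φ₀ φ₁ a)
    · rw [← (Equiv.sumCongr φ₀.ends φ₁.ends).injective.eq_iff]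
      exact Eq.congr rfl (bdL_iso φ₀ φ₁ a)

namespace Pre

/-- Transport of a surface along identifications of its boundary. -/
def pull (φ₀ : V₀.Iso W₀) (φ₁ : V₁.Iso W₁) (P : Pre W₀ W₁) : Pre V₀ V₁ where
  X := P.X
  r := P.r
  f k := P.f (Sum.map φ₀.ends φ₁.ends k)
  hE k := by rw [bdE_iso]; exact P.hE _
  hL k := by rw [bdL_iso]; exact P.hL _
  w := P.w

theorem pull_surf (φ₀ : V₀.Iso W₀) (φ₁ : V₁.Iso W₁) {P : Pre W₀ W₁} (hP : P.Surf) :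
    (P.pull φ₀ φ₁).Surf := by
  intro c
  obtain ⟨g, hg⟩ := hP c
  refine ⟨g, hg.trans ?_⟩
  have e : cnt P.bd c = cnt (P.pull φ₀ φ₁).bd c :=
    (cnt_congr (circIso φ₀ φ₁) _ _ _ _ fun x => by
      induction x using Quot.ind; exact Iff.rfl).symm
  -- Only `arcs` remains to be compared. It is counted by points of `Z`, which both identifications
  -- leave fixed, so the two counts agree by definition.
  rw [e]
  rfl

/-- Pieces, gluing relation and weights are untouched by `pull`; only the labelling of the pieces by
boundary ends is precomposed with a bijection. -/
theorem Eqv.pull (φ₀ : V₀.Iso W₀) (φ₁ : V₁.Iso W₁) {P P' : Pre W₀ W₁} {g h} (H : Eqv P P' g h) :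
    Eqv (P.pull φ₀ φ₁) (P'.pull φ₀ φ₁) g h :=
  ⟨H.hg, H.hh, H.hgh, H.hhg, fun _ => H.hf _, H.hw⟩

/-- The identification of the middle manifold cancels: both sides glue the same pairs of pieces,
indexed once by the ends of `V₁` and once by those of `W₁`, and `φ₁.ends` is onto. -/
theorem pull_comp (φ₀ : V₀.Iso W₀) (φ₁ : V₁.Iso W₁) (φ₂ : V₂.Iso W₂) (P : Pre W₀ W₁)
    (Q : Pre W₁ W₂) :
    Eqv ((P.pull φ₀ φ₁).comp (Q.pull φ₁ φ₂)) ((P.comp Q).pull φ₀ φ₂) id id := by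
  refine Eqv.ofEquiv (P := (P.pull φ₀ φ₁).comp (Q.pull φ₁ φ₂)) (P' := (P.comp Q).pull φ₀ φ₂)
    (Equiv.refl (P.X ⊕ Q.X)) ?_ ?_ ?_ (fun _ => rfl)
  · rintro _ _ (r | r | k)
    · exact Quot.sound (.left r)
    · exact Quot.sound (.right r)
    · exact Quot.sound (.mid (φ₁.ends k))
  · rintro _ _ (r | r | k)
    · exact Quot.sound (.left r)
    · exact Quot.sound (.right r)
    · obtain ⟨k, rfl⟩ := φ₁.ends.surjective k
      exact glue_mid (P.pull φ₀ φ₁) (Q.pull φ₁ φ₂) k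
  · rintro (k | k) <;> rfl

/-- The pieces of a trivial bordism are the ends of the manifold itself, so the renaming of ends is
at the same time the bijection between the pieces of the two surfaces. -/
theorem pull_one (φ : V₀.Iso W₀) : Eqv ((Pre.one W₀).pull φ φ) (Pre.one V₀) φ.ends.symm φ.ends := by
  refine Eqv.ofEquiv (P := (Pre.one W₀).pull φ φ) (P' := Pre.one V₀) φ.ends.symm ?_ ?_ ?_
    (fun _ => rfl)
  · rintro x _ (_ | j)
    · obtain ⟨x, rfl⟩ := φ.ends.surjective x
      rw [← φ.ends_e]
      refine (congrArg (Quot.mk _) (φ.ends.symm_apply_apply x)).trans (Eq.trans ?_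
        (congrArg (Quot.mk _) (φ.ends.symm_apply_apply (V₀.e x))).symm)
      exact (V₀.mk_e x).symm
    · obtain ⟨j, rfl⟩ := φ.toEquiv.surjective j
      rw [← φ.map_l]
      refine (congrArg (Quot.mk _) (φ.ends.symm_apply_apply (.inl j))).trans (Eq.trans ?_
        (congrArg (Quot.mk _) (φ.ends.symm_apply_apply (.inl (V₀.l j)))).symm)
      exact (V₀.mk_l j).symm
  · rintro x _ (_ | j)
    · exact ((W₀.mk_e (φ.ends x)).symm).trans (congrArg (Quot.mk W₀.Rel) (φ.ends_e x)).symm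
    · exact (W₀.mk_l (φ.toEquiv j)).symm.trans
        (congrArg (fun j => Quot.mk W₀.Rel (.inl j)) (φ.map_l j)).symm
  · rintro (k | k) <;> exact φ.ends.symm_apply_apply k

theorem pull_refl (P : Pre W₀ W₁) :
    Eqv (P.pull (.refl W₀) (.refl W₁)) P id id := by
  refine Eqv.ofEquiv (P := P.pull (.refl W₀) (.refl W₁)) (P' := P) (Equiv.refl P.X)
    (fun x y r => Quot.sound r) (fun x y r => Quot.sound r) ?_ (fun _ => rfl)
  rintro ((k | k) | (k | k)) <;> rfl

end Pre

namespace BHom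

/-- Transport of a bordism along identifications of its boundary. -/
noncomputable def pull (φ₀ : V₀.Iso W₀) (φ₁ : V₁.Iso W₁) (a : BHom W₀ W₁) : BHom V₀ V₁ :=
  (a.rep.pull φ₀ φ₁).cls (Pre.pull_surf φ₀ φ₁ a.rep_surf)

/-- Independence of the representative chosen in the definition of `BHom.pull`. -/
theorem pull_cls (φ₀ : V₀.Iso W₀) (φ₁ : V₁.Iso W₁) {P : Pre W₀ W₁} (hP : P.Surf) :
    pull φ₀ φ₁ (P.cls hP) = (P.pull φ₀ φ₁).cls (Pre.pull_surf φ₀ φ₁ hP) := by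
  obtain ⟨g, h, H⟩ := Pre.exists_eqv (rep_surf (P.cls hP)) hP (rep_cls _)
  exact (H.pull φ₀ φ₁).cls _ _

theorem pull_comp (φ₀ : V₀.Iso W₀) (φ₁ : V₁.Iso W₁) (φ₂ : V₂.Iso W₂) (a : BHom W₀ W₁)
    (b : BHom W₁ W₂) : (a.pull φ₀ φ₁).comp (b.pull φ₁ φ₂) = (a.comp b).pull φ₀ φ₂ := by
  obtain ⟨P, hP, rfl⟩ := a.exists_pre
  obtain ⟨Q, hQ, rfl⟩ := b.exists_pre
  rw [pull_cls, pull_cls, comp_cls, comp_cls, pull_cls]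
  exact (Pre.pull_comp φ₀ φ₁ φ₂ P Q).cls _ _

theorem pull_one (φ : V₀.Iso W₀) : (one W₀).pull φ φ = one V₀ := by
  rw [one, pull_cls]
  exact (Pre.pull_one φ).cls _ _

theorem pull_refl (a : BHom W₀ W₁) : a.pull (.refl W₀) (.refl W₁) = a := by
  obtain ⟨P, hP, rfl⟩ := a.exists_pre
  rw [pull_cls]
  exact (Pre.pull_refl P).cls _ _

/-- The mapping cylinder of an identification. -/
noncomputable def cyl (φ : V₀.Iso W₀) : BHom V₀ W₀ := (one W₀).pull φ (.refl W₀)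

/-- The inverse of the mapping cylinder of an identification. -/
noncomputable def cylInv (φ : V₀.Iso W₀) : BHom W₀ V₀ := (one W₀).pull (.refl W₀) φ

/-- Both cylinders are transported copies of `one W₀`. By `pull_comp` the middle identification
drops out, and what is left is `one W₀` transported by `φ` on both sides. In `cylInv_cyl` the
trivial identification is left on both sides instead. -/
theorem cyl_cylInv (φ : V₀.Iso W₀) : (cyl φ).comp (cylInv φ) = one V₀ := by
  rw [cyl, cylInv, pull_comp, one_comp, pull_one]

theorem cylInv_cyl (φ : V₀.Iso W₀) : (cylInv φ).comp (cyl φ) = one W₀ := by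
  rw [cyl, cylInv, pull_comp, one_comp, pull_refl]

/-- Transport is conjugation by cylinders, as both sides are `a` transported by `φ₀` at its source
only. This turns a diffeomorphism onto a transported surface into a commuting square of morphisms.
-/
theorem pull_cyl (φ₀ : V₀.Iso W₀) (φ₁ : V₁.Iso W₁) (a : BHom W₀ W₁) :
    (a.pull φ₀ φ₁).comp (cyl φ₁) = (cyl φ₀).comp a := by
  rw [cyl, pull_comp, comp_one, cyl]
  -- `pull_comp` needs both factors in transported form, with the same identification, here the
  -- trivial one of `W₀`, in the middle.
  conv_rhs => rw [← pull_refl a]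
  rw [pull_comp, one_comp]

end BHom

end

/-! ### Smoothings and saddle surfaces of a glued diagram. -/

namespace Frame
variable {Z : Signed} (F : Frame Z)

/-- A saddle bordism without saddles is a trivial bordism. -/
theorem saddle_self (σ : F.N → Bool) :
    (F.saddle σ σ).cls (F.saddle_surf σ σ) = BHom.one (F.smooth σ) := by
  refine (Pre.Eqv.ofEquiv (P := F.saddle σ σ) (P' := Pre.one (F.smooth σ)) (Equiv.refl F.H)
    ?_ ?_ (fun _ => rfl) ?_).cls _ _
  · rintro x _ (_ | j | j)
    · exact ((F.smooth σ).mk_e x).symm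
    · exact ((F.smooth σ).mk_l j).symm
    · exact ((F.smooth σ).mk_l j).symm
  · rintro x _ (_ | j)
    · exact (F.mk_e σ σ x).symm
    · exact (F.mk_l σ σ j).symm
  · rintro ((⟨n, i⟩ | m) | z)
    · exact if_neg fun h => h.2 rfl
    · rfl
    · rfl

end Frame

namespace Coloring
variable {Z₁ Z₂ Z' : Signed} (s : Sew Z₁ Z₂ Z') {D₁ : SDiagram Z₁.pt} {D₂ : SDiagram Z₂.pt}
  (χ : Coloring Z' (SDiagram.glue s.toGlue D₁ D₂))
  (h₁ : ∀ z, χ.pieces (.inl (.inr z)) = Z₁.pos z)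
  (h₂ : ∀ z, χ.pieces (.inr (.inr z)) = Z₂.pos z)

/-- The ends at the vertices of a glued diagram, as the ends of a glued `1`-manifold. -/
def gluedJ (g : Glue Z₁.pt Z₂.pt Z'.pt) (D₁ : SDiagram Z₁.pt) (D₂ : SDiagram Z₂.pt) :
    (SDiagram.glue g D₁ D₂).J ≃ (D₁.J ⊕ D₂.J) ⊕ (g.Y ⊕ g.Y) where
  toFun
    | .inl (.inl n, i) => .inl (.inl (.inl (n, i)))
    | .inl (.inr n, i) => .inl (.inr (.inl (n, i)))
    | .inr (.inl (.inl m), b) => .inl (.inl (.inr (m, b)))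
    | .inr (.inl (.inr m), b) => .inl (.inr (.inr (m, b)))
    | .inr (.inr y, false) => .inr (.inl y)
    | .inr (.inr y, true) => .inr (.inr y)
  invFun
    | .inl (.inl (.inl (n, i))) => .inl (.inl n, i)
    | .inl (.inr (.inl (n, i))) => .inl (.inr n, i)
    | .inl (.inl (.inr (m, b))) => .inr (.inl (.inl m), b)
    | .inl (.inr (.inr (m, b))) => .inr (.inl (.inr m), b)
    | .inr (.inl y) => .inr (.inr y, false)
    | .inr (.inr y) => .inr (.inr y, true)
  left_inv := by rintro (⟨n | n, i⟩ | ⟨(m | m) | y, _ | _⟩) <;> rfl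
  right_inv := by rintro (((⟨n, i⟩ | ⟨m, b⟩) | (⟨n, i⟩ | ⟨m, b⟩)) | (y | y)) <;> rfl

/-- A glued pair of boundary points `y` is a marking point with ends `(y, false)`, `(y, true)` in
the diagram, and a pair of cut ends in the glued `1`-manifold. Up to this renaming the two
constructions enumerate the ends of the pieces in the same way, so facts about `Glue.ends` apply to
diagrams. -/
theorem gluedEnds_eq (g : Glue Z₁.pt Z₂.pt Z'.pt) (x) : SDiagram.gluedEnds g D₁ D₂ x
    = g.ends D₁.J D₂.J (Sum.map (gluedJ g D₁ D₂) id x) := by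
  rcases x with (⟨n | n, i⟩ | ⟨(m | m) | y, _ | _⟩) | z <;> rfl

/-- Gluing merges no edges, since a glued pair becomes a marking point between two of them; every
edge of the glued diagram is an edge of one piece. -/
theorem glue_e (g : Glue Z₁.pt Z₂.pt Z'.pt) (x) :
    SDiagram.gluedEnds g D₁ D₂ ((SDiagram.glue g D₁ D₂).e x)
      = Sum.map D₁.e D₂.e (SDiagram.gluedEnds g D₁ D₂ x) :=
  Equiv.apply_symm_apply _ _

/-- A smoothing of a glued diagram is glued from smoothings of the pieces. -/
def smoothIso {σ : D₁.N ⊕ D₂.N → Bool} {σ₁ : D₁.N → Bool} {σ₂ : D₂.N → Bool}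
    (e₁ : ∀ n, σ (.inl n) = σ₁ n) (e₂ : ∀ n, σ (.inr n) = σ₂ n) :
    OneMfd.Iso (χ.frame.smooth σ)
      (s.mfd ((χ.fst h₁).frame.smooth σ₁) ((χ.snd h₂).frame.smooth σ₂)) where
  toEquiv := gluedJ s.toGlue D₁ D₂
  map_e x := by
    -- Both edge involutions are conjugates of the involution `Sum.map D₁.e D₂.e`, so they are
    -- compared at the ends of the pieces.
    refine (s.ends D₁.J D₂.J).injective ?_
    refine (gluedEnds_eq s.toGlue _).symm.trans ((glue_e s.toGlue x).trans ?_)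
    refine (congrArg _ (gluedEnds_eq s.toGlue x)).trans ?_
    exact (s.ends_e ((χ.fst h₁).frame.smooth σ₁) ((χ.snd h₂).frame.smooth σ₂) _).symm
  map_l := by
    -- The smoothing matters only at the 4-valent vertices. At marking points, old or arising from a
    -- glued pair, both sides interchange the two ends by definition.
    rintro (⟨n | n, i⟩ | ⟨(m | m) | y, _ | _⟩)
    · exact congrArg (fun b => Sum.inl (Sum.inl (Sum.inl (n, pairing b i)))) (e₁ n)
    · exact congrArg (fun b => Sum.inl (Sum.inr (Sum.inl (n, pairing b i)))) (e₂ n)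
    all_goals rfl
  map_o j := by
    -- Both orientations are read off the one colouring of the whole. At the boundary points of the
    -- pieces, where the orientation is prescribed by `Z₁` and `Z₂`, this is what `h₁` and `h₂` say.
    have key : ∀ x, Sum.elim ((χ.fst h₁).frame.smooth σ₁).dir ((χ.snd h₂).frame.smooth σ₂).dir x
        = χ.pieces x := by
      rintro ((j | z) | (j | z))
      · rfl
      · exact (h₁ z).symm
      · rfl
      · exact (h₂ z).symm
    refine (key _).trans ?_
    refine (congrArg χ.pieces (gluedEnds_eq s.toGlue (.inl j)).symm).trans ?_
    exact congrArg (Sum.elim χ.o Z'.pos) (Equiv.symm_apply_apply _ _)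

section
variable {σ τ : D₁.N ⊕ D₂.N → Bool} {σ₁ τ₁ : D₁.N → Bool} {σ₂ τ₂ : D₂.N → Bool}
  (e₁ : ∀ n, σ (.inl n) = σ₁ n) (e₂ : ∀ n, σ (.inr n) = σ₂ n)
  (e₁' : ∀ n, τ (.inl n) = τ₁ n) (e₂' : ∀ n, τ (.inr n) = τ₂ n)

/-- The saddles of a glued diagram are sewn from saddles of the pieces. -/
theorem saddle_glue : Pre.Eqv (χ.frame.saddle σ τ)
    ((s.pre ((χ.fst h₁).frame.saddle σ₁ τ₁) ((χ.snd h₂).frame.saddle σ₂ τ₂)).pull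
      (χ.smoothIso s h₁ h₂ e₁ e₂) (χ.smoothIso s h₁ h₂ e₁' e₂'))
    (SDiagram.gluedEnds s.toGlue D₁ D₂) (SDiagram.gluedEnds s.toGlue D₁ D₂).symm := by
  set F := χ.frame
  set F₁ := (χ.fst h₁).frame
  set F₂ := (χ.snd h₂).frame
  set P := F₁.saddle σ₁ τ₁
  set Q := F₂.saddle σ₂ τ₂
  -- The pieces of a saddle surface are the ends of the diagram, so the piece at a boundary point is
  -- that point.
  have pz : ∀ z, Sew.ptZ P Q z = Sum.map .inr .inr z := by rintro (z | z) <;> rfl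
  -- A glued or remaining boundary point, regarded as an end of the glued diagram, corresponds to
  -- the piece of the sewn surface at that point. With this, the joining at a new marking point can
  -- be matched with the relation `mid` of the sewing.
  have back : ∀ p, SDiagram.gluedEnds s.toGlue D₁ D₂
      (Sum.map (gluedJ s.toGlue D₁ D₂).symm id (s.back _ p)) = Sew.ptZ P Q (s.eqv.symm p) := by
    intro p
    rw [gluedEnds_eq, pz]
    refine Eq.trans (congrArg _ ?_) (s.ends_back D₁.J D₂.J p)
    rcases p with (p | p) | p <;> rfl
  refine Pre.Eqv.ofEquiv (P := F.saddle σ τ) (P' := (s.pre P Q).pull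
      (χ.smoothIso s h₁ h₂ e₁ e₂) (χ.smoothIso s h₁ h₂ e₁' e₂'))
    (SDiagram.gluedEnds s.toGlue D₁ D₂) ?_ ?_ ?_ ?_
  -- The surface identifies ends joined in either of the smoothings `σ` and `τ`. Both cases are
  -- treated at once for a smoothing `ρ` whose restrictions respect the identifications in `P` and
  -- `Q`.
  · have hj : ∀ (ρ : D₁.N ⊕ D₂.N → Bool) (ρ₁ : D₁.N → Bool) (ρ₂ : D₂.N → Bool)
        (_ : ∀ n, ρ (.inl n) = ρ₁ n) (_ : ∀ n, ρ (.inr n) = ρ₂ n)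
        (_ : ∀ j, Quot.mk P.r (.inl (F₁.join ρ₁ j)) = Quot.mk P.r (.inl j))
        (_ : ∀ j, Quot.mk Q.r (.inl (F₂.join ρ₂ j)) = Quot.mk Q.r (.inl j)) (j : F.J),
        Quot.mk (s.Rel P Q) (SDiagram.gluedEnds s.toGlue D₁ D₂ (.inl j))
          = Quot.mk (s.Rel P Q) (SDiagram.gluedEnds s.toGlue D₁ D₂ (.inl (F.join ρ j))) := by
      rintro ρ ρ₁ ρ₂ r₁ r₂ hP hQ (⟨n | n, i⟩ | ⟨(m | m) | y, b⟩)
      · refine (s.rel_left P Q (hP (.inl (n, i)))).symm.trans ?_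
        exact congrArg (fun b => Quot.mk (s.Rel P Q) (.inl (.inl (.inl (n, pairing b i))))) (r₁ n).symm
      · refine (s.rel_right P Q (hQ (.inl (n, i)))).symm.trans ?_
        exact congrArg (fun b => Quot.mk (s.Rel P Q) (.inr (.inl (.inl (n, pairing b i))))) (r₂ n).symm
      · exact (s.rel_left P Q (hP (.inr (m, b)))).symm
      · exact (s.rel_right P Q (hQ (.inr (m, b)))).symm
      -- At a marking point coming from a glued pair the two ends are identified by the sewing, not
      -- by a relation inside one of the pieces.
      · have b0 := congrArg (Quot.mk (s.Rel P Q)) (back (.inl (.inl y)))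
        have b1 := congrArg (Quot.mk (s.Rel P Q)) (back (.inl (.inr y)))
        cases b
        · exact b0.trans ((s.rel_mid P Q y).trans b1.symm)
        · exact b1.trans ((s.rel_mid P Q y).symm.trans b0.symm)
    have he : ∀ x, Quot.mk (s.Rel P Q) (Sum.map D₁.e D₂.e x) = Quot.mk (s.Rel P Q) x := by
      rintro (x | x)
      · exact s.rel_left P Q (F₁.mk_e σ₁ τ₁ x)
      · exact s.rel_right P Q (F₂.mk_e σ₂ τ₂ x)
    rintro x _ (_ | j | j)
    · exact (he _).symm.trans (congrArg (Quot.mk (s.Rel P Q)) (glue_e s.toGlue x)).symm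
    · exact hj σ σ₁ σ₂ e₁ e₂ (F₁.mk_l σ₁ τ₁) (F₂.mk_l σ₂ τ₂) j
    · exact hj τ τ₁ τ₂ e₁' e₂' (F₁.mk_l' σ₁ τ₁) (F₂.mk_l' σ₂ τ₂) j
  -- Conversely, each identification inside a piece and each sewn pair holds already in the saddle
  -- surface of the glued diagram.
  · have sy : ∀ x, (SDiagram.gluedEnds s.toGlue D₁ D₂).symm
        (SDiagram.gluedEnds s.toGlue D₁ D₂ x) = x := Equiv.symm_apply_apply _
    have he : ∀ x, Quot.mk (F.Rel σ τ) ((SDiagram.gluedEnds s.toGlue D₁ D₂).symm x)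
        = Quot.mk (F.Rel σ τ) ((SDiagram.gluedEnds s.toGlue D₁ D₂).symm (Sum.map D₁.e D₂.e x)) := by
      intro x
      refine (F.mk_e σ τ _).symm.trans (congrArg (Quot.mk (F.Rel σ τ)) ?_)
      refine (Equiv.eq_symm_apply _).2 ?_
      exact (glue_e s.toGlue _).trans (congrArg _ (Equiv.apply_symm_apply _ _))
    rintro _ _ ((x | j | j) | (x | j | j) | y)
    · exact he (.inl _)
    · rcases j with ⟨n, i⟩ | ⟨m, b⟩
      · refine (F.mk_l σ τ (.inl (.inl n, i))).symm.trans ?_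
        exact congrArg (fun b => Quot.mk (F.Rel σ τ) (.inl (.inl (.inl n, pairing b i)))) (e₁ n)
      · exact (F.mk_l σ τ (.inr (.inl (.inl m), b))).symm
    · rcases j with ⟨n, i⟩ | ⟨m, b⟩
      · refine (F.mk_l' σ τ (.inl (.inl n, i))).symm.trans ?_
        exact congrArg (fun b => Quot.mk (F.Rel σ τ) (.inl (.inl (.inl n, pairing b i)))) (e₁' n)
      · exact (F.mk_l' σ τ (.inr (.inl (.inl m), b))).symm
    · exact he (.inr _)
    · rcases j with ⟨n, i⟩ | ⟨m, b⟩
      · refine (F.mk_l σ τ (.inl (.inr n, i))).symm.trans ?_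
        exact congrArg (fun b => Quot.mk (F.Rel σ τ) (.inl (.inl (.inr n, pairing b i)))) (e₂ n)
      · exact (F.mk_l σ τ (.inr (.inl (.inr m), b))).symm
    · rcases j with ⟨n, i⟩ | ⟨m, b⟩
      · refine (F.mk_l' σ τ (.inl (.inr n, i))).symm.trans ?_
        exact congrArg (fun b => Quot.mk (F.Rel σ τ) (.inl (.inl (.inr n, pairing b i)))) (e₂' n)
      · exact (F.mk_l' σ τ (.inr (.inl (.inr m), b))).symm
    -- A sewn pair `y` is the pair of ends of the marking point `y`, and these are joined in every
    -- smoothing.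
    · have b0 := (congrArg (SDiagram.gluedEnds s.toGlue D₁ D₂).symm (back (.inl (.inl y)))).symm.trans
        (sy _)
      have b1 := (congrArg (SDiagram.gluedEnds s.toGlue D₁ D₂).symm (back (.inl (.inr y)))).symm.trans
        (sy _)
      refine (congrArg (Quot.mk (F.Rel σ τ)) b0).trans (Eq.trans ?_
        (congrArg (Quot.mk (F.Rel σ τ)) b1).symm)
      exact (F.mk_l σ τ (.inr (.inr y, false))).symm
  -- In a saddle surface the source and the target copy of an end lie on the piece named by that
  -- end, so the labellings agree on both parts of the boundary.
  · have kl : ∀ y : F₁.H ⊕ F₂.H, y = Sum.map P.f Q.f (Sum.map .inl .inl y) := by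
      rintro (y | y) <;> rfl
    have kr : ∀ y : F₁.H ⊕ F₂.H, y = Sum.map P.f Q.f (Sum.map .inr .inr y) := by
      rintro (y | y) <;> rfl
    rintro (x | x)
    · refine (gluedEnds_eq s.toGlue x).trans ((kl _).trans ?_)
      exact congrArg (Sum.map P.f Q.f) (s.spread_inl _).symm
    · refine (gluedEnds_eq s.toGlue x).trans ((kr _).trans ?_)
      exact congrArg (Sum.map P.f Q.f) (s.spread_inr _).symm
  -- The weights agree end by end: a saddle contributes only at the end `0` of its vertex, and all
  -- ends at marking points and boundary points, in particular at the glued points, have weight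
  -- zero.
  · rintro ((⟨n | n, i⟩ | ⟨(m | m) | y, _ | _⟩) | z)
    · show F.wt σ τ (.inl (.inl (.inl n, i))) = F₁.wt σ₁ τ₁ (.inl (.inl (n, i)))
      simp only [Frame.wt]
      rw [e₁, e₁']
    · show F.wt σ τ (.inl (.inl (.inr n, i))) = F₂.wt σ₂ τ₂ (.inl (.inl (n, i)))
      simp only [Frame.wt]
      rw [e₂, e₂']
    · rfl
    · rfl
    · rfl
    · rfl
    · have : ∀ x : Z₁.pt ⊕ Z₂.pt, (0 : ℤ) = (s.pre P Q).w (Sum.map .inr .inr x) := by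
        rintro (x | x) <;> rfl
      exact this _
    · have : ∀ x : Z₁.pt ⊕ Z₂.pt, (0 : ℤ) = (s.pre P Q).w (Sum.map .inr .inr x) := by
        rintro (x | x) <;> rfl
      exact this _
    · have : ∀ x : Z₁.pt ⊕ Z₂.pt, (0 : ℤ) = (s.pre P Q).w (Sum.map .inr .inr x) := by
        rintro (x | x) <;> rfl
      exact this _

end
end Coloring

/-! ### Isomorphisms of finite complexes -/

namespace FinCx
open CategoryTheory
variable {C : Type*} [Category C] [Preadditive C]

theorem one_self (K : FinCx C) (i : K.idx) : K.one i i = 𝟙 _ := by simp [one]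

theorem one_of_ne (K : FinCx C) {i j : K.idx} (h : i ≠ j) : K.one i j = 0 := dif_neg h

/-- Matrix products in `toCochain` run over the summands of a single degree. Extended by vanishing
terms to all indices, such sums can be evaluated by `sum_one_comp` and `sum_comp_one`. -/
theorem sum_deg (K : FinCx C) {A B : C} (n : ℤ) (f : ∀ x, A ⟶ K.obj x) (g : ∀ x, K.obj x ⟶ B)
    (h : ∀ x, K.deg x ≠ n → f x ≫ g x = 0) :
    ∑ x : {x // K.deg x = n}, f x.1 ≫ g x.1 = ∑ x, f x ≫ g x := by
  refine (Finset.sum_subtype (Finset.univ.filter fun x => K.deg x = n) (by simp)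
    (fun x => f x ≫ g x)).symm.trans ?_
  exact Finset.sum_subset (Finset.filter_subset _ _) fun x _ hx => h x (by simpa using hx)

variable {K L : FinCx C} (φ : K.idx ≃ L.idx) (hdeg : ∀ i, L.deg (φ i) = K.deg i)
  (u : ∀ i, K.obj i ≅ L.obj (φ i))

include hdeg in
theorem hom_one_deg (i j) (h : L.deg j ≠ K.deg i) : L.one (φ i) j = 0 :=
  L.one_of_ne fun e => h (by rw [← e, hdeg])

/-- The isomorphism between the terms of two complexes induced by isomorphisms of the summands. -/
noncomputable def termIso (hdeg : ∀ i, L.deg (φ i) = K.deg i) (n : ℤ) :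
    K.toCochain.X n ≅ L.toCochain.X n where
  -- `L.one (φ i) j` is the entry of the permutation matrix of `φ`; it replaces a transport along an
  -- equation `φ i = j`.
  hom := fun i j => (u i.1).hom ≫ L.one (φ i.1) j.1
  inv := fun j i => L.one j.1 (φ i.1) ≫ (u i.1).inv
  hom_inv_id := by
    refine DMatrix.ext fun i i' => ?_
    refine (L.sum_deg n (fun j => (u i.1).hom ≫ L.one (φ i.1) j)
      (fun j => L.one j (φ i'.1) ≫ (u i'.1).inv) ?_).trans ?_
    · intro j hj
      rw [hom_one_deg φ hdeg i.1 j (by rwa [i.2])]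
      simp
    · simp only [Category.assoc, ← Preadditive.comp_sum]
      rw [L.sum_one_comp (φ i.1) (fun j => L.one j (φ i'.1) ≫ (u i'.1).inv)]
      by_cases h : i = i'
      · subst h
        rw [one_self, Category.id_comp, Iso.hom_inv_id]
        exact (Mat_.id_apply_self (K.toCochain.X n) i).symm
      -- Injectivity of `φ` makes the off-diagonal entries vanish.
      · have h' : φ i.1 ≠ φ i'.1 := fun e => h (Subtype.ext (φ.injective e))
        rw [one_of_ne _ h', Limits.zero_comp, Limits.comp_zero]
        exact (Mat_.id_apply_of_ne (K.toCochain.X n) i i' h).symm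
  inv_hom_id := by
    refine DMatrix.ext fun j j' => ?_
    refine (K.sum_deg n (fun i => L.one j.1 (φ i) ≫ (u i).inv)
      (fun i => (u i).hom ≫ L.one (φ i) j'.1) ?_).trans ?_
    · intro i hi
      rw [hom_one_deg φ hdeg i j'.1 (by rw [j'.2]; exact hi.symm)]
      simp
    · simp only [Category.assoc, Iso.inv_hom_id_assoc]
      -- In this order the sum runs over `K.idx`; since `φ` is a bijection it is a sum over all of
      -- `L.idx`, so it collapses.
      refine (Equiv.sum_comp φ fun x => L.one j.1 x ≫ L.one x j'.1).trans ?_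
      rw [L.sum_one_comp j.1 (fun x => L.one x j'.1)]
      by_cases h : j = j'
      · subst h
        rw [one_self]
        exact (Mat_.id_apply_self (L.toCochain.X n) j).symm
      · rw [one_of_ne _ fun e => h (Subtype.ext e)]
        exact (Mat_.id_apply_of_ne (L.toCochain.X n) j j' h).symm

/-- Isomorphisms of the summands that are compatible with the entries of the differentials give an
isomorphism of complexes. -/
noncomputable def toCochainIso (hdeg : ∀ i, L.deg (φ i) = K.deg i)
    (hd : ∀ i j, K.d i j ≫ (u j).hom = (u i).hom ≫ L.d (φ i) (φ j)) :
    K.toCochain ≅ L.toCochain :=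
  HomologicalComplex.Hom.isoOfComponents (termIso φ u hdeg) fun n m _ => by
    refine DMatrix.ext fun i j => ?_
    have e1 := L.sum_deg n (fun x => (u i.1).hom ≫ L.one (φ i.1) x) (fun x => L.d x j.1) (by
      intro x hx
      rw [hom_one_deg φ hdeg i.1 x (by rwa [i.2])]
      simp)
    have e2 := K.sum_deg m (fun x => K.d i.1 x) (fun x => (u x).hom ≫ L.one (φ x) j.1) (by
      intro x hx
      rw [hom_one_deg φ hdeg x j.1 (by rw [j.2]; exact hx.symm)]
      simp)
    refine e1.trans (Eq.trans ?_ e2.symm)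
    simp only [Category.assoc, ← Preadditive.comp_sum]
    rw [L.sum_one_comp (φ i.1) (fun x => L.d x j.1)]
    -- The isomorphism at the target summand is moved past each entry of the differential, which
    -- leaves the common factor `(u i).hom` on both sides.
    simp only [reassoc_of% hd, ← Preadditive.comp_sum]
    congr 1
    refine Eq.trans ?_ (Equiv.sum_comp φ fun x => L.d (φ i.1) x ≫ L.one x j.1).symm
    exact (L.sum_comp_one j.1 (fun x => L.d (φ i.1) x)).symm

end FinCx

/-! ### Change of the ordering -/

namespace Frame
variable {Z : Signed} (F : Frame Z)

open scoped Classical in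
/-- The sign of the permutation of the elements of `s` between the orderings `ν` and `ν'`. -/
noncomputable def reorder (ν ν' : F.N → ℕ) (s : Finset F.N) : ℤ :=
  ∏ a ∈ s, ∏ b ∈ s, if ν a < ν b ∧ ν' b < ν' a then -1 else 1

-- In product form the sign is multiplicative over the elements of the state, so it splits under
-- insertion of an element and over disjoint unions.
open scoped Classical in
theorem sgn_eq_prod (ν : F.N → ℕ) (s : Finset F.N) (a : F.N) :
    F.sgn ν s a = ∏ b ∈ s, if ν b < ν a then -1 else 1 := by
  rw [sgn, Finset.prod_ite, Finset.prod_const, Finset.prod_const_one, mul_one]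

theorem sgn_mul_self (ν : F.N → ℕ) (s : Finset F.N) (a : F.N) :
    F.sgn ν s a * F.sgn ν s a = 1 := by
  rw [sgn, ← mul_pow]; simp

/-- Every factor is `1` or `-1`. This is what makes rescaling a summand by `reorder` invertible. -/
theorem reorder_mul_self (ν ν' : F.N → ℕ) (s : Finset F.N) :
    F.reorder ν ν' s * F.reorder ν ν' s = 1 := by
  simp only [reorder, ← Finset.prod_mul_distrib]
  refine (Finset.prod_congr rfl fun a _ => Finset.prod_eq_one fun b _ => ?_).trans
    (Finset.prod_const_one (M := ℤ))
  split <;> norm_num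

-- The new inversions are the pairs formed by `a` and an element `b` of `s` for which exactly one of
-- `ν b < ν a` and `ν' b < ν' a` holds. Their parity is that of the sum of the numbers of elements
-- below `a` in the two orderings.
open scoped Classical in
theorem reorder_insert {ν ν' : F.N → ℕ} (hν : ν.Injective) (hν' : ν'.Injective) {s : Finset F.N}
    {a : F.N} (ha : a ∉ s) :
    F.reorder ν ν' (insert a s) = F.reorder ν ν' s * (F.sgn ν s a * F.sgn ν' s a) := by
  rw [reorder, Finset.prod_insert ha]
  simp only [Finset.prod_insert ha, lt_irrefl, false_and, if_false, one_mul]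
  -- The ordered pairs fall into three blocks: first entry `a`, second entry `a`, and both entries
  -- in `s`. The last block is `reorder` of `s`; the first two are combined factor by factor.
  rw [Finset.prod_mul_distrib, ← mul_assoc, ← Finset.prod_mul_distrib, mul_comm,
    sgn_eq_prod, sgn_eq_prod]
  refine congrArg (F.reorder ν ν' s * ·) (Eq.trans ?_ Finset.prod_mul_distrib)
  refine Finset.prod_congr rfl fun b hb => ?_
  have hab : a ≠ b := fun e => ha (e ▸ hb)
  -- Injectivity of the numberings excludes ties, which leaves four cases.
  have h1 := hν.ne hab
  have h2 := hν'.ne hab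
  rcases lt_or_gt_of_ne h1 with h1 | h1 <;> rcases lt_or_gt_of_ne h2 with h2 | h2 <;>
    simp [h1, h2, h1.not_gt, h2.not_gt]

/-- Rescaling the summand of each state by `reorder` converts the signs of `ν` into those of `ν'`. A
saddle enlarges the state by `a`, a genus-one morphism shrinks it by `a`; in both cases
`reorder_insert` compares the two states, and signs being their own inverses takes care of the
direction. -/
theorem reorder_step {ν ν' : F.N → ℕ} (hν : ν.Injective) (hν' : ν'.Injective)
    {sing : F.N → Bool} {p q : F.Cube sing} {a : F.N} (h : p.Step q a) :
    F.sgn ν p.s a * F.reorder ν ν' q.s = F.reorder ν ν' p.s * F.sgn ν' p.s a := by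
  classical
  rcases h with ⟨h1, h2, _⟩ | ⟨h1, h2, _⟩
  · have e : q.s = insert a p.s := by rw [h2]
    rw [e, F.reorder_insert hν hν' h1]
    linear_combination (F.reorder ν ν' p.s * F.sgn ν' p.s a) * F.sgn_mul_self ν p.s a
  · have h3 : a ∉ q.s := by rw [h2]; exact Finset.notMem_erase _ _
    have e : p.s = insert a q.s := by rw [h2, Finset.insert_erase]; exact h1
    -- The strict inequality in the sign excludes `a` itself, so deleting `a` from the state does
    -- not affect its own sign.
    have hs : ∀ μ : F.N → ℕ, F.sgn μ p.s a = F.sgn μ q.s a := by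
      intro μ
      rw [e, sgn_eq_prod, sgn_eq_prod, Finset.prod_insert h3, if_neg (lt_irrefl _), one_mul]
    rw [hs, hs, e, F.reorder_insert hν hν' h3]
    linear_combination (-F.reorder ν ν' q.s * F.sgn ν q.s a) * F.sgn_mul_self ν' q.s a

end Frame

/-- An ordering of a disjoint union in which the first part comes before the second. -/
theorem exists_lex {A B : Type} [Finite A] (ν₁ : A ↪ ℕ) (ν₂ : B ↪ ℕ) : ∃ ν : A ⊕ B ↪ ℕ,
    (∀ a b, ν (.inl a) < ν (.inl b) ↔ ν₁ a < ν₁ b) ∧ (∀ a b, ν (.inr a) < ν (.inr b) ↔ ν₂ a < ν₂ b) ∧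
    ∀ a b, ν (.inl a) < ν (.inr b) := by
  obtain ⟨m, hm⟩ := (Set.finite_range ν₁).bddAbove
  have hm' : ∀ a, ν₁ a ≤ m := fun a => hm ⟨a, rfl⟩
  -- `m` bounds `ν₁` by finiteness of the first part; the shift by `m + 1` puts the whole second
  -- part strictly above it.
  refine ⟨⟨Sum.elim ν₁ fun b => m + 1 + ν₂ b, ?_⟩, ?_, ?_, ?_⟩
  · rintro (a | a) (b | b) h
    · exact congrArg _ (ν₁.injective h)
    · have := hm' a
      simp only [Sum.elim_inl, Sum.elim_inr] at h
      omega
    · have := hm' b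
      simp only [Sum.elim_inl, Sum.elim_inr] at h
      omega
    · exact congrArg _ (ν₂.injective (Nat.add_left_cancel h))
  · exact fun a b => Iff.rfl
  · exact fun a b => Nat.add_lt_add_iff_left
  · intro a b
    have := hm' a
    show ν₁ a < m + 1 + ν₂ b
    omega

/-! ### The bracket complex of a glued diagram -/

theorem LHom.sub_comp {k : Type*} [CommRing k] {Z : Signed} {W₀ W₁ W₂ : OneMfd Z}
    (a a' : LHom k W₀ W₁) (b : LHom k W₁ W₂) :
    LHom.comp (a - a') b = LHom.comp a b - LHom.comp a' b := by
  rw [map_sub, LinearMap.sub_apply]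

theorem Sew.lhom_sub_left {k : Type*} [CommRing k] {Z₁ Z₂ Z' : Signed} (s : Sew Z₁ Z₂ Z')
    {W₁ W₁' : OneMfd Z₁} {W₂ W₂' : OneMfd Z₂} (x y : LHom k W₁ W₁') (z : LHom k W₂ W₂') :
    s.lhom (x - y) z = s.lhom x z - s.lhom y z := by
  rw [map_sub, LinearMap.sub_apply]

namespace Coloring
open CategoryTheory
variable {Z₁ Z₂ Z' : Signed} (s : Sew Z₁ Z₂ Z') {D₁ : SDiagram Z₁.pt} {D₂ : SDiagram Z₂.pt}
  (χ : Coloring Z' (SDiagram.glue s.toGlue D₁ D₂))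
  (h₁ : ∀ z, χ.pieces (.inl (.inr z)) = Z₁.pos z)
  (h₂ : ∀ z, χ.pieces (.inr (.inr z)) = Z₂.pos z)

section
variable (k : Type*) [CommRing k]
  {σ τ : D₁.N ⊕ D₂.N → Bool} {σ₁ τ₁ : D₁.N → Bool} {σ₂ τ₂ : D₂.N → Bool}
  (e₁ : ∀ n, σ (.inl n) = σ₁ n) (e₂ : ∀ n, σ (.inr n) = σ₂ n)
  (e₁' : ∀ n, τ (.inl n) = τ₁ n) (e₂' : ∀ n, τ (.inr n) = τ₂ n)

/-- The identification of a smoothing of a glued diagram with the glued smoothings, as a morphism. -/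
noncomputable def cylHom : LHom k (χ.frame.smooth σ)
    (s.mfd ((χ.fst h₁).frame.smooth σ₁) ((χ.snd h₂).frame.smooth σ₂)) :=
  LHom.of k (BHom.cyl (χ.smoothIso s h₁ h₂ e₁ e₂))

/-- The passage from surfaces to morphisms: by `BHom.pull_cyl`, a surface equivalent to a
transported one gives a square with the cylinders of the identifications as vertical arrows. -/
theorem cyl_of {P : Pre (χ.frame.smooth σ) (χ.frame.smooth τ)}
    {Q : Pre (s.mfd ((χ.fst h₁).frame.smooth σ₁) ((χ.snd h₂).frame.smooth σ₂))
      (s.mfd ((χ.fst h₁).frame.smooth τ₁) ((χ.snd h₂).frame.smooth τ₂))} (hP : P.Surf) (hQ : Q.Surf)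
    {g h} (H : Pre.Eqv P (Q.pull (χ.smoothIso s h₁ h₂ e₁ e₂) (χ.smoothIso s h₁ h₂ e₁' e₂')) g h) :
    LHom.comp (LHom.of k (P.cls hP)) (χ.cylHom s h₁ h₂ k e₁' e₂')
      = LHom.comp (χ.cylHom s h₁ h₂ k e₁ e₂) (LHom.of k (Q.cls hQ)) := by
  rw [cylHom, cylHom, LHom.comp_of, LHom.comp_of, ← BHom.pull_cyl, BHom.pull_cls, H.cls hP]

/-- `saddle_glue` on the level of morphisms. The smoothings of both pieces may change here; when one
of them is constant, its saddle morphism is an identity by `Frame.saddle_self`, and this is the case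
that occurs in the differential. -/
theorem sad_glue : LHom.comp (χ.frame.sad k σ τ) (χ.cylHom s h₁ h₂ k e₁' e₂')
    = LHom.comp (χ.cylHom s h₁ h₂ k e₁ e₂)
      (s.lhom ((χ.fst h₁).frame.sad k σ₁ τ₁) ((χ.snd h₂).frame.sad k σ₂ τ₂)) := by
  refine (χ.cyl_of s h₁ h₂ k e₁ e₂ e₁' e₂' _ (s.pre_surf (Frame.saddle_surf _ _ _)
    (Frame.saddle_surf _ _ _)) (χ.saddle_glue s h₁ h₂ e₁ e₂ e₁' e₂')).trans (congrArg _ ?_)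
  exact ((s.lhom_of _ _).trans (congrArg _ (s.hom_cls _ _))).symm

/-- `Pre.Eqv.tube` carries the tube across the equivalence of `saddle_glue`, with its feet moved to
the corresponding ends of the first piece. `Sew.tube_pre` then allows the tube to be attached before
sewing. -/
theorem tub_glue_left (n n' : D₁.N × Fin 4) :
    LHom.comp (χ.frame.tub k σ τ (.inl (.inl (.inl n.1, n.2))) (.inl (.inl (.inl n'.1, n'.2))))
      (χ.cylHom s h₁ h₂ k e₁' e₂')
    = LHom.comp (χ.cylHom s h₁ h₂ k e₁ e₂)
      (s.lhom ((χ.fst h₁).frame.tub k σ₁ τ₁ (.inl (.inl n)) (.inl (.inl n')))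
        ((χ.snd h₂).frame.sad k σ₂ τ₂)) := by
  have hs := s.pre_surf ((χ.fst h₁).frame.saddle_surf σ₁ τ₁) ((χ.snd h₂).frame.saddle_surf σ₂ τ₂)
  refine (χ.cyl_of s h₁ h₂ k e₁ e₂ e₁' e₂' _ (Pre.tube_surf hs _ _)
    ((χ.saddle_glue s h₁ h₂ e₁ e₂ e₁' e₂').tube _ _)).trans (congrArg _ ?_)
  refine ((s.lhom_of _ _).trans (congrArg _ ((s.hom_cls _ _).trans ?_))).symm
  exact (s.tube_pre _ _ _ _).cls _ _

theorem tub_glue_right (n n' : D₂.N × Fin 4) :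
    LHom.comp (χ.frame.tub k σ τ (.inl (.inl (.inr n.1, n.2))) (.inl (.inl (.inr n'.1, n'.2))))
      (χ.cylHom s h₁ h₂ k e₁' e₂')
    = LHom.comp (χ.cylHom s h₁ h₂ k e₁ e₂)
      (s.lhom ((χ.fst h₁).frame.sad k σ₁ τ₁)
        ((χ.snd h₂).frame.tub k σ₂ τ₂ (.inl (.inl n)) (.inl (.inl n')))) := by
  have hs := s.pre_surf ((χ.fst h₁).frame.saddle_surf σ₁ τ₁) ((χ.snd h₂).frame.saddle_surf σ₂ τ₂)
  refine (χ.cyl_of s h₁ h₂ k e₁ e₂ e₁' e₂' _ (Pre.tube_surf hs _ _)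
    ((χ.saddle_glue s h₁ h₂ e₁ e₂ e₁' e₂').tube _ _)).trans (congrArg _ ?_)
  refine ((s.lhom_of _ _).trans (congrArg _ ((s.hom_cls _ _).trans ?_))).symm
  exact (s.pre_tube _ _ _ _).cls _ _

/-- The tube and the handle of the genus-one morphism both have their feet at ends of the vertex
`b`, hence in one piece; the claim is the difference of two instances of `tub_glue_left`. -/
theorem genusOne_glue_left (b : D₁.N) :
    LHom.comp (χ.frame.genusOne k σ τ (.inl b)) (χ.cylHom s h₁ h₂ k e₁' e₂')
    = LHom.comp (χ.cylHom s h₁ h₂ k e₁ e₂)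
      (s.lhom ((χ.fst h₁).frame.genusOne k σ₁ τ₁ b) ((χ.snd h₂).frame.sad k σ₂ τ₂)) := by
  refine (LHom.sub_comp _ _ _).trans (Eq.trans ?_ (congrArg _ (s.lhom_sub_left _ _ _)).symm)
  refine Eq.trans ?_ (map_sub _ _ _).symm
  exact congrArg₂ (· - ·) (χ.tub_glue_left s h₁ h₂ k e₁ e₂ e₁' e₂' (b, 0) (b, 1))
    (χ.tub_glue_left s h₁ h₂ k e₁ e₂ e₁' e₂' (b, 0) (b, 0))

theorem genusOne_glue_right (b : D₂.N) :
    LHom.comp (χ.frame.genusOne k σ τ (.inr b)) (χ.cylHom s h₁ h₂ k e₁' e₂')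
    = LHom.comp (χ.cylHom s h₁ h₂ k e₁ e₂)
      (s.lhom ((χ.fst h₁).frame.sad k σ₁ τ₁) ((χ.snd h₂).frame.genusOne k σ₂ τ₂ b)) := by
  refine (LHom.sub_comp _ _ _).trans (Eq.trans ?_ (congrArg _ (map_sub (s.lhom _) _ _)).symm)
  refine Eq.trans ?_ (map_sub _ _ _).symm
  exact congrArg₂ (· - ·) (χ.tub_glue_right s h₁ h₂ k e₁ e₂ e₁' e₂' (b, 0) (b, 1))
    (χ.tub_glue_right s h₁ h₂ k e₁ e₂ e₁' e₂' (b, 0) (b, 0))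

end

/-! ### States of a glued diagram. -/

/-- A state of a glued diagram consists of states of the two pieces. -/
def cubeEquiv : (χ.fst h₁).frame.Cube D₁.sing × (χ.snd h₂).frame.Cube D₂.sing ≃
    χ.frame.Cube (SDiagram.glue s.toGlue D₁ D₂).sing where
  toFun p := ⟨(p.1.r.disjSum p.2.r, p.1.s.disjSum p.2.s), by
    rintro (n | n) hn
    · exact p.1.2 n (Finset.inl_mem_disjSum.1 hn)
    · exact p.2.2 n (Finset.inr_mem_disjSum.1 hn)⟩
  invFun p := (⟨(Finset.toLeft (α := D₁.N) (β := D₂.N) p.r,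
      Finset.toLeft (α := D₁.N) (β := D₂.N) p.s),
      fun n hn => p.2 (.inl n) (Finset.mem_toLeft.1 hn)⟩,
    ⟨(Finset.toRight (α := D₁.N) (β := D₂.N) p.r, Finset.toRight (α := D₁.N) (β := D₂.N) p.s),
      fun n hn => p.2 (.inr n) (Finset.mem_toRight.1 hn)⟩)
  left_inv p := Prod.ext
    (Frame.Cube.ext Finset.toLeft_disjSum Finset.toLeft_disjSum)
    (Frame.Cube.ext Finset.toRight_disjSum Finset.toRight_disjSum)
  right_inv p := Frame.Cube.ext Finset.toLeft_disjSum_toRight Finset.toLeft_disjSum_toRight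

section
variable (p : (χ.fst h₁).frame.Cube D₁.sing × (χ.snd h₂).frame.Cube D₂.sing)

theorem inl_mem_s (n : D₁.N) : .inl n ∈ (χ.cubeEquiv s h₁ h₂ p).s ↔ n ∈ p.1.s :=
  Finset.inl_mem_disjSum
theorem inr_mem_s (n : D₂.N) : .inr n ∈ (χ.cubeEquiv s h₁ h₂ p).s ↔ n ∈ p.2.s :=
  Finset.inr_mem_disjSum
theorem inl_mem_r (n : D₁.N) : .inl n ∈ (χ.cubeEquiv s h₁ h₂ p).r ↔ n ∈ p.1.r :=
  Finset.inl_mem_disjSum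
theorem inr_mem_r (n : D₂.N) : .inr n ∈ (χ.cubeEquiv s h₁ h₂ p).r ↔ n ∈ p.2.r :=
  Finset.inr_mem_disjSum

/-- The smoothing at a vertex depends only on whether that vertex lies in `s` and in `r`. Together
with `smoothing_inr` this supplies the compatibility required by `smoothIso`. -/
theorem smoothing_inl (n : D₁.N) : (χ.cubeEquiv s h₁ h₂ p).smoothing (.inl n) = p.1.smoothing n := by
  classical
  exact congrArg₂ xor (decide_eq_decide.2 (χ.inl_mem_s s h₁ h₂ p n))
    (decide_eq_decide.2 (χ.inl_mem_r s h₁ h₂ p n))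

theorem smoothing_inr (n : D₂.N) : (χ.cubeEquiv s h₁ h₂ p).smoothing (.inr n) = p.2.smoothing n := by
  classical
  exact congrArg₂ xor (decide_eq_decide.2 (χ.inr_mem_s s h₁ h₂ p n))
    (decide_eq_decide.2 (χ.inr_mem_r s h₁ h₂ p n))

end
end Coloring

/-! ### Disjoint unions of finite sets, and signs of an ordering with the first part before the
second. -/

section
variable {A B : Type} [DecidableEq (A ⊕ B)]

/-- The decidable equality on `A ⊕ B` is kept arbitrary, because insertion and deletion in the cube
of a glued diagram use a classical one and not the one built from the summands. -/
theorem disjSum_eq_insert_inl [DecidableEq A] {s s' : Finset A} {t t' : Finset B} {a : A} :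
    s'.disjSum t' = insert (Sum.inl a) (s.disjSum t) ↔ s' = insert a s ∧ t' = t := by
  simp [Finset.ext_iff, Sum.forall]

theorem disjSum_eq_insert_inr [DecidableEq B] {s s' : Finset A} {t t' : Finset B} {b : B} :
    s'.disjSum t' = insert (Sum.inr b) (s.disjSum t) ↔ s' = s ∧ t' = insert b t := by
  simp [Finset.ext_iff, Sum.forall]

theorem disjSum_eq_erase_inl [DecidableEq A] {s s' : Finset A} {t t' : Finset B} {a : A} :
    s'.disjSum t' = (s.disjSum t).erase (Sum.inl a) ↔ s' = s.erase a ∧ t' = t := by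
  simp [Finset.ext_iff, Sum.forall]

theorem disjSum_eq_erase_inr [DecidableEq B] {s s' : Finset A} {t t' : Finset B} {b : B} :
    s'.disjSum t' = (s.disjSum t).erase (Sum.inr b) ↔ s' = s ∧ t' = t.erase b := by
  simp [Finset.ext_iff, Sum.forall]

omit [DecidableEq (A ⊕ B)] in
theorem disjSum_eq_disjSum {s s' : Finset A} {t t' : Finset B} :
    s'.disjSum t' = s.disjSum t ↔ s' = s ∧ t' = t := by
  simp [Finset.ext_iff, Sum.forall]
end

section
open scoped Classical
variable {A B : Type} (s : Finset A) (t : Finset B) {ν : A ⊕ B → ℕ}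

/-- No element of the second part lies below an element of the first, so the second part contributes
only factors `1`. -/
theorem prod_sign_inl {ν₁ : A → ℕ} (hl : ∀ a b, ν (.inl a) < ν (.inl b) ↔ ν₁ a < ν₁ b)
    (hlr : ∀ a b, ν (.inl a) < ν (.inr b)) (a : A) :
    ∏ b ∈ s.disjSum t, (if ν b < ν (.inl a) then (-1 : ℤ) else 1)
      = ∏ b ∈ s, if ν₁ b < ν₁ a then (-1 : ℤ) else 1 := by
  rw [Finset.prod_disjSum, Finset.prod_eq_one (s := t) fun b _ => if_neg (hlr a b).not_gt, mul_one]
  simp only [hl]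

/-- All of `s` lies below an element of the second part, and each of its elements contributes `-1`.
This is the source of the Koszul sign. -/
theorem prod_sign_inr {ν₂ : B → ℕ} (hr : ∀ a b, ν (.inr a) < ν (.inr b) ↔ ν₂ a < ν₂ b)
    (hlr : ∀ a b, ν (.inl a) < ν (.inr b)) (b : B) :
    ∏ c ∈ s.disjSum t, (if ν c < ν (.inr b) then (-1 : ℤ) else 1)
      = (-1) ^ s.card * ∏ c ∈ t, if ν₂ c < ν₂ b then (-1 : ℤ) else 1 := by
  rw [Finset.prod_disjSum]
  simp only [hr, hlr, if_true, Finset.prod_const]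
end

/-- The propositional skeleton of `step_inl`. The disjuncts are a saddle and a genus-one step: `A`
and `R` express membership of the vertex in the state and in the resolution, `B`, `C`, `E`, `S` the
changes in the piece containing the vertex, and `U`, `V` that the state and the resolution of the
other piece stay fixed. The next statement is its mirror image for `step_inr`. -/
theorem and_or_and_right_iff {A B C E R U V S : Prop} : (¬A ∧ (B ∧ U) ∧ (C ∧ V)) ∨ (A ∧ (E ∧ U) ∧ ¬R ∧ (S ∧ V)) ↔
    ((¬A ∧ B ∧ C) ∨ (A ∧ E ∧ ¬R ∧ S)) ∧ U ∧ V := by tauto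

theorem and_or_and_left_iff {A B C E R U V S : Prop} : (¬A ∧ (U ∧ B) ∧ (V ∧ C)) ∨ (A ∧ (U ∧ E) ∧ ¬R ∧ (V ∧ S)) ↔
    (U ∧ V) ∧ ((¬A ∧ B ∧ C) ∨ (A ∧ E ∧ ¬R ∧ S)) := by tauto

/-! ### Entries of the bracket complex of a single diagram: reordering, identities and degree signs.
-/

namespace Frame
variable {Z : Signed} {F : Frame Z} {k : Type*} [CommRing k] {sing : F.N → Bool}

/-- The morphism part `core` of an entry does not involve the ordering, so `reorder_step` for the
signs is all that is needed; off the steps both entries vanish. -/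
theorem entry_reorder {ν ν' : F.N → ℕ} (hν : ν.Injective) (hν' : ν'.Injective)
    (p q : F.Cube sing) (a : F.N) :
    F.reorder ν ν' q.s • F.entry k sing ν p q a = F.reorder ν ν' p.s • F.entry k sing ν' p q a := by
  by_cases h : p.Step q a
  · rw [entry_step ν h, entry_step ν' h, smul_smul, smul_smul, mul_comm, F.reorder_step hν hν' h]
  · rw [entry_not ν h, entry_not ν' h, smul_zero, smul_zero]

theorem core_of_mem {p q : F.Cube sing} {a : F.N} (h : a ∈ p.s) :
    core k p q a = F.genusOne k p.smoothing q.smoothing a := if_pos h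

theorem core_of_notMem {p q : F.Cube sing} {a : F.N} (h : a ∉ p.s) :
    core k p q a = F.sad k p.smoothing q.smoothing := if_neg h

/-- Writing the identity as a saddle surface without saddles puts the factor in which nothing
happens into the form that `sad_glue`, `genusOne_glue_left` and `genusOne_glue_right` expect. -/
theorem bracket_one_self (ν : F.N ↪ ℕ) (p : F.Cube sing) :
    (F.bracket k sing ν).one p p = F.sad k p.smoothing p.smoothing :=
  ((F.bracket k sing ν).one_self p).trans (congrArg (LHom.of k) (F.saddle_self p.smoothing).symm)

/-- The resolution enters the degree with even weight `2 |r|`, so the Koszul sign depends on the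
state alone. It can therefore agree with the sign convention of the bracket, which counts elements
of `s` only. -/
theorem negOnePow_deg (ν : F.N ↪ ℕ) (p : F.Cube sing) :
    (((F.bracket k sing ν).deg p).negOnePow : ℤ) = (-1) ^ p.s.card := by
  have e : (F.bracket k sing ν).deg p = p.s.card + 2 * p.r.card := rfl
  rw [e, Int.negOnePow_add, Int.negOnePow_even (2 * _) (even_two_mul _), mul_one,
    Int.negOnePow_def, zpow_natCast]
  simp

end Frame

/-! ### Steps, signs and unsigned entries in the cube of a glued diagram. -/

namespace Coloring
open CategoryTheory
variable {Z₁ Z₂ Z' : Signed} (s : Sew Z₁ Z₂ Z') {D₁ : SDiagram Z₁.pt} {D₂ : SDiagram Z₂.pt}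
  (χ : Coloring Z' (SDiagram.glue s.toGlue D₁ D₂))
  (h₁ : ∀ z, χ.pieces (.inl (.inr z)) = Z₁.pos z)
  (h₂ : ∀ z, χ.pieces (.inr (.inr z)) = Z₂.pos z)

section
variable (p q : (χ.fst h₁).frame.Cube D₁.sing × (χ.snd h₂).frame.Cube D₂.sing)

/-- A step at `a` changes the state and the resolution only at `a`. An equation between disjoint
unions splits into its two parts, the second of which says that the data of the second piece are
unchanged. -/
theorem step_inl (a : D₁.N) :
    (χ.cubeEquiv s h₁ h₂ p).Step (χ.cubeEquiv s h₁ h₂ q) (.inl a) ↔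
      p.1.Step q.1 a ∧ q.2 = p.2 := by
  classical
  -- An element of the cube is determined by its state and resolution, which appear separately in
  -- the definition of a step.
  have e : q.2 = p.2 ↔ q.2.s = p.2.s ∧ q.2.r = p.2.r :=
    ⟨fun h => by rw [h]; exact ⟨rfl, rfl⟩, fun h => Frame.Cube.ext h.1 h.2⟩
  have hs := χ.inl_mem_s s h₁ h₂ p a
  have hr := χ.inl_mem_r s h₁ h₂ p a
  have i1 := @disjSum_eq_insert_inl D₁.N D₂.N (Classical.decEq _) (Classical.decEq _)
    p.1.s q.1.s p.2.s q.2.s a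
  have i2 := disjSum_eq_disjSum (s := p.1.r) (t := p.2.r) (s' := q.1.r) (t' := q.2.r)
  have i3 := @disjSum_eq_erase_inl D₁.N D₂.N (Classical.decEq _) (Classical.decEq _)
    p.1.s q.1.s p.2.s q.2.s a
  have i4 := @disjSum_eq_insert_inl D₁.N D₂.N (Classical.decEq _) (Classical.decEq _)
    p.1.r q.1.r p.2.r q.2.r a
  rw [e]
  refine (or_congr (and_congr (not_congr hs) (and_congr i1 i2))
    (and_congr hs (and_congr i3 (and_congr (not_congr hr) i4)))).trans ?_
  exact and_or_and_right_iff

theorem step_inr (a : D₂.N) :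
    (χ.cubeEquiv s h₁ h₂ p).Step (χ.cubeEquiv s h₁ h₂ q) (.inr a) ↔
      q.1 = p.1 ∧ p.2.Step q.2 a := by
  classical
  have e : q.1 = p.1 ↔ q.1.s = p.1.s ∧ q.1.r = p.1.r :=
    ⟨fun h => by rw [h]; exact ⟨rfl, rfl⟩, fun h => Frame.Cube.ext h.1 h.2⟩
  have hs := χ.inr_mem_s s h₁ h₂ p a
  have hr := χ.inr_mem_r s h₁ h₂ p a
  have i1 := @disjSum_eq_insert_inr D₁.N D₂.N (Classical.decEq _) (Classical.decEq _)
    p.1.s q.1.s p.2.s q.2.s a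
  have i2 := disjSum_eq_disjSum (s := p.1.r) (t := p.2.r) (s' := q.1.r) (t' := q.2.r)
  have i3 := @disjSum_eq_erase_inr D₁.N D₂.N (Classical.decEq _) (Classical.decEq _)
    p.1.s q.1.s p.2.s q.2.s a
  have i4 := @disjSum_eq_insert_inr D₁.N D₂.N (Classical.decEq _) (Classical.decEq _)
    p.1.r q.1.r p.2.r q.2.r a
  rw [e]
  refine (or_congr (and_congr (not_congr hs) (and_congr i1 i2))
    (and_congr hs (and_congr i3 (and_congr (not_congr hr) i4)))).trans ?_
  exact and_or_and_left_iff

variable {ν : D₁.N ⊕ D₂.N ↪ ℕ} {ν₁ : D₁.N ↪ ℕ} {ν₂ : D₂.N ↪ ℕ}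

theorem sgn_inl (hl : ∀ a b, ν (.inl a) < ν (.inl b) ↔ ν₁ a < ν₁ b)
    (hlr : ∀ a b, ν (.inl a) < ν (.inr b)) (a : D₁.N) :
    χ.frame.sgn ν (χ.cubeEquiv s h₁ h₂ p).s (.inl a) = (χ.fst h₁).frame.sgn ν₁ p.1.s a := by
  classical
  refine (Frame.sgn_eq_prod _ _ _ _).trans (Eq.trans ?_ (Frame.sgn_eq_prod _ _ _ _).symm)
  exact prod_sign_inl (A := D₁.N) (B := D₂.N) p.1.s p.2.s hl hlr a

/-- The vertices in the state of the first piece all precede `b`; their number is what distinguishes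
this from `sgn_inl`. -/
theorem sgn_inr (hr : ∀ a b, ν (.inr a) < ν (.inr b) ↔ ν₂ a < ν₂ b)
    (hlr : ∀ a b, ν (.inl a) < ν (.inr b)) (b : D₂.N) :
    χ.frame.sgn ν (χ.cubeEquiv s h₁ h₂ p).s (.inr b)
      = (-1) ^ p.1.s.card * (χ.snd h₂).frame.sgn ν₂ p.2.s b := by
  classical
  refine (Frame.sgn_eq_prod _ _ _ _).trans (Eq.trans ?_
    (congrArg _ (Frame.sgn_eq_prod _ _ _ _).symm))
  exact prod_sign_inr (A := D₁.N) (B := D₂.N) p.1.s p.2.s hr hlr b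

variable (k : Type*) [CommRing k]

/-- The smoothing of a glued diagram in a given state is the glued smoothing. -/
noncomputable def stateHom : LHom k (χ.frame.smooth (χ.cubeEquiv s h₁ h₂ p).smoothing)
    (s.mfd ((χ.fst h₁).frame.smooth p.1.smoothing) ((χ.snd h₂).frame.smooth p.2.smoothing)) :=
  χ.cylHom s h₁ h₂ k (χ.smoothing_inl s h₁ h₂ p) (χ.smoothing_inr s h₁ h₂ p)

/-- Whether the entry at `a` is a saddle or a genus-one morphism is decided by membership of `a` in
the state, and this is the same for the glued diagram and for the piece. No step is assumed; in the
application the second states agree, and the second factor is an identity. -/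
theorem core_inl (a : D₁.N) :
    LHom.comp (Frame.core k (χ.cubeEquiv s h₁ h₂ p) (χ.cubeEquiv s h₁ h₂ q) (.inl a))
      (χ.stateHom s h₁ h₂ q k)
    = LHom.comp (χ.stateHom s h₁ h₂ p k) (s.lhom (Frame.core k p.1 q.1 a)
      ((χ.snd h₂).frame.sad k p.2.smoothing q.2.smoothing)) := by
  have hs := χ.inl_mem_s s h₁ h₂ p a
  by_cases h : a ∈ p.1.s
  · rw [Frame.core_of_mem (hs.2 h), Frame.core_of_mem h]
    exact χ.genusOne_glue_left s h₁ h₂ k _ _ _ _ a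
  · rw [Frame.core_of_notMem (mt hs.1 h), Frame.core_of_notMem h]
    exact χ.sad_glue s h₁ h₂ k _ _ _ _

theorem core_inr (a : D₂.N) :
    LHom.comp (Frame.core k (χ.cubeEquiv s h₁ h₂ p) (χ.cubeEquiv s h₁ h₂ q) (.inr a))
      (χ.stateHom s h₁ h₂ q k)
    = LHom.comp (χ.stateHom s h₁ h₂ p k) (s.lhom
      ((χ.fst h₁).frame.sad k p.1.smoothing q.1.smoothing) (Frame.core k p.2 q.2 a)) := by
  have hs := χ.inr_mem_s s h₁ h₂ p a
  by_cases h : a ∈ p.2.s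
  · rw [Frame.core_of_mem (hs.2 h), Frame.core_of_mem h]
    exact χ.genusOne_glue_right s h₁ h₂ k _ _ _ _ a
  · rw [Frame.core_of_notMem (mt hs.1 h), Frame.core_of_notMem h]
    exact χ.sad_glue s h₁ h₂ k _ _ _ _

end
end Coloring

/-! ### Bilinearity: multiples, zeros and sums of commuting squares, and of sewn morphisms. -/

namespace LHom
variable {k : Type*} [CommRing k] {Z : Signed} {W₀ W₁ V₀ V₁ : OneMfd Z} {u : LHom k W₀ V₀}
  {v : LHom k W₁ V₁} {a : LHom k W₀ W₁} {b : LHom k V₀ V₁}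

theorem zsmul_square (n : ℤ) (h : comp a v = comp u b) : comp (n • a) v = comp u (n • b) := by
  rw [map_zsmul, map_zsmul, LinearMap.smul_apply, h]

/-- Unlike in `zsmul_square`, the multiple ends up on a vertical arrow: it becomes the sign by which
the identification of a summand is rescaled. -/
theorem zsmul_square' (n : ℤ) (h : comp a v = comp u b) : comp (n • a) v = comp (n • u) b := by
  rw [map_zsmul, map_zsmul, LinearMap.smul_apply, LinearMap.smul_apply, h]

theorem zsmul_comp (n : ℤ) (a : LHom k W₀ W₁) (v : LHom k W₁ V₁) :
    comp (n • a) v = comp a (n • v) := by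
  rw [map_zsmul, map_zsmul, LinearMap.smul_apply]

theorem zsmul_comp_zsmul (m n : ℤ) (a : LHom k W₀ W₁) (v : LHom k W₁ V₁) :
    comp (m • a) (n • v) = (m * n) • comp a v := by
  rw [map_zsmul, map_zsmul, LinearMap.smul_apply, smul_smul, mul_comm]

theorem zero_square (u : LHom k W₀ V₀) (v : LHom k W₁ V₁) :
    comp (0 : LHom k W₀ W₁) v = comp u (0 : LHom k V₀ V₁) := by
  rw [map_zero, map_zero, LinearMap.zero_apply]

theorem add_square {a' : LHom k W₀ W₁} {b' : LHom k V₀ V₁} (h : comp a v = comp u b)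
    (h' : comp a' v = comp u b') : comp (a + a') v = comp u (b + b') := by
  rw [map_add, map_add, LinearMap.add_apply, h, h']

theorem sum_square {ι : Type*} (s : Finset ι) {f : ι → LHom k W₀ W₁} {g : ι → LHom k V₀ V₁}
    (h : ∀ i, comp (f i) v = comp u (g i)) : comp (∑ i ∈ s, f i) v = comp u (∑ i ∈ s, g i) := by
  rw [map_sum, map_sum, LinearMap.sum_apply]
  exact Finset.sum_congr rfl fun i _ => h i
end LHom

namespace Sew
variable {k : Type*} [CommRing k] {Z₁ Z₂ Z' : Signed} (s : Sew Z₁ Z₂ Z')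
    {W₁ W₁' : OneMfd Z₁} {W₂ W₂' : OneMfd Z₂} (x : LHom k W₁ W₁') (z : LHom k W₂ W₂')

theorem lhom_zsmul_left (n : ℤ) : s.lhom (n • x) z = n • s.lhom x z := by
  rw [map_zsmul, LinearMap.smul_apply]

theorem lhom_zsmul_right (n : ℤ) : s.lhom x (n • z) = n • s.lhom x z := map_zsmul _ _ _

theorem lhom_zero_left : s.lhom (0 : LHom k W₁ W₁') z = 0 := by
  rw [map_zero, LinearMap.zero_apply]

theorem lhom_zero_right : s.lhom x (0 : LHom k W₂ W₂') = 0 := map_zero _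

theorem lhom_sum_left {ι : Type*} (t : Finset ι) (f : ι → LHom k W₁ W₁') :
    s.lhom (∑ i ∈ t, f i) z = ∑ i ∈ t, s.lhom (f i) z := by
  rw [map_sum, LinearMap.sum_apply]

theorem lhom_sum_right {ι : Type*} (t : Finset ι) (f : ι → LHom k W₂ W₂') :
    s.lhom x (∑ i ∈ t, f i) = ∑ i ∈ t, s.lhom x (f i) := map_sum _ _ _
end Sew

/-! ### Identity entries. -/

namespace Frame
variable {Z : Signed} {F : Frame Z} (k : Type*) [CommRing k] {sing : F.N → Bool}

/-- The entries of the identity of the bracket complex. -/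
noncomputable def unit (ν : F.N ↪ ℕ) (p q : F.Cube sing) :
    LHom k (F.smooth p.smoothing) (F.smooth q.smoothing) := (F.bracket k sing ν).one p q

/-- The saddle morphism makes sense for any two states, so for equal but differently named states
the identity needs no transport along `h`. -/
theorem unit_of_eq (ν : F.N ↪ ℕ) {p q : F.Cube sing} (h : q = p) :
    unit k ν p q = F.sad k p.smoothing q.smoothing := by
  subst h; exact bracket_one_self ν q

theorem unit_of_ne (ν : F.N ↪ ℕ) {p q : F.Cube sing} (h : p ≠ q) : unit k ν p q = 0 :=
  (F.bracket k sing ν).one_of_ne h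

end Frame

/-! ### Comparison of the differentials, vertex by vertex. -/

namespace Coloring
open CategoryTheory
variable {Z₁ Z₂ Z' : Signed} (s : Sew Z₁ Z₂ Z') {D₁ : SDiagram Z₁.pt} {D₂ : SDiagram Z₂.pt}
  (χ : Coloring Z' (SDiagram.glue s.toGlue D₁ D₂))
  (h₁ : ∀ z, χ.pieces (.inl (.inr z)) = Z₁.pos z)
  (h₂ : ∀ z, χ.pieces (.inr (.inr z)) = Z₂.pos z) (k : Type*) [CommRing k]

section
variable (p q : (χ.fst h₁).frame.Cube D₁.sing × (χ.snd h₂).frame.Cube D₂.sing)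
  {ν : D₁.N ⊕ D₂.N ↪ ℕ} {ν₁ : D₁.N ↪ ℕ} {ν₂ : D₂.N ↪ ℕ}

/-- The contribution of a vertex of a glued diagram to the differential. -/
noncomputable def gluedEntry (ν : D₁.N ⊕ D₂.N ↪ ℕ) (a : D₁.N ⊕ D₂.N) :
    LHom k (χ.frame.smooth (χ.cubeEquiv s h₁ h₂ p).smoothing)
      (χ.frame.smooth (χ.cubeEquiv s h₁ h₂ q).smoothing) :=
  χ.frame.entry k (SDiagram.glue s.toGlue D₁ D₂).sing ν (χ.cubeEquiv s h₁ h₂ p)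
      (χ.cubeEquiv s h₁ h₂ q) a

/-- At a vertex of the first piece the glued differential is the term `d ⊗ 1`, without further sign.
For a step the signs agree by `sgn_inl` and the morphisms by `core_inl`. -/
theorem entry_inl (hl : ∀ a b, ν (.inl a) < ν (.inl b) ↔ ν₁ a < ν₁ b)
    (hlr : ∀ a b, ν (.inl a) < ν (.inr b)) (a : D₁.N) :
    LHom.comp (χ.gluedEntry s h₁ h₂ k p q ν (.inl a)) (χ.stateHom s h₁ h₂ q k)
    = LHom.comp (χ.stateHom s h₁ h₂ p k) (s.lhom ((χ.fst h₁).frame.entry k D₁.sing ν₁ p.1 q.1 a)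
      (Frame.unit (F := (χ.snd h₂).frame) k ν₂ p.2 q.2)) := by
  by_cases h : p.1.Step q.1 a ∧ q.2 = p.2
  · have h' := (χ.step_inl s h₁ h₂ p q a).2 h
    have e : Frame.unit (F := (χ.snd h₂).frame) k ν₂ p.2 q.2 
        = (χ.snd h₂).frame.sad k p.2.smoothing q.2.smoothing :=
      Frame.unit_of_eq (F := (χ.snd h₂).frame) k ν₂ h.2
    have e1 : χ.gluedEntry s h₁ h₂ k p q ν (.inl a) = (χ.fst h₁).frame.sgn ν₁ p.1.s a •
        Frame.core k (χ.cubeEquiv s h₁ h₂ p) (χ.cubeEquiv s h₁ h₂ q) (.inl a) :=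
      (Frame.entry_step (F := χ.frame) ν h').trans (congrArg (· • _) (χ.sgn_inl s h₁ h₂ p hl hlr a))
    rw [e1, Frame.entry_step (F := (χ.fst h₁).frame) ν₁ h.1, e, s.lhom_zsmul_left]
    exact LHom.zsmul_square _ (χ.core_inl s h₁ h₂ p q k a)
  -- If this is not a step of the glued cube, then either the first piece makes no step, and its
  -- entry is zero, or the second state changes, and the identity has entry zero there.
  · have e1 : χ.gluedEntry s h₁ h₂ k p q ν (.inl a) = 0 :=
      Frame.entry_not (F := χ.frame) ν (mt (χ.step_inl s h₁ h₂ p q a).1 h)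
    have e2 : s.lhom ((χ.fst h₁).frame.entry k D₁.sing ν₁ p.1 q.1 a)
        (Frame.unit (F := (χ.snd h₂).frame) k ν₂ p.2 q.2) = 0 := by
      rcases not_and_or.1 h with h | h
      · rw [Frame.entry_not (F := (χ.fst h₁).frame) ν₁ h, s.lhom_zero_left]
      · rw [Frame.unit_of_ne (F := (χ.snd h₂).frame) k ν₂ (Ne.symm h), s.lhom_zero_right]
    rw [e1, e2]
    exact LHom.zero_square _ _

/-- At a vertex of the second piece the glued differential is the term `1 ⊗ d`; the sign in front
comes from `sgn_inr`. -/
theorem entry_inr (hr : ∀ a b, ν (.inr a) < ν (.inr b) ↔ ν₂ a < ν₂ b)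
    (hlr : ∀ a b, ν (.inl a) < ν (.inr b)) (a : D₂.N) :
    LHom.comp (χ.gluedEntry s h₁ h₂ k p q ν (.inr a)) (χ.stateHom s h₁ h₂ q k)
    = LHom.comp (χ.stateHom s h₁ h₂ p k) (((-1 : ℤ) ^ p.1.s.card) •
      s.lhom (Frame.unit (F := (χ.fst h₁).frame) k ν₁ p.1 q.1)
        ((χ.snd h₂).frame.entry k D₂.sing ν₂ p.2 q.2 a)) := by
  by_cases h : q.1 = p.1 ∧ p.2.Step q.2 a
  · have h' := (χ.step_inr s h₁ h₂ p q a).2 h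
    have e : Frame.unit (F := (χ.fst h₁).frame) k ν₁ p.1 q.1 
        = (χ.fst h₁).frame.sad k p.1.smoothing q.1.smoothing :=
      Frame.unit_of_eq (F := (χ.fst h₁).frame) k ν₁ h.1
    have e1 : χ.gluedEntry s h₁ h₂ k p q ν (.inr a)
        = ((-1 : ℤ) ^ p.1.s.card * (χ.snd h₂).frame.sgn ν₂ p.2.s a) •
        Frame.core k (χ.cubeEquiv s h₁ h₂ p) (χ.cubeEquiv s h₁ h₂ q) (.inr a) :=
      (Frame.entry_step (F := χ.frame) ν h').trans (congrArg (· • _) (χ.sgn_inr s h₁ h₂ p hr hlr a))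
    rw [e1, Frame.entry_step (F := (χ.snd h₂).frame) ν₂ h.2, e, s.lhom_zsmul_right, smul_smul]
    exact LHom.zsmul_square _ (χ.core_inr s h₁ h₂ p q k a)
  · have e1 : χ.gluedEntry s h₁ h₂ k p q ν (.inr a) = 0 :=
      Frame.entry_not (F := χ.frame) ν (mt (χ.step_inr s h₁ h₂ p q a).1 h)
    have e2 : s.lhom (Frame.unit (F := (χ.fst h₁).frame) k ν₁ p.1 q.1)
        ((χ.snd h₂).frame.entry k D₂.sing ν₂ p.2 q.2 a) = 0 := by
      rcases not_and_or.1 h with h | h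
      · rw [Frame.unit_of_ne (F := (χ.fst h₁).frame) k ν₁ (Ne.symm h), s.lhom_zero_left]
      · rw [Frame.entry_not (F := (χ.snd h₂).frame) ν₂ h, s.lhom_zero_right]
    rw [e1, e2, smul_zero]
    exact LHom.zero_square _ _

end
end Coloring

/-- The differential is defined with one particular enumeration of the vertices; the sum is the same
for any other. -/
theorem Frame.bracket_d {Z : Signed} {F : Frame Z} {k : Type*} [CommRing k] {sing : F.N → Bool}
    [i : Fintype F.N] (ν : F.N ↪ ℕ) (p q : F.Cube sing) :
    (F.bracket k sing ν).d p q = ∑ a, F.entry k sing ν p q a :=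
  Finset.sum_congr (congrArg (fun i => @Finset.univ _ i) (Subsingleton.elim _ _)) fun _ _ => rfl

-- The equivalence `cubeEquiv` runs from pairs of states to states of the glued diagram, whereas the
-- cylinders run the other way. Inverting the vertical arrows reconciles the two directions.
open CategoryTheory in
theorem CategoryTheory.Iso.symm_square {C : Type*} [CategoryTheory.Category C] {A B A' B' : C}
    (u : A ≅ A') (v : B ≅ B') {f : A ⟶ B} {f' : A' ⟶ B'} (h : f ≫ v.hom = u.hom ≫ f') :
    f' ≫ v.symm.hom = u.symm.hom ≫ f := by
  rw [Iso.symm_hom, Iso.symm_hom, Iso.eq_inv_comp, ← reassoc_of% h, Iso.hom_inv_id,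
    Category.comp_id]

/-! ### Assembly of the isomorphism of complexes. -/

namespace Coloring
open CategoryTheory
variable {Z₁ Z₂ Z' : Signed} (s : Sew Z₁ Z₂ Z') {D₁ : SDiagram Z₁.pt} {D₂ : SDiagram Z₂.pt}
  (χ : Coloring Z' (SDiagram.glue s.toGlue D₁ D₂))
  (h₁ : ∀ z, χ.pieces (.inl (.inr z)) = Z₁.pos z)
  (h₂ : ∀ z, χ.pieces (.inr (.inr z)) = Z₂.pos z) (k : Type*) [CommRing k]

section
variable (p q : (χ.fst h₁).frame.Cube D₁.sing × (χ.snd h₂).frame.Cube D₂.sing)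
  {ν ν' : D₁.N ⊕ D₂.N ↪ ℕ} {ν₁ : D₁.N ↪ ℕ} {ν₂ : D₂.N ↪ ℕ}

/-- The entry of the differential of the bracket complex of a glued diagram. -/
noncomputable def gluedD (ν : D₁.N ⊕ D₂.N ↪ ℕ) :
    LHom k (χ.frame.smooth (χ.cubeEquiv s h₁ h₂ p).smoothing)
      (χ.frame.smooth (χ.cubeEquiv s h₁ h₂ q).smoothing) :=
  (χ.bracket k ν).d (χ.cubeEquiv s h₁ h₂ p) (χ.cubeEquiv s h₁ h₂ q)

theorem gluedD_eq [Fintype D₁.N] [Fintype D₂.N] : χ.gluedD s h₁ h₂ k p q ν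
      = ∑ a, χ.gluedEntry s h₁ h₂ k p q ν (.inl a) + ∑ a, χ.gluedEntry s h₁ h₂ k p q ν (.inr a) := by
  refine Eq.trans ?_ (Fintype.sum_sum_type (χ.gluedEntry s h₁ h₂ k p q ν))
  exact Finset.sum_congr (congrArg (fun i => @Finset.univ _ i) (Subsingleton.elim _ _))
    fun _ _ => rfl

/-- The entry of the differential of the tensor product of the bracket complexes of two pieces. -/
noncomputable def tensorD (ν₁ : D₁.N ↪ ℕ) (ν₂ : D₂.N ↪ ℕ) :
    LHom k (s.mfd ((χ.fst h₁).frame.smooth p.1.smoothing) ((χ.snd h₂).frame.smooth p.2.smoothing))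
      (s.mfd ((χ.fst h₁).frame.smooth q.1.smoothing) ((χ.snd h₂).frame.smooth q.2.smoothing)) :=
  (FinCx.tensor (s.biFun k) ((χ.fst h₁).bracket k ν₁) ((χ.snd h₂).bracket k ν₂)).d p q

/-- Expanding both factors over the vertices of their pieces gives one term for each vertex of the
glued diagram, in the form treated by `entry_inl` and `entry_inr`. -/
theorem tensorD_eq [Fintype D₁.N] [Fintype D₂.N] : tensorD s χ h₁ h₂ k p q ν₁ ν₂
      = ∑ a : D₁.N, s.lhom ((χ.fst h₁).frame.entry k D₁.sing ν₁ p.1 q.1 a)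
          (Frame.unit (F := (χ.snd h₂).frame) k ν₂ p.2 q.2)
        + ∑ a : D₂.N, ((-1 : ℤ) ^ p.1.s.card) •
            s.lhom (Frame.unit (F := (χ.fst h₁).frame) k ν₁ p.1 q.1)
              ((χ.snd h₂).frame.entry k D₂.sing ν₂ p.2 q.2 a) := by
  refine congrArg₂ (· + ·) ?_ ?_
  · exact (congrArg (fun x => s.lhom x _)
      (Frame.bracket_d (F := (χ.fst h₁).frame) (i := ‹Fintype D₁.N›) ν₁ p.1 q.1)).trans
      (s.lhom_sum_left _ _ _)
  -- The sign of the total complex is computed from the degree of the first factor; by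
  -- `negOnePow_deg` it is `(-1)^|s₁|`.
  · refine (congrArg₂ (fun n x => n • s.lhom _ x)
      (Frame.negOnePow_deg (k := k) (F := (χ.fst h₁).frame) ν₁ p.1)
      (Frame.bracket_d (F := (χ.snd h₂).frame) (i := ‹Fintype D₂.N›) ν₂ p.2 q.2)).trans ?_
    exact (congrArg _ (s.lhom_sum_right _ _ _)).trans Finset.smul_sum

/-- For the ordering with the first piece in front, the cylinders commute with the differentials
with no correction of signs. -/
theorem gluedD_stateHom (hl : ∀ a b, ν (.inl a) < ν (.inl b) ↔ ν₁ a < ν₁ b)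
    (hr : ∀ a b, ν (.inr a) < ν (.inr b) ↔ ν₂ a < ν₂ b) (hlr : ∀ a b, ν (.inl a) < ν (.inr b)) :
    LHom.comp (χ.gluedD s h₁ h₂ k p q ν) (χ.stateHom s h₁ h₂ q k)
    = LHom.comp (χ.stateHom s h₁ h₂ p k) (tensorD s χ h₁ h₂ k p q ν₁ ν₂) := by
  have := Fintype.ofFinite D₁.N
  have := Fintype.ofFinite D₂.N
  rw [gluedD_eq, tensorD_eq]
  exact LHom.add_square (LHom.sum_square _ fun a => χ.entry_inl s h₁ h₂ k p q hl hlr a)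
    (LHom.sum_square _ fun a => χ.entry_inr s h₁ h₂ k p q hr hlr a)

theorem gluedD_reorder :
    χ.frame.reorder ν ν' (χ.cubeEquiv s h₁ h₂ q).s • χ.gluedD s h₁ h₂ k p q ν
      = χ.frame.reorder ν ν' (χ.cubeEquiv s h₁ h₂ p).s • χ.gluedD s h₁ h₂ k p q ν' := by
  refine Finset.smul_sum.trans (Eq.trans ?_ Finset.smul_sum.symm)
  exact Finset.sum_congr rfl fun a _ =>
    Frame.entry_reorder (F := χ.frame) ν.injective ν'.injective _ _ a

/-- The inverse is the reversed mapping cylinder. -/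
theorem stateHom_iso (k : Type*) [CommRing k] : ∃ v : LHom k
      (s.mfd ((χ.fst h₁).frame.smooth p.1.smoothing) ((χ.snd h₂).frame.smooth p.2.smoothing))
      (χ.frame.smooth (χ.cubeEquiv s h₁ h₂ p).smoothing),
    LHom.comp (χ.stateHom s h₁ h₂ p k) v = LHom.of k (BHom.one _) ∧
    LHom.comp v (χ.stateHom s h₁ h₂ p k) = LHom.of k (BHom.one _) :=
  ⟨LHom.of k (BHom.cylInv (χ.smoothIso s h₁ h₂ (χ.smoothing_inl s h₁ h₂ p)
    (χ.smoothing_inr s h₁ h₂ p))), (LHom.comp_of _ _).trans (congrArg _ (BHom.cyl_cylInv _)),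
    (LHom.comp_of _ _).trans (congrArg _ (BHom.cylInv_cyl _))⟩

/-- The identification of the summands of the bracket complex of a glued diagram, with the sign that
takes account of the orderings of the vertices. -/
noncomputable def stateIso (ε : ℤ) (hε : ε * ε = 1) :
    (⟨χ.frame.smooth (χ.cubeEquiv s h₁ h₂ p).smoothing⟩ : Cob k Z') ≅
      ⟨s.mfd ((χ.fst h₁).frame.smooth p.1.smoothing) ((χ.snd h₂).frame.smooth p.2.smoothing)⟩ where
  hom := ε • χ.stateHom s h₁ h₂ p k
  -- The same sign serves for the inverse, as `ε * ε = 1`.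
  inv := ε • (χ.stateHom_iso s h₁ h₂ p k).choose
  hom_inv_id := by
    have h := (χ.stateHom_iso s h₁ h₂ p k).choose_spec.1
    refine Eq.trans ?_ h
    refine (LHom.zsmul_comp_zsmul _ _ _ _).trans ?_
    rw [hε, one_smul]
  inv_hom_id := by
    have h := (χ.stateHom_iso s h₁ h₂ p k).choose_spec.2
    refine Eq.trans ?_ h
    refine (LHom.zsmul_comp_zsmul _ _ _ _).trans ?_
    rw [hε, one_smul]

theorem deg_cubeEquiv : (χ.bracket k ν).deg (χ.cubeEquiv s h₁ h₂ p)
    = ((χ.fst h₁).bracket k ν₁).deg p.1 + ((χ.snd h₂).bracket k ν₂).deg p.2 := by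
  have e1 : (χ.cubeEquiv s h₁ h₂ p).s.card = p.1.s.card + p.2.s.card := Finset.card_disjSum _ _
  have e2 : (χ.cubeEquiv s h₁ h₂ p).r.card = p.1.r.card + p.2.r.card := Finset.card_disjSum _ _
  show ((χ.cubeEquiv s h₁ h₂ p).s.card : ℤ) + 2 * (χ.cubeEquiv s h₁ h₂ p).r.card
    = (p.1.s.card + 2 * p.1.r.card) + (p.2.s.card + 2 * p.2.r.card)
  rw [e1, e2]
  push_cast
  ring
end

/-- The bracket complex of a glued diagram is the tensor product of the bracket complexes of the
pieces along the gluing. -/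
theorem bracket_glue (ν : D₁.N ⊕ D₂.N ↪ ℕ) (ν₁ : D₁.N ↪ ℕ) (ν₂ : D₂.N ↪ ℕ) :
    Nonempty ((χ.bracket k ν).toCochain ≅
      (FinCx.tensor (s.biFun k) ((χ.fst h₁).bracket k ν₁) ((χ.snd h₂).bracket k ν₂)).toCochain) := by
  -- The given orderings of the pieces determine an ordering of the whole for which the comparison
  -- is strict; the given `ν` is related to it by the signs `ε`.
  obtain ⟨ν', hl, hr, hlr⟩ := exists_lex ν₁ ν₂
  let ε := fun p => χ.frame.reorder ν ν' (χ.cubeEquiv s h₁ h₂ p).s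
  have hε : ∀ p, ε p * ε p = 1 := fun p => χ.frame.reorder_mul_self _ _ _
  let w := fun p => χ.stateIso s h₁ h₂ k p (ε p) (hε p)
  -- The isomorphism is built from the tensor product to the glued bracket, in the direction of
  -- `cubeEquiv`, and then inverted.
  refine ⟨(FinCx.toCochainIso (K := FinCx.tensor (s.biFun k) ((χ.fst h₁).bracket k ν₁)
    ((χ.snd h₂).bracket k ν₂)) (L := χ.bracket k ν) (χ.cubeEquiv s h₁ h₂) (fun p => (w p).symm)
    (fun p => χ.deg_cubeEquiv s h₁ h₂ k p) fun p q => ?_).symm⟩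
  refine Iso.symm_square (w p) (w q) ?_
  have e := χ.gluedD_stateHom s h₁ h₂ k p q hl hr hlr
  have e' := χ.gluedD_reorder s h₁ h₂ k p q (ν := ν) (ν' := ν')
  -- The sign at the target is moved onto the differential for `ν`; `e'` exchanges it for the sign
  -- at the source together with the differential for `ν'`, to which `e` applies.
  refine (LHom.zsmul_comp (ε q) _ _).symm.trans ?_
  exact (congrArg (LHom.comp · _) e').trans (LHom.zsmul_square' (ε p) e)

end Coloring

theorem theorem5p4 (k : Type*) [CommRing k] :
    (∀ (Y₀ Y₂ : Signed) (Q : Type) [Finite Q] (D' : SDiagram (Y₀.pt ⊕ Q))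
        (D'' : SDiagram (Q ⊕ Y₂.pt))
        (χ : Coloring (Y₀.sum Y₂.neg) (SDiagram.comp D'' D'))
        (ν : (SDiagram.comp D'' D').N ↪ ℕ) (ν' : D'.N ↪ ℕ) (ν'' : D''.N ↪ ℕ),
      Nonempty ((χ.bracket k ν).toCochain ≅
        (hcomp (χ.upper.bracket k ν'') (χ.lower.bracket k ν')).toCochain)) ∧
    (∀ (Y₀ Y₁ Y₀' Y₁' : Signed) (D' : SDiagram (Y₀.pt ⊕ Y₁.pt)) (D'' : SDiagram (Y₀'.pt ⊕ Y₁'.pt))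
        (χ : Coloring ((Y₀.sum Y₀').sum (Y₁.sum Y₁').neg) (SDiagram.tensor D' D''))
        (ν : (SDiagram.tensor D' D'').N ↪ ℕ) (ν' : D'.N ↪ ℕ) (ν'' : D''.N ↪ ℕ),
      Nonempty ((χ.bracket k ν).toCochain ≅
        (otimes (χ.left.bracket k ν') (χ.right.bracket k ν'')).toCochain)) := by
  refine ⟨fun Y₀ Y₂ Q _ D' D'' χ ν ν' ν'' => ?_, fun Y₀ Y₁ Y₀' Y₁' D' D'' χ ν ν' ν'' => ?_⟩
  -- The upper diagram is the first factor, as in the horizontal composition. The signs of the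
  -- points along which the two diagrams meet are read off the colouring.
  · exact Coloring.bracket_glue (Sew.stack Y₀ χ.mid Y₂) (D₁ := D'') (D₂ := D') χ _ _ k ν ν'' ν'
  · exact Coloring.bracket_glue (Sew.side Y₀ Y₁ Y₀' Y₁') (D₁ := D') (D₂ := D'') χ _ _ k ν ν' ν''
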